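/- **Setting.** A finite ranked poset $P$ is identified with its Hasse diagram, whose edges (covering relations) $s\to t$, $s\lessdot t$, carry one color $i\in I$ each (written $s\stackrel{i}{\to}t$) and two complex labels $c_{t,s}$, $d_{s,t}$, not both $0$. The $i$-components are the connected components of the graph formed by the edges of color $i$. Put $m_i(s)=2\rho_i(s)-l_i(s)$, where $l_i(s)$ is the rank of the $i$-component of $s$ and $\rho_i(s)$ is the rank of $s$ in it. Put $\pi_{s,t}=c_{t,s}d_{s,t}$ and $\mathrm{wt}(s)=\sum_i m_i(s)\omega_i$, where $\omega_i$, $\alpha_i$ are the fundamental weights and simple roots of a semisimple Lie algebra. The conditions are: * *structure*: $\mathrm{wt}(s)+\alpha_i=\mathrm{wt}(t)$ whenever $s\stackrel{i}{\to}t$; * *crossing*: $\sum_{r:\,r\stackrel{i}{\to}s}\pi_{r,s}-\sum_{t:\,s\stackrel{i}{\to}t}\pi_{s,t}=m_i(s)$ for all $s$ and $i$; * *diamond*: for all $s\ne t$ of the same rank and all colors $i,j$ (possibly equal), $\sum_{u:\,s\stackrel{j}{\to}u,\ t\stackrel{i}{\to}u}c_{u,s}d_{t,u}=\sum_{r:\,r\stackrel{i}{\to}s,\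 r\stackrel{j}{\to}t}d_{r,s}c_{t,r}$. Let $\lambda=(\lambda_1\ge\dots\ge\lambda_n\ge0)$ be a partition with at most $n$ rows. The vertices of $GT(\lambda)$ are the semistandard Young tableaux of shape $\lambda$ with entries in $[n]=\{1,\dots,n\}$, and the colors are $1,\dots,n-1$. There is an edge $S\stackrel{k}{\to}T$ when $T$ is obtained from $S$ by changing a single entry $k+1$ into $k$. The order is the one generated by the edges. For a tableau $T$ let $\lambda^{(k)}=(\lambda_{k1}\ge\dots\ge\lambda_{kk})$ be the shape formed by its entries $\le k$; these numbers form the Gelfand–Tsetlin pattern $\Lambda$ of $T$. The outer rim $R$ of $\lambda^{(k)}$ consists of the cells $(i,j)\notin\lambda^{(k)}$ with at least one of $(i,j-1),(i-1,j),(i-1,j-1)$ in $\lambda^{(k)}$; if $\lambda^{(k)}$ is empty, $R=\{(1,1)\}$. A cell $(i,j)\in R$ is an outer corner if $(i,j-1)$ and $(i-1,j)$ are both in $R$, and an inner corner if neither is. Number the cells of $R$ from northeast to southwest starting from $1$. Let $a_1<\dots<a_p$ be the numbers of the inner corners, $r_1<\dots<r_p$ their rows, and $a'_1<\dots<a'_{p-1}$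 the numbers of the outer corners. Let $b_i$ be the length of row $r_i$ of $\lambda^{(k+1)}/\lambda^{(k)}$, and $b'_i$ the length of row $r_{i+1}-1$ of $\lambda^{(k)}/\lambda^{(k-1)}$. If $T\stackrel{k}{\to}U$ and the changed entry is in row $r_i$, put $$c_{U,T}=b_i\prod_{j<i}\Bigl(1+\frac{b_j}{a_i-a_j}\Bigr)\prod_{j>i}\Bigl(1-\frac{b_j}{a_j-a_i}\Bigr).$$ If $S\stackrel{k}{\to}T$ and the changed entry is in row $r_{i+1}-1$, put $$d_{S,T}=b'_i\prod_{j<i}\Bigl(1-\frac{b'_j}{a'_i-a'_j}\Bigr)\prod_{j>i}\Bigl(1+\frac{b'_j}{a'_j-a'_i}\Bigr).$$ **Theorem.** 1. $GT(\lambda)$ with these data is a finite edge-colored, edge-labeled ranked poset, whose covering relations are exactly the edges. It satisfies the structure condition for $\mathfrak{sl}_n$, the crossing condition and the diamond condition. 2. Consequently, on the complex vector space $V$ with basis $\{v_T\}_{T\in GT(\lambda)}$ there is a representation of $\mathfrak{sl}_n(\mathbb C)$ in which $X_k=E_{k,k+1}$, $Y_k=E_{k+1,k}$, $H_k=E_{kk}-E_{k+1,k+1}$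 ($1\le k\le n-1$) act by $$X_kv_S=\sum_{T:\,S\stackrel{k}{\to}T}c_{T,S}v_T,\qquad Y_kv_T=\sum_{S:\,S\stackrel{k}{\to}T}d_{S,T}v_S,\qquad H_kv_S=m_k(S)v_S,$$ and it is the irreducible representation with highest weight $\lambda$: it is irreducible and contains a nonzero vector killed by all $X_k$ on which each $H_k$ acts by $\lambda_k-\lambda_{k+1}$. 3. (Gelfand–Tsetlin formulas.) This representation extends to the irreducible representation of $\mathfrak{gl}_n(\mathbb C)$ with highest weight $\lambda$ on $V$, and $V$ has a basis $\{\xi_\Lambda\}$, indexed by the Gelfand–Tsetlin patterns $\Lambda$ of the tableaux in $GT(\lambda)$, such that, with $l_{ki}=\lambda_{ki}-i+1$, $$E_{kk}\xi_\Lambda=\Bigl(\sum_{i=1}^k\lambda_{ki}-\sum_{i=1}^{k-1}\lambda_{k-1,i}\Bigr)\xi_\Lambda\qquad(1\le k\le n),$$ $$E_{k,k+1}\xi_\Lambda=-\sum_{i=1}^k\frac{\prod_{m=1}^{k+1}(l_{ki}-l_{k+1,m})}{\prod_{m\le k,\,m\ne i}(l_{ki}-l_{km})}\,\xi_{\Lambda+\delta_{ki}},\qquad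 E_{k+1,k}\xi_\Lambda=\sum_{i=1}^k\frac{\prod_{m=1}^{k-1}(l_{ki}-l_{k-1,m})}{\prod_{m\le k,\,m\ne i}(l_{ki}-l_{km})}\,\xi_{\Lambda-\delta_{ki}}\qquad(1\le k\le n-1).$$ Here $\Lambda\pm\delta_{ki}$ is obtained by replacing $\lambda_{ki}$ by $\lambda_{ki}\pm1$, and $\xi_{\Lambda\pm\delta_{ki}}=0$ if this array is not a pattern. 4. For all $N\ge 0$, all pairwise distinct $x_1,\dots,x_N\in\mathbb C$ and all $y_1,\dots,y_N\in\mathbb C$, $$\sum_{i=1}^N y_i\prod_{j\ne i}\Bigl(1+\frac{y_j}{x_j-x_i}\Bigr)=\sum_{i=1}^N y_i.$$ -/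

import Mathlib

open Finset LieAlgebra.SpecialLinear

attribute [local instance 100] LieRing.ofAssociativeRing

noncomputable section

/-! ### Edge-colored and edge-labeled ranked posets -/

/-- The data carried by the Hasse diagram of a ranked poset whose edges are colored by `I` and
labeled with two complex coefficients. An edge of color `i` from `s` to `t` is `edge i s t`; its
labels are `c t s` and `d s t` (values of `c` and `d` off the edges are irrelevant). -/
structure LabeledDiagram (I P : Type*) where
  edge : I → P → P → Prop
  c : P → P → ℂ
  d : P → P → ℂ
  rank : P → ℤ

namespace LabeledDiagram

variable {I P : Type*} (D : LabeledDiagram I P)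

/-- The edges are the covering relations of the poset `P`, every edge has one color, the two labels
of an edge are not both zero, and `rank` is a rank function. -/
structure IsRankedPoset [PartialOrder P] : Prop where
  covBy_iff : ∀ s t, s ⋖ t ↔ ∃ i, D.edge i s t
  color_unique : ∀ i j s t, D.edge i s t → D.edge j s t → i = j
  label_ne_zero : ∀ i s t, D.edge i s t → D.c t s ≠ 0 ∨ D.d s t ≠ 0
  rank_covBy : ∀ s t, s ⋖ t → D.rank t = D.rank s + 1

/-- The `i`-component of `s`: the connected component of `s` in the (undirected) graph formed by
the edges of color `i`. -/
def component (i : I) (s : P) : Set P := {t | Relation.EqvGen (D.edge i) s t}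

/-- `ρ_i(s)`: the rank of `s` within its `i`-component. -/
def rho (i : I) (s : P) : ℤ := D.rank s - sInf (D.rank '' D.component i s)

/-- `l_i(s)`: the rank of the `i`-component of `s`. -/
def len (i : I) (s : P) : ℤ :=
  sSup (D.rank '' D.component i s) - sInf (D.rank '' D.component i s)

/-- `m_i(s) = 2 ρ_i(s) - l_i(s)`. -/
def m (i : I) (s : P) : ℤ := 2 * D.rho i s - D.len i s

/-- The weight `∑ i, m_i(s) ω_i`, by its coordinates in the basis of fundamental weights. -/
def wt (s : P) : I → ℤ := fun i => D.m i s

/-- The simple root `α_i = ∑ j, A j i ω_j` of the root system with Cartan matrix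
`A j i = ⟨α_j^∨, α_i⟩`, by its coordinates in the basis of fundamental weights. -/
def simpleRoot (A : Matrix I I ℤ) (i : I) : I → ℤ := fun j => A j i

/-- The structure condition for the semisimple Lie algebra with Cartan matrix `A`. -/
def StructureCondition (A : Matrix I I ℤ) : Prop :=
  ∀ i s t, D.edge i s t → D.wt s + simpleRoot A i = D.wt t

/-- The edge product `π_{s,t} = c_{t,s} d_{s,t}`. -/
def edgeProd (s t : P) : ℂ := D.c t s * D.d s t

open Classical in
/-- The crossing condition. -/
def CrossingCondition [Fintype P] : Prop :=
  ∀ s i, (∑ r with D.edge i r s, D.edgeProd r s) - (∑ t with D.edge i s t, D.edgeProd s t)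
    = (D.m i s : ℂ)

open Classical in
/-- The diamond condition, for pairs of distinct vertices of the same rank and for any two
(possibly equal) colors. -/
def DiamondCondition [Fintype P] : Prop :=
  ∀ s t, s ≠ t → D.rank s = D.rank t → ∀ i j,
    (∑ u with D.edge j s u ∧ D.edge i t u, D.c u s * D.d t u)
      = ∑ r with D.edge i r s ∧ D.edge j r t, D.d r s * D.c t r

open Classical in
/-- The operator `X_i v_s = ∑ c_{t,s} v_t` on the space `V[P]` with basis
`v_s = Finsupp.single s 1`. -/
def opX [Fintype P] (i : I) : Module.End ℂ (P →₀ ℂ) :=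
  Finsupp.linearCombination ℂ fun s => ∑ t with D.edge i s t, Finsupp.single t (D.c t s)

open Classical in
/-- The operator `Y_i v_t = ∑ d_{s,t} v_s` on `V[P]`. -/
def opY [Fintype P] (i : I) : Module.End ℂ (P →₀ ℂ) :=
  Finsupp.linearCombination ℂ fun t => ∑ s with D.edge i s t, Finsupp.single s (D.d s t)

/-- The operator `H_i v_s = m_i(s) v_s` on `V[P]`. -/
def opH (i : I) : Module.End ℂ (P →₀ ℂ) :=
  Finsupp.linearCombination ℂ fun s => Finsupp.single s (D.m i s : ℂ)

end LabeledDiagram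

/-! ### The Lie algebras `sl_n` and `gl_n` and their highest weight representations

The colors `1, …, n - 1` are encoded by `k : Fin (n - 1)`, which stands for the color `k + 1`;
the rows and columns of `n × n` matrices are numbered from `0` by `Fin n`. -/

/-- The row and column number `k` in `Fin n`. -/
def lowIdx {n : ℕ} (k : Fin (n - 1)) : Fin n := ⟨k, by omega⟩

/-- The row and column number following `lowIdx k`. -/
def highIdx {n : ℕ} (k : Fin (n - 1)) : Fin n := ⟨k + 1, by omega⟩

theorem lowIdx_ne_highIdx {n : ℕ} (k : Fin (n - 1)) : lowIdx k ≠ highIdx k := by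
  simp [lowIdx, highIdx]

/-- The Chevalley generator `X_k = E_{k,k+1}` of `sl_n`. -/
def slX {n : ℕ} (k : Fin (n - 1)) : sl (Fin n) ℂ :=
  LieAlgebra.SpecialLinear.single (lowIdx k) (highIdx k) (lowIdx_ne_highIdx k) 1

/-- The Chevalley generator `Y_k = E_{k+1,k}` of `sl_n`. -/
def slY {n : ℕ} (k : Fin (n - 1)) : sl (Fin n) ℂ :=
  LieAlgebra.SpecialLinear.single (highIdx k) (lowIdx k) (lowIdx_ne_highIdx k).symm 1

/-- The Chevalley generator `H_k = E_{k,k} - E_{k+1,k+1}` of `sl_n`. -/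
def slH {n : ℕ} (k : Fin (n - 1)) : sl (Fin n) ℂ :=
  singleSubSingle (lowIdx k) (highIdx k) 1

/-- A representation of a Lie algebra is irreducible if the corresponding Lie module is. -/
def IsIrreducibleRep {L V : Type*} [LieRing L] [LieAlgebra ℂ L] [AddCommGroup V] [Module ℂ V]
    (φ : L →ₗ⁅ℂ⁆ Module.End ℂ V) : Prop :=
  letI := LieRingModule.compLieHom V φ
  haveI := LieModule.compLieHom (R := ℂ) V φ
  LieModule.IsIrreducible ℂ L V

/-- `φ` is the irreducible representation of `sl_n` with highest weight `lam`: it is irreducible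
and has a highest weight vector, on which `H_k` acts by `lam_k - lam_{k+1}`. -/
def IsSlIrrepOfHighestWeight {n : ℕ} {V : Type*} [AddCommGroup V] [Module ℂ V]
    (lam : YoungDiagram) (φ : sl (Fin n) ℂ →ₗ⁅ℂ⁆ Module.End ℂ V) : Prop :=
  IsIrreducibleRep φ ∧ ∃ v : V, v ≠ 0 ∧ (∀ k, φ (slX k) v = 0) ∧
    ∀ k : Fin (n - 1), φ (slH k) v = ((lam.rowLen k : ℂ) - (lam.rowLen (k + 1) : ℂ)) • v

/-- `ψ` is the irreducible representation of `gl_n` with highest weight `lam`: it is irreducible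
and has a highest weight vector, on which `E_{k,k}` acts by `lam_k`. -/
def IsGlIrrepOfHighestWeight {n : ℕ} {V : Type*} [AddCommGroup V] [Module ℂ V]
    (lam : YoungDiagram) (ψ : Matrix (Fin n) (Fin n) ℂ →ₗ⁅ℂ⁆ Module.End ℂ V) : Prop :=
  IsIrreducibleRep ψ ∧ ∃ v : V, v ≠ 0 ∧
    (∀ k : Fin (n - 1), ψ (Matrix.single (lowIdx k) (highIdx k) 1) v = 0) ∧
    ∀ k : Fin n, ψ (Matrix.single k k 1) v = (lam.rowLen k : ℂ) • v

/-! ### Outer rim and corners of a Young diagram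

Cells are `(row, column)`, both numbered from `0`. -/

namespace YoungDiagram

/-- The outer rim of `ν`: the cells `(i, j)` not in `ν` such that at least one of `(i, j - 1)`,
`(i - 1, j)`, `(i - 1, j - 1)` belongs to `ν`. The outer rim of the empty diagram is, by convention,
the single cell `(0, 0)`. All these cells lie in the finite box to which we restrict. -/
def outerRim (ν : YoungDiagram) : Finset (ℕ × ℕ) :=
  {x ∈ range (ν.colLen 0 + 1) ×ˢ range (ν.rowLen 0 + 1) | x ∉ ν ∧
    (x = (0, 0) ∨ (0 < x.2 ∧ (x.1, x.2 - 1) ∈ ν) ∨ (0 < x.1 ∧ (x.1 - 1, x.2) ∈ ν) ∨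
      (0 < x.1 ∧ 0 < x.2 ∧ (x.1 - 1, x.2 - 1) ∈ ν))}

/-- Outer corners: rim cells whose left and upper neighbours both belong to the rim. -/
def outerCorners (ν : YoungDiagram) : Finset (ℕ × ℕ) :=
  {x ∈ ν.outerRim | (0 < x.2 ∧ (x.1, x.2 - 1) ∈ ν.outerRim) ∧
    (0 < x.1 ∧ (x.1 - 1, x.2) ∈ ν.outerRim)}

/-- Inner corners: rim cells for which neither the left nor the upper neighbour belongs to the
rim. -/
def innerCorners (ν : YoungDiagram) : Finset (ℕ × ℕ) :=
  {x ∈ ν.outerRim | ¬ (0 < x.2 ∧ (x.1, x.2 - 1) ∈ ν.outerRim) ∧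
    ¬ (0 < x.1 ∧ (x.1 - 1, x.2) ∈ ν.outerRim)}

/-- The number of a rim cell when the rim is numbered from northeast to southwest, starting
from `1`: the number of rim cells weakly to the northeast of it. -/
def rimNumber (ν : YoungDiagram) (x : ℕ × ℕ) : ℕ :=
  #{y ∈ ν.outerRim | y.1 ≤ x.1 ∧ x.2 ≤ y.2}

end YoungDiagram

/-! ### The Gelfand-Tsetlin lattice -/

/-- Semistandard Young tableaux of shape `lam` with entries in `{1, …, n}`. -/
def GT (lam : YoungDiagram) (n : ℕ) : Type :=
  {T : SemistandardYoungTableau lam // ∀ i j, (i, j) ∈ lam → 1 ≤ T i j ∧ T i j ≤ n}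

namespace GT

variable {lam : YoungDiagram} {n : ℕ}

/-- The entry of `T` in a cell (and `0` outside the shape). -/
def entry (T : GT lam n) (x : ℕ × ℕ) : ℕ := T.1 x.1 x.2

theorem entry_ext {S T : GT lam n} (h : ∀ x, S.entry x = T.entry x) : S = T :=
  Subtype.ext (SemistandardYoungTableau.ext fun i j => h (i, j))

theorem entry_of_notMem (T : GT lam n) {x : ℕ × ℕ} (hx : x ∉ lam) : T.entry x = 0 :=
  T.1.zeros hx

instance : Finite (GT lam n) := by
  refine Finite.of_injective
    (fun (T : GT lam n) (x : lam.cells) => (⟨T.entry x, ?_⟩ : Fin (n + 1))) ?_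
  · exact Nat.lt_succ_of_le (T.2 _ _ ((YoungDiagram.mem_cells _).1 x.2)).2
  · intro S T h
    refine entry_ext fun x => ?_
    by_cases hx : x ∈ lam
    · have h1 := congrFun h ⟨x, (YoungDiagram.mem_cells _).2 hx⟩
      simpa using h1
    · rw [entry_of_notMem S hx, entry_of_notMem T hx]

instance : Fintype (GT lam n) := Fintype.ofFinite _

/-- `T` is obtained from `S` by decreasing the entry in the cell `x` by one. -/
def ChangesAt (S T : GT lam n) (x : ℕ × ℕ) : Prop :=
  S.entry x = T.entry x + 1 ∧ ∀ y, y ≠ x → S.entry y = T.entry y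

/-- The edge of color `k` from `S` to `T`: the tableau `T` is obtained from `S` by changing a single
entry `k + 1` into `k`. -/
def Edge (k : ℕ) (S T : GT lam n) : Prop :=
  ∃ x ∈ lam.cells, ChangesAt S T x ∧ T.entry x = k

theorem entry_le_of_reflTransGen {S T : GT lam n}
    (h : Relation.ReflTransGen (fun S T => ∃ k, Edge k S T) S T) (x : ℕ × ℕ) :
    T.entry x ≤ S.entry x := by
  induction h with
  | refl => exact le_rfl
  | tail _ h ih =>
    obtain ⟨k, y, -, ⟨h1, h2⟩, -⟩ := h
    refine le_trans ?_ ih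
    by_cases hxy : x = y
    · subst hxy; omega
    · exact (h2 x hxy).ge

/-- The partial order generated by the edges. -/
instance : PartialOrder (GT lam n) where
  le := Relation.ReflTransGen fun S T => ∃ k, Edge k S T
  le_refl _ := Relation.ReflTransGen.refl
  le_trans _ _ _ := Relation.ReflTransGen.trans
  le_antisymm _ _ h h' := entry_ext fun x =>
    le_antisymm (entry_le_of_reflTransGen h' x) (entry_le_of_reflTransGen h x)

/-- The Young diagram `λ^(k)` formed by the cells of `T` with entries at most `k`. -/
def shape (T : GT lam n) (k : ℕ) : YoungDiagram where
  cells := {x ∈ lam.cells | T.entry x ≤ k}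
  isLowerSet := by
    rintro ⟨i, j⟩ ⟨i', j'⟩ ⟨hi, hj⟩ h
    simp only [coe_filter, YoungDiagram.mem_cells, Set.mem_ofPred_eq] at h ⊢
    have h1 : (i, j') ∈ lam := lam.up_left_mem le_rfl hj h.1
    refine ⟨lam.up_left_mem hi hj h.1, ?_⟩
    exact ((T.1.col_weak hi h1).trans (T.1.row_weak_of_le hj h.1)).trans h.2

/-- `λ_{k,i}`, the entries of the Gelfand-Tsetlin pattern of `T` (with `i` numbered from `0`). -/
def pattern (T : GT lam n) (k i : ℕ) : ℕ := (T.shape k).rowLen i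

/-- The length of the component of `λ^(k+1)/λ^(k)` in the row of the inner corner `x` of
`λ^(k)`. -/
def bIn (T : GT lam n) (k : ℕ) (x : ℕ × ℕ) : ℂ :=
  (T.pattern (k + 1) x.1 : ℂ) - (T.pattern k x.1 : ℂ)

/-- The length of the component of `λ^(k)/λ^(k-1)` in the row just above the outer corner `x` of
`λ^(k)`. (The `i`-th outer corner is in the same row as the `(i+1)`-st inner corner.) -/
def bOut (T : GT lam n) (k : ℕ) (x : ℕ × ℕ) : ℂ :=
  (T.pattern k (x.1 - 1) : ℂ) - (T.pattern (k - 1) (x.1 - 1) : ℂ)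

/-- The number of a cell in the outer rim of `λ^(k)`. -/
def num (T : GT lam n) (k : ℕ) (x : ℕ × ℕ) : ℕ := (T.shape k).rimNumber x

/-- The label `c` of the edge of color `k` going out of `T` whose changed entry is in the inner
corner `x` of `λ^(k)`. -/
def cCoeff (T : GT lam n) (k : ℕ) (x : ℕ × ℕ) : ℂ :=
  T.bIn k x *
    (∏ y ∈ (T.shape k).innerCorners with T.num k y < T.num k x,
      (1 + T.bIn k y / ((T.num k x : ℂ) - (T.num k y : ℂ)))) *
    ∏ y ∈ (T.shape k).innerCorners with T.num k x < T.num k y,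
      (1 - T.bIn k y / ((T.num k y : ℂ) - (T.num k x : ℂ)))

/-- The label `d` of the edge of color `k` coming into `T` whose changed entry is in the row just
above the outer corner `x` of `λ^(k)`. -/
def dCoeff (T : GT lam n) (k : ℕ) (x : ℕ × ℕ) : ℂ :=
  T.bOut k x *
    (∏ y ∈ (T.shape k).outerCorners with T.num k y < T.num k x,
      (1 - T.bOut k y / ((T.num k x : ℂ) - (T.num k y : ℂ)))) *
    ∏ y ∈ (T.shape k).outerCorners with T.num k x < T.num k y,
      (1 + T.bOut k y / ((T.num k y : ℂ) - (T.num k x : ℂ)))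

open Classical in
/-- `c_{U,T}` for an edge from `T` to `U`. The sum has exactly one term: the changed cell `x`, which
is an inner corner of `λ^(k)` for `T`, where `k`, the entry of `U` at `x`, is the color. -/
def cLabel (U T : GT lam n) : ℂ :=
  ∑ x ∈ lam.cells with ChangesAt T U x, T.cCoeff (U.entry x) x

open Classical in
/-- `d_{S,T}` for an edge from `S` to `T`. The sum has exactly one term: the changed cell `x`; the
cell diagonally below it is an outer corner of `λ^(k)` for `T`, where `k`, the entry of `T` at `x`,
is the color. -/
def dLabel (S T : GT lam n) : ℂ :=
  ∑ x ∈ lam.cells with ChangesAt S T x, T.dCoeff (T.entry x) (x.1 + 1, x.2 + 1)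

variable (lam n)

/-- The edge-colored and edge-labeled ranked poset `GT(lam)`. -/
def diagram : LabeledDiagram (Fin (n - 1)) (GT lam n) where
  edge k S T := Edge (k + 1) S T
  c U T := cLabel U T
  d S T := dLabel S T
  rank T := ∑ x ∈ lam.cells, ((n : ℤ) - (T.entry x : ℤ))

variable {lam n}

/-! ### The Gelfand-Tsetlin formulas -/

/-- The numbers `l_{k,i} = λ_{k,i} - i + 1`; here `i` is numbered from `0`. -/
def l (T : GT lam n) (k i : ℕ) : ℂ := (T.pattern k i : ℂ) - (i : ℂ)

/-- The pattern of `U` is obtained from that of `T` by replacing `λ_{k,i}` by `λ_{k,i} + 1`. -/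
def IsPatternAdd (T U : GT lam n) (k i : ℕ) : Prop :=
  ∀ m j, U.pattern m j = T.pattern m j + if m = k ∧ j = i then 1 else 0

/-- The coefficient of `ξ_{Λ + δ_{k,i}}` in `E_{k,k+1} ξ_Λ`. -/
def raiseCoeff (T : GT lam n) (k i : ℕ) : ℂ :=
  -((∏ m ∈ range (k + 1), (T.l k i - T.l (k + 1) m)) /
    ∏ m ∈ (range k).erase i, (T.l k i - T.l k m))

/-- The coefficient of `ξ_{Λ - δ_{k,i}}` in `E_{k+1,k} ξ_Λ`. -/
def lowerCoeff (T : GT lam n) (k i : ℕ) : ℂ :=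
  (∏ m ∈ range (k - 1), (T.l k i - T.l (k - 1) m)) /
    ∏ m ∈ (range k).erase i, (T.l k i - T.l k m)

open Classical in
/-- The Gelfand-Tsetlin formulas for the action of the generators of `gl_n` on a family of vectors
parametrized by the Gelfand-Tsetlin patterns, the latter being identified with tableaux. For each
`i` the inner sum has at most one term, and it is empty if the modified array is not a pattern.
The index `k` in `E_{k,k}`, `E_{k,k+1}`, `E_{k+1,k}` is `k + 1` here, as `k` is numbered from `0`. -/
def SatisfiesGTFormulas {V : Type*} [AddCommGroup V] [Module ℂ V]
    (ψ : Matrix (Fin n) (Fin n) ℂ →ₗ⁅ℂ⁆ Module.End ℂ V) (ξ : GT lam n → V) : Prop :=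
  (∀ (k : Fin n) (T : GT lam n), ψ (Matrix.single k k 1) (ξ T) =
    ((∑ i ∈ range (k + 1), (T.pattern (k + 1) i : ℂ)) - ∑ i ∈ range k, (T.pattern k i : ℂ)) • ξ T) ∧
  (∀ (k : Fin (n - 1)) (T : GT lam n), ψ (Matrix.single (lowIdx k) (highIdx k) 1) (ξ T) =
    ∑ i ∈ range (k + 1), ∑ U with IsPatternAdd T U (k + 1) i, T.raiseCoeff (k + 1) i • ξ U) ∧
  (∀ (k : Fin (n - 1)) (T : GT lam n), ψ (Matrix.single (highIdx k) (lowIdx k) 1) (ξ T) =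
    ∑ i ∈ range (k + 1), ∑ S with IsPatternAdd S T (k + 1) i, T.lowerCoeff (k + 1) i • ξ S)

end GT

end

/-!
The proof translates tableaux into Gelfand–Tsetlin patterns. A tableau is the same thing as its
pattern (`GT.pattern_ext`, `GT.exists_pattern_eq`), and an edge of color `k` adds `1` to one entry
of row `k` (`GT.edge_iff`). Hence, within a component of color `k`, the entries of row `k` vary
independently of each other, each in the interval that the rows `k - 1` and `k + 1` leave to it.
Reflecting every entry in its interval exchanges the extreme ranks of the component, so `m_k` is
twice the sum of row `k` minus the sums of the rows `k - 1` and `k + 1` (`GT.diagram_m`). The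
structure condition follows.

Along the rim of the shape of level `k` the number of a cell is row minus column up to a constant
(`YoungDiagram.rimNumber_add`), and rows without a corner contribute trivial factors. So the labels
are products over all rows of the pattern, in terms of the numbers `l_{k,i}` and of the differences
between neighbouring rows (`GT.cRow`, `GT.dRow`). The crossing condition is then the
partial fraction identity of the last part, `sum_mul_prod_one_add_div`, with the nodes `l_{k,j}` and
`l_{k,j} - 1`; the identity itself is Lagrange interpolation for the difference of two products.
For the diamond condition, both sums have at most one term, given by the entrywise maximum and
minimum of the two patterns, and the products of labels agree (`GT.cRow_mul_dRow_eq`).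

The crossing and diamond conditions say that `[X_i, Y_j] = δ_{ij} H_i`, and the operators have the
right weights. On a finite-dimensional space the Serre relations are then automatic, because
`End V` is a finite-dimensional `sl_2`-module under each triple. A Chevalley system satisfying the
Serre relations extends to all matrix units by taking iterated commutators, one row and column at a
time (`IsGlChevalleySystem.exists_isGlSystem`), which gives the representation of `gl_n`; the
representation of `sl_n` is its restriction.

For irreducibility, a vector killed by all `X_k` is a multiple of the basis vector of the maximal
tableau (`GT.eq_highest_of_killed`), and the same holds for the transposes of the `Y_k`. So a nonzero
invariant subspace contains the highest weight vector, while the annihilator of a proper one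
contains the corresponding coordinate functional, and the two are incompatible
(`LabeledDiagram.eq_top_of_invariant`). The Gelfand–Tsetlin formulas come from rescaling the basis by
`GT.normalization`, a product of factorials that turns the labels into the classical coefficients.
-/

/-! ### Gelfand-Tsetlin patterns of tableaux -/

namespace GT

variable {lam : YoungDiagram} {n : ℕ}

theorem lt_pattern_iff (T : GT lam n) {k i j : ℕ} :
    j < T.pattern k i ↔ (i, j) ∈ lam ∧ T.entry (i, j) ≤ k := by
  rw [pattern, ← YoungDiagram.mem_iff_lt_rowLen, ← YoungDiagram.mem_cells]
  simp [shape]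

theorem pattern_mono (T : GT lam n) {k m : ℕ} (h : k ≤ m) (i : ℕ) :
    T.pattern k i ≤ T.pattern m i := by
  refine le_of_forall_lt fun j hj => ?_
  rw [lt_pattern_iff] at hj ⊢
  exact ⟨hj.1, hj.2.trans h⟩

theorem pattern_anti (T : GT lam n) (k : ℕ) {i j : ℕ} (h : i ≤ j) :
    T.pattern k j ≤ T.pattern k i :=
  YoungDiagram.rowLen_anti _ _ _ h

theorem pattern_succ_succ_le (T : GT lam n) (k i : ℕ) :
    T.pattern (k + 1) (i + 1) ≤ T.pattern k i := by
  refine le_of_forall_lt fun j hj => ?_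
  rw [lt_pattern_iff] at hj ⊢
  have h := T.1.col_strict (Nat.lt_add_one i) hj.1
  have h2 : T.1 (i + 1) j ≤ k + 1 := hj.2
  refine ⟨lam.up_left_mem (Nat.le_succ i) le_rfl hj.1, ?_⟩
  change T.1 i j ≤ k
  omega

theorem pattern_eq_rowLen (T : GT lam n) {k : ℕ} (h : n ≤ k) (i : ℕ) :
    T.pattern k i = lam.rowLen i := by
  refine eq_of_forall_lt_iff fun j => ?_
  rw [lt_pattern_iff, ← YoungDiagram.mem_iff_lt_rowLen]
  exact ⟨fun h => h.1, fun hj => ⟨hj, (T.2 _ _ hj).2.trans h⟩⟩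

@[simp]
theorem pattern_zero (T : GT lam n) (i : ℕ) : T.pattern 0 i = 0 := by
  by_contra h
  have h1 := (T.lt_pattern_iff (k := 0) (i := i) (j := 0)).1 (by omega)
  have h2 : 1 ≤ T.entry (i, 0) := (T.2 _ _ h1.1).1
  omega

theorem pattern_eq_zero (T : GT lam n) {k i : ℕ} (h : k ≤ i) : T.pattern k i = 0 := by
  induction k generalizing i with
  | zero => simp
  | succ k ih =>
    obtain ⟨i, rfl⟩ : ∃ i', i = i' + 1 := ⟨i - 1, by omega⟩
    have := T.pattern_succ_succ_le k i
    rw [ih (by omega)] at this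
    omega

theorem entry_le_iff (T : GT lam n) {i j k : ℕ} (h : (i, j) ∈ lam) :
    T.entry (i, j) ≤ k ↔ j < T.pattern k i := by
  rw [lt_pattern_iff]; tauto

/-- A tableau is determined by its Gelfand-Tsetlin pattern. -/
theorem pattern_ext {S T : GT lam n} (h : ∀ k i, S.pattern k i = T.pattern k i) : S = T := by
  refine entry_ext fun ⟨i, j⟩ => ?_
  by_cases hx : (i, j) ∈ lam
  · refine eq_of_forall_ge_iff fun k => ?_
    rw [entry_le_iff _ hx, entry_le_iff _ hx, h]
  · rw [entry_of_notMem _ hx, entry_of_notMem _ hx]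

/-- Every array satisfying the interlacing and boundary conditions is the Gelfand-Tsetlin pattern of
a tableau: the entry in the cell `(i, j)` is the least `k` with `j < p k i`. -/
theorem exists_pattern_eq (p : ℕ → ℕ → ℕ) (h0 : ∀ i, p 0 i = 0)
    (hmono : ∀ k i, p k i ≤ p (k + 1) i) (hlace : ∀ k i, p (k + 1) (i + 1) ≤ p k i)
    (htop : ∀ k, n ≤ k → ∀ i, p k i = lam.rowLen i) :
    ∃ T : GT lam n, ∀ k i, T.pattern k i = p k i := by
  classical
  have hm : ∀ i, Monotone fun k => p k i := fun i => monotone_nat_of_le_succ fun k => hmono k i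
  have hex : ∀ {i j}, (i, j) ∈ lam → ∃ k, j < p k i := fun {i j} h =>
    ⟨n, by rw [htop n le_rfl]; exact YoungDiagram.mem_iff_lt_rowLen.1 h⟩
  let en : ℕ → ℕ → ℕ := fun i j => if h : (i, j) ∈ lam then Nat.find (hex h) else 0
  have hen : ∀ {i j} k, (i, j) ∈ lam → (en i j ≤ k ↔ j < p k i) := by
    intro i j k h
    simp only [en, h, dif_pos]
    refine ⟨fun hk => lt_of_lt_of_le (Nat.find_spec (hex h)) (hm i hk), fun hk => ?_⟩
    exact Nat.find_min' _ hk
  have hpos : ∀ {i j}, (i, j) ∈ lam → 1 ≤ en i j := by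
    intro i j h
    by_contra hc
    have := (hen 0 h).1 (by omega)
    simp [h0] at this
  let T : SemistandardYoungTableau lam :=
    { entry := en
      row_weak' := by
        intro i j1 j2 hj h2
        rw [hen _ (lam.up_left_mem le_rfl hj.le h2)]
        exact lt_trans hj ((hen _ h2).1 le_rfl)
      col_strict' := by
        have step : ∀ i j, (i + 1, j) ∈ lam → en i j < en (i + 1) j := by
          intro i j h
          have h1 := hpos h
          have h2 := (hen _ h).1 le_rfl
          have h3 : en i j ≤ en (i + 1) j - 1 := by
            rw [hen _ (lam.up_left_mem (Nat.le_succ i) le_rfl h)]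
            refine lt_of_lt_of_le h2 ?_
            obtain ⟨m, hm⟩ : ∃ m, en (i + 1) j = m + 1 := ⟨en (i + 1) j - 1, by omega⟩
            rw [hm]
            exact hlace m i
          omega
        intro i1 i2 j hi h2
        induction hi with
        | refl => exact step _ _ h2
        | step hi ih =>
          exact (ih (lam.up_left_mem (Nat.le_succ _) le_rfl h2)).trans (step _ _ h2)
      zeros' := by
        intro i j h
        simp [en, h] }
  have hle : ∀ i j, (i, j) ∈ lam → en i j ≤ n := fun i j h => by
    rw [hen _ h, htop n le_rfl]
    exact YoungDiagram.mem_iff_lt_rowLen.1 h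
  let T' : GT lam n := ⟨T, fun i j h => ⟨hpos h, hle i j h⟩⟩
  refine ⟨T', fun k i => ?_⟩
  refine eq_of_forall_lt_iff fun j => ?_
  rw [lt_pattern_iff]
  change (i, j) ∈ lam ∧ en i j ≤ k ↔ _
  constructor
  · rintro ⟨h, hk⟩
    exact (hen k h).1 hk
  · intro hj
    have h : (i, j) ∈ lam := by
      rw [YoungDiagram.mem_iff_lt_rowLen, ← htop (max n k) (le_max_left _ _)]
      exact lt_of_lt_of_le hj (hm i (le_max_right _ _))
    exact ⟨h, (hen k h).2 hj⟩

/-! ### Edges as elementary moves of patterns -/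

namespace IsPatternAdd

variable {S T U : GT lam n} {k i : ℕ}

theorem pattern_self (h : IsPatternAdd S T k i) : T.pattern k i = S.pattern k i + 1 := by
  simpa using h k i

theorem pattern_of_ne (h : IsPatternAdd S T k i) {m j : ℕ} (hne : m ≠ k ∨ j ≠ i) :
    T.pattern m j = S.pattern m j := by
  have := h m j
  rw [if_neg (by tauto)] at this
  simpa using this

theorem row_lt (h : IsPatternAdd S T k i) : i < k := by
  by_contra hc
  have h1 := h.pattern_self
  rw [pattern_eq_zero T (by omega)] at h1
  omega

theorem pos (h : IsPatternAdd S T k i) : 0 < k := lt_of_le_of_lt (Nat.zero_le _) h.row_lt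

theorem level_lt (h : IsPatternAdd S T k i) : k < n := by
  by_contra hc
  have h1 := h.pattern_self
  rw [pattern_eq_rowLen T (by omega), pattern_eq_rowLen S (by omega)] at h1
  omega

theorem right_unique (h : IsPatternAdd S T k i) (h' : IsPatternAdd S U k i) : T = U :=
  pattern_ext fun m j => by rw [h m j, h' m j]

theorem left_unique (h : IsPatternAdd S U k i) (h' : IsPatternAdd T U k i) : S = T :=
  pattern_ext fun m j => by
    have h1 := h m j
    have h2 := h' m j
    omega

theorem indices_unique (h : IsPatternAdd S T k i) {m j : ℕ} (h' : IsPatternAdd S T m j) :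
    k = m ∧ i = j := by
  by_contra hc
  have h1 := h.pattern_self
  rw [h'.pattern_of_ne (by omega)] at h1
  omega

/-- The cell whose entry is changed is the first one after row `i` of the shape of level `k`. -/
theorem changesAt (h : IsPatternAdd S T k i) :
    (i, S.pattern k i) ∈ lam ∧ ChangesAt S T (i, S.pattern k i) ∧
      T.entry (i, S.pattern k i) = k := by
  have hself := h.pattern_self
  have hx : (i, S.pattern k i) ∈ lam :=
    (T.lt_pattern_iff.1 (by omega : S.pattern k i < T.pattern k i)).1
  have hlt : ∀ m, m < k → T.pattern m i ≤ S.pattern k i := fun m hm => by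
    rw [h.pattern_of_ne (Or.inl hm.ne)]
    exact S.pattern_mono hm.le i
  have hT : T.entry (i, S.pattern k i) = k := by
    refine eq_of_forall_ge_iff fun m => ?_
    rw [entry_le_iff _ hx]
    constructor
    · intro h1
      by_contra hc
      have := hlt m (by omega)
      omega
    · intro hm
      have := T.pattern_mono hm i
      omega
  have hS : S.entry (i, S.pattern k i) = k + 1 := by
    refine eq_of_forall_ge_iff fun m => ?_
    rw [entry_le_iff _ hx]
    constructor
    · intro h1
      by_contra hc
      have := S.pattern_mono (by omega : m ≤ k) i
      omega
    · intro hm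
      have h1 := T.pattern_mono (Nat.le_add_right k 1) i
      have h2 := S.pattern_mono (by omega : k + 1 ≤ m) i
      rw [h.pattern_of_ne (m := k + 1) (Or.inl (by omega))] at h1
      omega
  refine ⟨hx, ⟨by omega, ?_⟩, hT⟩
  rintro ⟨r, j⟩ hne
  by_cases hy : (r, j) ∈ lam
  · refine eq_of_forall_ge_iff fun m => ?_
    rw [entry_le_iff _ hy, entry_le_iff _ hy]
    by_cases hmr : m = k ∧ r = i
    · obtain ⟨rfl, rfl⟩ := hmr
      have : j ≠ S.pattern m r := fun hj => hne (by rw [hj])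
      omega
    · rw [h.pattern_of_ne (by tauto)]
  · rw [entry_of_notMem _ hy, entry_of_notMem _ hy]

theorem edge (h : IsPatternAdd S T k i) : Edge k S T :=
  ⟨_, (YoungDiagram.mem_cells _).2 h.changesAt.1, h.changesAt.2⟩

end IsPatternAdd

theorem isPatternAdd_of_changesAt {S T : GT lam n} {x : ℕ × ℕ} (hx : x ∈ lam)
    (h : ChangesAt S T x) :
    IsPatternAdd S T (T.entry x) x.1 ∧ x.2 = S.pattern (T.entry x) x.1 := by
  obtain ⟨i, j⟩ := x
  set k := T.entry (i, j) with hk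
  have hSx : S.entry (i, j) = k + 1 := h.1
  have h1 : S.pattern k i ≤ j := by
    by_contra hc
    have := (S.lt_pattern_iff.1 (not_le.1 hc)).2
    omega
  have h2 : j < T.pattern k i := T.lt_pattern_iff.2 ⟨hx, hk.ge⟩
  have hne : ∀ j', j' ≠ j → ∀ m, (j' < T.pattern m i ↔ j' < S.pattern m i) := by
    intro j' hj m
    rw [lt_pattern_iff, lt_pattern_iff, h.2 (i, j') (by simpa using hj)]
  have h3 : T.pattern k i = j + 1 := by
    by_contra hc
    have := (hne (j + 1) (by omega) k).1 (by omega)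
    omega
  have h4 : S.pattern k i = j := by
    by_contra hc
    have := (hne (S.pattern k i) hc k).1 (by omega)
    omega
  refine ⟨fun m r => ?_, h4.symm⟩
  by_cases hmr : m = k ∧ r = i
  · obtain ⟨rfl, rfl⟩ := hmr
    simp [h3, h4]
  · rw [if_neg (by simpa using hmr), add_zero]
    refine eq_of_forall_lt_iff fun j' => ?_
    rw [lt_pattern_iff, lt_pattern_iff]
    by_cases hrj : (r, j') = (i, j)
    · obtain ⟨rfl, rfl⟩ := Prod.mk.inj hrj
      rw [hSx, ← hk]
      have : m ≠ k := fun hm => hmr ⟨hm, rfl⟩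
      constructor
      · rintro ⟨h5, h6⟩; exact ⟨h5, by omega⟩
      · rintro ⟨h5, h6⟩; exact ⟨h5, by omega⟩
    · rw [h.2 _ hrj]

theorem edge_iff {S T : GT lam n} {k : ℕ} : Edge k S T ↔ ∃ i, IsPatternAdd S T k i := by
  constructor
  · rintro ⟨x, hx, hc, rfl⟩
    exact ⟨x.1, (isPatternAdd_of_changesAt ((YoungDiagram.mem_cells _).1 hx) hc).1⟩
  · rintro ⟨i, h⟩
    exact h.edge

theorem changesAt_iff_of_isPatternAdd {S T : GT lam n} {k i : ℕ} (h : IsPatternAdd S T k i)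
    {x : ℕ × ℕ} (hx : x ∈ lam) : ChangesAt S T x ↔ x = (i, S.pattern k i) := by
  constructor
  · intro hc
    obtain ⟨h1, h2⟩ := isPatternAdd_of_changesAt hx hc
    obtain ⟨h3, h4⟩ := h.indices_unique h1
    rw [h3, h4, ← h2]
  · rintro rfl
    exact h.changesAt.2.1

/-- A move is possible as soon as the interlacing inequalities at the changed entry allow it. -/
theorem exists_isPatternAdd {S : GT lam n} {k i : ℕ} (hik : i < k) (hk : k < n)
    (h1 : S.pattern k i < S.pattern (k + 1) i)
    (h2 : i = 0 ∨ S.pattern k i < S.pattern (k - 1) (i - 1)) :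
    ∃ T, IsPatternAdd S T k i := by
  refine exists_pattern_eq (fun m j => S.pattern m j + if m = k ∧ j = i then 1 else 0) ?_ ?_ ?_ ?_
  · intro j
    rw [if_neg (by omega)]; simp
  · intro m j
    have := S.pattern_mono (Nat.le_add_right m 1) j
    by_cases hm : m = k ∧ j = i
    · obtain ⟨rfl, rfl⟩ := hm
      simp; omega
    · rw [if_neg hm]; omega
  · intro m j
    have := S.pattern_succ_succ_le m j
    by_cases hm : m + 1 = k ∧ j + 1 = i
    · obtain ⟨rfl, rfl⟩ := hm
      simp at h2 ⊢; omega
    · rw [if_neg hm]; omega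
  · intro m hm j
    rw [if_neg (by omega), S.pattern_eq_rowLen hm, add_zero]

/-- A move leading to `T` exists as soon as the dual inequalities hold at the changed entry. -/
theorem exists_isPatternAdd_to {T : GT lam n} {k i : ℕ} (hk : k < n) (hpos : 0 < k)
    (h1 : T.pattern (k - 1) i < T.pattern k i)
    (h2 : T.pattern (k + 1) (i + 1) < T.pattern k i) :
    ∃ S, IsPatternAdd S T k i := by
  obtain ⟨S, hS⟩ := exists_pattern_eq (lam := lam) (n := n)
    (fun m j => T.pattern m j - if m = k ∧ j = i then 1 else 0)
    (by simp)
    (by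
      intro m j
      have := T.pattern_mono (Nat.le_add_right m 1) j
      by_cases hm : m + 1 = k ∧ j = i
      · obtain ⟨rfl, rfl⟩ := hm
        simp at h1 ⊢; omega
      · rw [if_neg hm]; omega)
    (by
      intro m j
      have := T.pattern_succ_succ_le m j
      by_cases hm : m = k ∧ j = i
      · obtain ⟨rfl, rfl⟩ := hm
        simp; omega
      · rw [if_neg hm]; omega)
    (by
      intro m hm j
      rw [if_neg (by omega), T.pattern_eq_rowLen hm, Nat.sub_zero])
  refine ⟨S, fun m j => ?_⟩
  rw [hS]
  split_ifs with h
  · obtain ⟨rfl, rfl⟩ := h; omega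
  · rfl

end GT

/-! ### The poset of tableaux and its rank function -/

namespace GT

variable {lam : YoungDiagram} {n : ℕ}

/-- The sum of row `k` of the Gelfand-Tsetlin pattern of `T`. -/
def rowSum (T : GT lam n) (k : ℕ) : ℤ := ∑ i ∈ range k, (T.pattern k i : ℤ)

theorem IsPatternAdd.rowSum_eq {S T : GT lam n} {k i : ℕ} (h : IsPatternAdd S T k i) (m : ℕ) :
    T.rowSum m = S.rowSum m + if m = k then 1 else 0 := by
  unfold rowSum
  by_cases hm : m = k
  · subst hm
    simp only [h m _, Nat.cast_add, sum_add_distrib]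
    simp [h.row_lt]
  · simp [h m _, hm]

theorem rank_of_isPatternAdd {S T : GT lam n} {k i : ℕ} (h : IsPatternAdd S T k i) :
    (diagram lam n).rank T = (diagram lam n).rank S + 1 := by
  obtain ⟨hx, ⟨h1, h2⟩, -⟩ := h.changesAt
  have hx' := (YoungDiagram.mem_cells _).2 hx
  change ∑ x ∈ lam.cells, ((n : ℤ) - (T.entry x : ℤ)) =
    ∑ x ∈ lam.cells, ((n : ℤ) - (S.entry x : ℤ)) + 1
  rw [← add_sum_erase _ _ hx', ← add_sum_erase _ _ hx', h1]
  have h3 : ∑ y ∈ lam.cells.erase (i, S.pattern k i), ((n : ℤ) - (S.entry y : ℤ)) =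
      ∑ y ∈ lam.cells.erase (i, S.pattern k i), ((n : ℤ) - (T.entry y : ℤ)) :=
    sum_congr rfl fun y hy => by rw [h2 y (ne_of_mem_erase hy)]
  rw [h3]
  push_cast
  ring

theorem diagram_edge_iff {S T : GT lam n} {k : Fin (n - 1)} :
    (diagram lam n).edge k S T ↔ ∃ i, IsPatternAdd S T (k + 1) i :=
  edge_iff

theorem rank_of_edge {S T : GT lam n} {k : ℕ} (h : Edge k S T) :
    (diagram lam n).rank T = (diagram lam n).rank S + 1 := by
  obtain ⟨i, h⟩ := edge_iff.1 h
  exact rank_of_isPatternAdd h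

theorem rank_mono {S T : GT lam n} (h : S ≤ T) :
    (diagram lam n).rank S ≤ (diagram lam n).rank T := by
  change Relation.ReflTransGen (fun S T => ∃ k, Edge k S T) S T at h
  induction h with
  | refl => exact le_rfl
  | tail _ h ih =>
    obtain ⟨k, h⟩ := h
    have := rank_of_edge h
    omega

theorem exists_edge_of_lt {S T : GT lam n} (h : S < T) : ∃ k U, Edge k S U ∧ U ≤ T := by
  have h1 : Relation.ReflTransGen (fun S T : GT lam n => ∃ k, Edge k S T) S T := h.le
  obtain h2 | ⟨U, ⟨k, h2⟩, h3⟩ := h1.cases_head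
  · exact absurd h2 h.ne
  · exact ⟨k, U, h2, h3⟩

theorem rank_strictMono {S T : GT lam n} (h : S < T) :
    (diagram lam n).rank S < (diagram lam n).rank T := by
  obtain ⟨k, U, h1, h2⟩ := exists_edge_of_lt h
  have h3 := rank_of_edge h1
  have h4 := rank_mono h2
  omega

theorem lt_of_edge {S T : GT lam n} {k : ℕ} (h : Edge k S T) : S < T := by
  have h1 : S ≤ T := Relation.ReflTransGen.single ⟨k, h⟩
  refine lt_of_le_of_ne h1 fun hST => ?_
  have := rank_of_edge h
  rw [hST] at this
  omega

theorem covBy_iff_edge {S T : GT lam n} : S ⋖ T ↔ ∃ k : Fin (n - 1), (diagram lam n).edge k S T := by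
  constructor
  · intro h
    obtain ⟨k, U, h1, h2⟩ := exists_edge_of_lt h.lt
    obtain rfl : U = T := by
      by_contra hne
      exact h.2 (lt_of_edge h1) (lt_of_le_of_ne h2 hne)
    obtain ⟨i, hi⟩ := edge_iff.1 h1
    have hpos := hi.pos
    have hlt := hi.level_lt
    refine ⟨⟨k - 1, by omega⟩, ?_⟩
    rw [diagram_edge_iff]
    exact ⟨i, by simpa [Nat.sub_add_cancel hpos] using hi⟩
  · rintro ⟨k, h⟩
    refine ⟨lt_of_edge h, fun U h1 h2 => ?_⟩
    have h3 := rank_strictMono h1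
    have h4 := rank_strictMono h2
    have h5 : (diagram lam n).rank T = (diagram lam n).rank S + 1 := rank_of_edge h
    omega

theorem edge_color_unique {S T : GT lam n} {k m : Fin (n - 1)} (h : (diagram lam n).edge k S T)
    (h' : (diagram lam n).edge m S T) : k = m := by
  obtain ⟨i, h⟩ := diagram_edge_iff.1 h
  obtain ⟨j, h'⟩ := diagram_edge_iff.1 h'
  have := (h.indices_unique h').1
  exact Fin.ext (by omega)

/-! ### Components of one color and the structure condition -/

/-- Two tableaux whose patterns agree outside row `k` are connected by edges of color `k`. -/
theorem eqvGen_edge_of_pattern_eq {k : ℕ} (hk : k < n) (S T : GT lam n)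
    (h : ∀ m, m ≠ k → ∀ j, S.pattern m j = T.pattern m j) :
    Relation.EqvGen (Edge k) S T := by
  induction hd : ∑ j ∈ range k, ((S.pattern k j - T.pattern k j) + (T.pattern k j - S.pattern k j))
    using Nat.strong_induction_on generalizing S T with
  | _ d ih =>
    by_cases hST : S = T
    · rw [hST]; exact Relation.EqvGen.refl _
    have hex : ∃ j, S.pattern k j ≠ T.pattern k j := by
      by_contra hc
      refine hST (pattern_ext fun m j => ?_)
      by_cases hm : m = k
      · subst hm
        by_contra hne
        exact hc ⟨j, hne⟩
      · exact h m hm j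
    obtain ⟨j, hj⟩ := hex
    wlog hlt : S.pattern k j < T.pattern k j generalizing S T
    · refine Relation.EqvGen.symm _ _ (this T S (fun m hm j => (h m hm j).symm) ?_ (Ne.symm hST)
        hj.symm (by omega))
      rw [← hd]
      exact sum_congr rfl fun j _ => add_comm _ _
    have hjk : j < k := by
      by_contra hc
      rw [pattern_eq_zero T (by omega)] at hlt
      omega
    obtain ⟨U, hU⟩ := exists_isPatternAdd (S := S) hjk hk
      (by
        rw [h (k + 1) (by omega)]
        exact lt_of_lt_of_le hlt (T.pattern_mono (Nat.le_add_right k 1) j))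
      (by
        rcases Nat.eq_zero_or_pos j with h0 | h0
        · exact Or.inl h0
        · right
          rw [h (k - 1) (by omega)]
          have := T.pattern_succ_succ_le (k - 1) (j - 1)
          rw [Nat.sub_add_cancel h0, Nat.sub_add_cancel (by omega : 1 ≤ k)] at this
          omega)
    refine Relation.EqvGen.trans _ _ _ (Relation.EqvGen.rel _ _ hU.edge) (ih _ ?_ U T ?_ rfl)
    · rw [← hd]
      refine sum_lt_sum (fun m _ => ?_) ⟨j, mem_range.2 hjk, ?_⟩
      · have := hU k m
        by_cases hm : m = j
        · subst hm
          simp at this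
          omega
        · simp [hm] at this
          omega
      · have := hU.pattern_self
        omega
    · intro m hm i
      rw [hU.pattern_of_ne (Or.inl hm), h m hm]

theorem mem_component_iff {k : Fin (n - 1)} {S T : GT lam n} :
    T ∈ (diagram lam n).component k S ↔
      ∀ m, m ≠ (k : ℕ) + 1 → ∀ j, S.pattern m j = T.pattern m j := by
  constructor
  · intro h
    change Relation.EqvGen (Edge (k + 1)) S T at h
    induction h with
    | rel S T h =>
      obtain ⟨i, h⟩ := edge_iff.1 h
      exact fun m hm j => (h.pattern_of_ne (Or.inl hm)).symm
    | refl => exact fun _ _ _ => rfl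
    | symm S T _ ih => exact fun m hm j => (ih m hm j).symm
    | trans S T U _ _ ih1 ih2 => exact fun m hm j => (ih1 m hm j).trans (ih2 m hm j)
  · exact eqvGen_edge_of_pattern_eq (by omega) S T

theorem rank_sub_rowSum_of_mem_component {k : Fin (n - 1)} {S T : GT lam n}
    (h : T ∈ (diagram lam n).component k S) :
    (diagram lam n).rank T - T.rowSum (k + 1) = (diagram lam n).rank S - S.rowSum (k + 1) := by
  change Relation.EqvGen (Edge (k + 1)) S T at h
  induction h with
  | rel S T h =>
    obtain ⟨i, h⟩ := edge_iff.1 h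
    rw [rank_of_isPatternAdd h, h.rowSum_eq, if_pos rfl]
    ring
  | refl => rfl
  | symm S T _ ih => exact ih.symm
  | trans S T U _ _ ih1 ih2 => exact ih2.trans ih1

/-- Summation by parts behind the reflection of a row of a pattern in the interval allowed by the
neighbouring rows `a` (above) and `b` (below). -/
theorem sum_max_add_min (a b : ℕ → ℕ) (q : ℕ) :
    ∑ j ∈ range (q + 1), (max (a j) (b (j + 1)) + if j = 0 then b 0 else min (b j) (a (j - 1))) =
      ∑ j ∈ range q, a j + ∑ j ∈ range (q + 1), b j + max (a q) (b (q + 1)) := by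
  induction q with
  | zero => simp [add_comm]
  | succ q ih =>
    rw [sum_range_succ, ih, sum_range_succ a, sum_range_succ b (q + 1)]
    simp only [Nat.add_eq_zero_iff, one_ne_zero, and_false, if_false, Nat.add_sub_cancel]
    have := max_add_min (a q) (b (q + 1))
    rw [min_comm] at this
    omega

/-- The reflection of row `k + 1` of a pattern: each entry is reflected in the interval allowed by
the rows `k` and `k + 2`, so that its sum with the original entry depends on these rows only. -/
theorem exists_reflection {k : ℕ} (hk : k + 1 < n) (T : GT lam n) :
    ∃ U : GT lam n, (∀ m, m ≠ k + 1 → ∀ j, T.pattern m j = U.pattern m j) ∧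
      U.rowSum (k + 1) + T.rowSum (k + 1) = T.rowSum k + T.rowSum (k + 2) := by
  let M : ℕ → ℕ := fun j => max (T.pattern k j) (T.pattern (k + 2) (j + 1)) +
    if j = 0 then T.pattern (k + 2) 0 else min (T.pattern (k + 2) j) (T.pattern k (j - 1))
  have hlow : ∀ j, max (T.pattern k j) (T.pattern (k + 2) (j + 1)) ≤ T.pattern (k + 1) j :=
    fun j => max_le (T.pattern_mono (Nat.le_add_right k 1) j) (T.pattern_succ_succ_le _ _)
  have hhigh : ∀ j, T.pattern (k + 1) j ≤
      if j = 0 then T.pattern (k + 2) 0 else min (T.pattern (k + 2) j) (T.pattern k (j - 1)) := by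
    intro j
    have h1 := T.pattern_mono (Nat.le_add_right (k + 1) 1) j
    rcases j with _ | j
    · simpa using h1
    · simpa using ⟨h1, T.pattern_succ_succ_le k j⟩
  have hhigh' : ∀ j, (if j = 0 then T.pattern (k + 2) 0 else
      min (T.pattern (k + 2) j) (T.pattern k (j - 1))) ≤ T.pattern (k + 2) j := by
    intro j
    split_ifs with h
    · rw [h]
    · exact min_le_left _ _
  have hM : ∀ j, M j = max (T.pattern k j) (T.pattern (k + 2) (j + 1)) +
    if j = 0 then T.pattern (k + 2) 0 else min (T.pattern (k + 2) j) (T.pattern k (j - 1)) :=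
    fun _ => rfl
  obtain ⟨U, hU⟩ := exists_pattern_eq (lam := lam) (n := n)
    (fun m j => if m = k + 1 then M j - T.pattern (k + 1) j else T.pattern m j)
    (by simp)
    (by
      intro m j
      have h1 := hlow j
      have h2 := hhigh j
      have h3 := hhigh' j
      have h4 := hM j
      have h5 := T.pattern_mono (Nat.le_add_right m 1) j
      by_cases hm : m = k + 1
      · subst hm
        rw [if_pos rfl, if_neg (by omega)]
        change _ ≤ T.pattern (k + 2) j
        omega
      · rw [if_neg hm]
        split_ifs with hm'
        · obtain rfl : m = k := by omega
          have := le_max_left (T.pattern m j) (T.pattern (m + 2) (j + 1))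
          omega
        · exact h5)
    (by
      intro m j
      have h5 := T.pattern_succ_succ_le m j
      by_cases hm : m = k + 1
      · subst hm
        rw [if_pos rfl, if_neg (by omega)]
        have h1 := hlow j
        have h2 := hhigh j
        have h4 := hM j
        have := le_max_right (T.pattern k j) (T.pattern (k + 2) (j + 1))
        change T.pattern (k + 2) (j + 1) ≤ _
        omega
      · rw [if_neg hm]
        split_ifs with hm'
        · obtain rfl : m = k := by omega
          have h1 := hlow (j + 1)
          have h2 := hhigh (j + 1)
          have h4 := hM (j + 1)
          simp only [Nat.add_eq_zero_iff, one_ne_zero, and_false, if_false,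
            Nat.add_sub_cancel] at h2 h4
          have := min_le_right (T.pattern (m + 2) (j + 1)) (T.pattern m j)
          omega
        · exact h5)
    (by
      intro m hm j
      rw [if_neg (by omega), T.pattern_eq_rowLen hm])
  refine ⟨U, fun m hm j => by rw [hU, if_neg hm], ?_⟩
  have hsum := sum_max_add_min (T.pattern k) (T.pattern (k + 2)) k
  rw [pattern_eq_zero T (le_refl k), max_eq_right (Nat.zero_le _), add_assoc,
    ← sum_range_succ (T.pattern (k + 2))] at hsum
  have h1 : ∑ j ∈ range (k + 1), U.pattern (k + 1) j + ∑ j ∈ range (k + 1), T.pattern (k + 1) j =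
      ∑ j ∈ range k, T.pattern k j + ∑ j ∈ range (k + 2), T.pattern (k + 2) j := by
    rw [← hsum, ← sum_add_distrib]
    refine sum_congr rfl fun j _ => ?_
    rw [hU, if_pos rfl]
    have h1 := hlow j
    have h2 := hhigh j
    have h4 := hM j
    omega
  unfold rowSum
  exact_mod_cast h1

/-- The number `m_k` in terms of the row sums of the pattern: since the rows of color `k` can be
reflected within their component, the smallest and the largest rank in the component are exchanged,
and their sum is determined by the two neighbouring rows. -/
theorem diagram_m (k : Fin (n - 1)) (T : GT lam n) :
    (diagram lam n).m k T = 2 * T.rowSum (k + 1) - T.rowSum k - T.rowSum (k + 2) := by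
  set A : Set ℤ := (diagram lam n).rank '' (diagram lam n).component k T with hA
  set C : ℤ := 2 * (diagram lam n).rank T - 2 * T.rowSum (k + 1) + T.rowSum k + T.rowSum (k + 2)
    with hC
  have hfin : A.Finite := (Set.toFinite _).image _
  have hne : A.Nonempty := ⟨_, T, mem_component_iff.2 fun _ _ _ => rfl, rfl⟩
  -- The set `A` of ranks in the component is symmetric, so its extreme elements add up to `C`.
  have hsymm : ∀ x ∈ A, C - x ∈ A := by
    rintro _ ⟨S, hS, rfl⟩
    obtain ⟨U, hU, hsum⟩ := exists_reflection (by omega : (k : ℕ) + 1 < n) S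
    have hS' := mem_component_iff.1 hS
    have hUT : U ∈ (diagram lam n).component k T :=
      mem_component_iff.2 fun m hm j => (hS' m hm j).trans (hU m hm j)
    refine ⟨U, hUT, ?_⟩
    have h1 := rank_sub_rowSum_of_mem_component hUT
    have h2 := rank_sub_rowSum_of_mem_component hS
    have h3 : S.rowSum k = T.rowSum k :=
      sum_congr rfl fun j _ => by rw [hS' k (by omega)]
    have h4 : S.rowSum (k + 2) = T.rowSum (k + 2) :=
      sum_congr rfl fun j _ => by rw [hS' (k + 2) (by omega)]
    rw [h3, h4] at hsum
    linarith
  have hsInf : sInf A ∈ A := hne.csInf_mem hfin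
  have hsSup : sSup A ∈ A := hne.csSup_mem hfin
  have h1 : sInf A ≤ C - sSup A := csInf_le hfin.bddBelow (hsymm _ hsSup)
  have h2 : C - sInf A ≤ sSup A := le_csSup hfin.bddAbove (hsymm _ hsInf)
  have h3 : (diagram lam n).m k T = 2 * ((diagram lam n).rank T - sInf A) - (sSup A - sInf A) := rfl
  rw [h3]
  linarith

theorem structureCondition : (diagram lam n).StructureCondition (CartanMatrix.A (n - 1)) := by
  intro k S T h
  obtain ⟨i, h⟩ := diagram_edge_iff.1 h
  funext j
  change (diagram lam n).m j S + CartanMatrix.A (n - 1) j k = (diagram lam n).m j T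
  rw [diagram_m, diagram_m, h.rowSum_eq, h.rowSum_eq, h.rowSum_eq]
  simp only [CartanMatrix.A, Matrix.of_apply, Fin.ext_iff]
  split_ifs <;> omega

end GT

/-! ### The rim of a Young diagram in terms of its row lengths -/

namespace YoungDiagram

variable (ν : YoungDiagram)

theorem mem_outerRim_iff {i j : ℕ} :
    (i, j) ∈ ν.outerRim ↔ ν.rowLen i ≤ j ∧
      ((i = 0 ∧ j = ν.rowLen 0) ∨ (0 < i ∧ j ≤ ν.rowLen (i - 1) ∧ 0 < ν.rowLen (i - 1))) := by
  have hbox : 0 < i → 0 < ν.rowLen (i - 1) → i ≤ ν.colLen 0 := by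
    intro hi h
    have := mem_iff_lt_colLen.1 (mem_iff_lt_rowLen.2 h)
    omega
  have h1 := ν.rowLen_anti 0 (i - 1) (Nat.zero_le _)
  have h2 := ν.rowLen_anti (i - 1) i (Nat.sub_le _ _)
  simp only [outerRim, mem_filter, mem_product, mem_range, mem_iff_lt_rowLen, Prod.mk.injEq, not_lt]
  rcases Nat.eq_zero_or_pos i with rfl | hi
  · omega
  · have h3 := hbox hi
    constructor
    · rintro ⟨-, h4, h5⟩
      omega
    · rintro ⟨h4, h5⟩
      have h6 : i ≤ ν.colLen 0 := h3 (by omega)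
      omega

theorem mem_innerCorners_iff {i j : ℕ} :
    (i, j) ∈ ν.innerCorners ↔ j = ν.rowLen i ∧ (i = 0 ∨ ν.rowLen i < ν.rowLen (i - 1)) := by
  have h1 := ν.rowLen_anti (i - 1) i (Nat.sub_le _ _)
  have h2 := ν.rowLen_anti (i - 1 - 1) (i - 1) (Nat.sub_le _ _)
  simp only [innerCorners, mem_filter, mem_outerRim_iff]
  rcases Nat.eq_zero_or_pos i with rfl | hi
  · omega
  · rcases Nat.eq_zero_or_pos (i - 1) with h0 | h0
    · rw [h0] at *
      omega
    · omega

theorem mem_outerCorners_iff {i j : ℕ} :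
    (i, j) ∈ ν.outerCorners ↔ 0 < i ∧ j = ν.rowLen (i - 1) ∧ ν.rowLen i < j := by
  have h1 := ν.rowLen_anti (i - 1) i (Nat.sub_le _ _)
  have h2 := ν.rowLen_anti (i - 1 - 1) (i - 1) (Nat.sub_le _ _)
  simp only [outerCorners, mem_filter, mem_outerRim_iff]
  rcases Nat.eq_zero_or_pos i with rfl | hi
  · omega
  · rcases Nat.eq_zero_or_pos (i - 1) with h0 | h0
    · rw [h0] at *
      omega
    · omega

theorem innerCorners_subset : ν.innerCorners ⊆ ν.outerRim := filter_subset _ _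

theorem outerCorners_subset : ν.outerCorners ⊆ ν.outerRim := filter_subset _ _

/-- The number of a rim cell is, up to a constant, its row minus its column: going from northeast to
southwest the rim moves by one cell to the left or downwards. -/
theorem rimNumber_add {i j : ℕ} (h : (i, j) ∈ ν.outerRim) :
    ν.rimNumber (i, j) + j = ν.rowLen 0 + i + 1 := by
  induction i generalizing j with
  | zero =>
    have hj : j = ν.rowLen 0 := by
      have := ν.mem_outerRim_iff.1 h
      omega
    have : ν.rimNumber (0, j) = 1 := by
      rw [rimNumber, card_eq_one]
      refine ⟨(0, j), ?_⟩
      ext ⟨a, b⟩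
      simp only [mem_filter, mem_outerRim_iff, mem_singleton, Prod.mk.injEq]
      constructor
      · omega
      · rintro ⟨rfl, rfl⟩
        omega
    omega
  | succ i ih =>
    have hj := ν.mem_outerRim_iff.1 h
    simp only [Nat.add_eq_zero_iff, one_ne_zero, and_false, false_and, false_or,
      Nat.add_sub_cancel] at hj
    have hi : (i, ν.rowLen i) ∈ ν.outerRim := by
      rw [mem_outerRim_iff]
      have h1 := ν.rowLen_anti (i - 1) i (Nat.sub_le _ _)
      rcases Nat.eq_zero_or_pos i with rfl | hi
      · omega
      · omega
    have hset : {y ∈ ν.outerRim | y.1 ≤ i + 1 ∧ j ≤ y.2} =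
        {y ∈ ν.outerRim | y.1 ≤ i ∧ ν.rowLen i ≤ y.2} ∪ {i + 1} ×ˢ Icc j (ν.rowLen i) := by
      ext ⟨a, b⟩
      simp only [mem_filter, mem_union, mem_product, mem_singleton, mem_Icc]
      constructor
      · rintro ⟨h1, h2, h3⟩
        rcases Nat.lt_or_ge i a with h4 | h4
        · obtain rfl : a = i + 1 := by omega
          have := ν.mem_outerRim_iff.1 h1
          simp only [Nat.add_eq_zero_iff, one_ne_zero, and_false, false_and, false_or,
            Nat.add_sub_cancel] at this
          omega
        · have h5 := (ν.mem_outerRim_iff.1 h1).1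
          have h6 := ν.rowLen_anti a i h4
          exact Or.inl ⟨h1, h4, h6.trans h5⟩
      · rintro (⟨h1, h2, h3⟩ | ⟨rfl, h2, h3⟩)
        · exact ⟨h1, by omega, by omega⟩
        · refine ⟨?_, le_rfl, h2⟩
          rw [mem_outerRim_iff]
          simp only [Nat.add_sub_cancel]
          omega
    have hdisj : Disjoint {y ∈ ν.outerRim | y.1 ≤ i ∧ ν.rowLen i ≤ y.2}
        ({i + 1} ×ˢ Icc j (ν.rowLen i)) := by
      rw [disjoint_left]
      rintro ⟨a, b⟩ h1 h2
      simp only [mem_filter, mem_product, mem_singleton] at h1 h2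
      omega
    have hih : #{y ∈ ν.outerRim | y.1 ≤ i ∧ ν.rowLen i ≤ y.2} + ν.rowLen i = ν.rowLen 0 + i + 1 :=
      ih hi
    have hcard : ν.rimNumber (i + 1, j) =
        #{y ∈ ν.outerRim | y.1 ≤ i ∧ ν.rowLen i ≤ y.2} + (ν.rowLen i + 1 - j) := by
      rw [rimNumber]
      simp only
      rw [hset, card_union_of_disjoint hdisj, card_product, card_singleton, Nat.card_Icc, one_mul]
    omega

end YoungDiagram

/-! ### The edge labels in terms of patterns -/

/-- The two products in the definition of the edge labels, over the corners before and after a given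
one, have factors of the same form. -/
theorem prod_filter_lt_mul_prod_filter_gt {ι : Type*} [DecidableEq ι] (s : Finset ι) (N : ι → ℕ)
    (b : ι → ℂ) (hN : Set.InjOn N s) {x : ι} (hx : x ∈ s) :
    (∏ y ∈ s with N y < N x, (1 + b y / ((N x : ℂ) - (N y : ℂ)))) *
      ∏ y ∈ s with N x < N y, (1 - b y / ((N y : ℂ) - (N x : ℂ))) =
    ∏ y ∈ s.erase x, (1 + b y / ((N x : ℂ) - (N y : ℂ))) := by
  have h1 : ∏ y ∈ s with N x < N y, (1 - b y / ((N y : ℂ) - (N x : ℂ))) =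
      ∏ y ∈ s with N x < N y, (1 + b y / ((N x : ℂ) - (N y : ℂ))) :=
    prod_congr rfl fun y _ => by rw [← neg_sub (N x : ℂ), div_neg, sub_neg_eq_add]
  have hset : s.erase x = {y ∈ s | N y < N x} ∪ {y ∈ s | N x < N y} := by
    ext y
    simp only [mem_erase, mem_union, mem_filter]
    constructor
    · rintro ⟨h2, h3⟩
      have : N y ≠ N x := fun h => h2 (hN h3 hx h)
      rcases lt_or_gt_of_ne this with h | h
      · exact Or.inl ⟨h3, h⟩
      · exact Or.inr ⟨h3, h⟩
    · rintro (⟨h2, h3⟩ | ⟨h2, h3⟩)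
      · exact ⟨fun h => by rw [h] at h3; exact lt_irrefl _ h3, h2⟩
      · exact ⟨fun h => by rw [h] at h3; exact lt_irrefl _ h3, h2⟩
  rw [h1, hset, prod_union]
  rw [disjoint_left]
  intro y h2 h3
  exact lt_asymm (mem_filter.1 h2).2 (mem_filter.1 h3).2

namespace GT

variable {lam : YoungDiagram} {n : ℕ}

/-- The difference of the `j`-th entries of the rows `k + 1` and `k` of a pattern. -/
noncomputable def gap (T : GT lam n) (k j : ℕ) : ℂ :=
  (T.pattern (k + 1) j : ℂ) - (T.pattern k j : ℂ)

/-- The label `c` of the edge along which the `i`-th entry of row `k` is increased, as a product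
over all rows instead of the inner corners. -/
noncomputable def cRow (T : GT lam n) (k i : ℕ) : ℂ :=
  T.gap k i * ∏ j ∈ (range (k + 1)).erase i, (1 + T.gap k j / (T.l k j - T.l k i))

/-- The label `d` of the edge along which the `i`-th entry of row `k` was increased to give `T`, as
a product over all rows instead of the outer corners. -/
noncomputable def dRow (T : GT lam n) (k i : ℕ) : ℂ :=
  T.gap (k - 1) i * ∏ j ∈ (range k).erase i, (1 + T.gap (k - 1) j / (T.l k i - T.l k j))

theorem l_strictAnti (T : GT lam n) (k : ℕ) {i j : ℕ} (h : i < j) :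
    ((T.pattern k j : ℤ) - j) < (T.pattern k i : ℤ) - i := by
  have := T.pattern_anti k h.le
  omega

theorem l_injective (T : GT lam n) (k : ℕ) : Function.Injective (T.l k) := by
  intro i j h
  have h1 : (T.pattern k i : ℤ) - i = (T.pattern k j : ℤ) - j := by
    have h2 : ((T.pattern k i : ℂ) - i) = (T.pattern k j : ℂ) - j := h
    exact_mod_cast h2
  rcases lt_trichotomy i j with h2 | h2 | h2
  · have := T.l_strictAnti k h2; omega
  · exact h2
  · have := T.l_strictAnti k h2; omega

theorem num_of_mem_innerCorners (T : GT lam n) (k : ℕ) {x : ℕ × ℕ}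
    (hx : x ∈ (T.shape k).innerCorners) :
    (T.num k x : ℂ) = T.pattern k 0 + 1 - T.l k x.1 := by
  obtain ⟨i, j⟩ := x
  have h1 := (T.shape k).rimNumber_add ((T.shape k).innerCorners_subset hx)
  have h2 := ((T.shape k).mem_innerCorners_iff.1 hx).1
  have h3 : T.num k (i, j) + T.pattern k i = T.pattern k 0 + i + 1 := by
    rw [h2] at h1 ⊢
    exact h1
  have h4 : (T.num k (i, j) : ℂ) + T.pattern k i = T.pattern k 0 + i + 1 := by exact_mod_cast h3
  simp only [l]
  linear_combination h4

theorem num_of_mem_outerCorners (T : GT lam n) (k : ℕ) {x : ℕ × ℕ}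
    (hx : x ∈ (T.shape k).outerCorners) :
    (T.num k x : ℂ) = T.pattern k 0 + 2 - T.l k (x.1 - 1) := by
  obtain ⟨i, j⟩ := x
  have h1 := (T.shape k).rimNumber_add ((T.shape k).outerCorners_subset hx)
  obtain ⟨h0, h2, -⟩ := (T.shape k).mem_outerCorners_iff.1 hx
  obtain ⟨i, rfl⟩ : ∃ i', i = i' + 1 := ⟨i - 1, by omega⟩
  have h3 : T.num k (i + 1, j) + T.pattern k i = T.pattern k 0 + (i + 1) + 1 := by
    rw [h2] at h1 ⊢
    exact h1
  have h4 : (T.num k (i + 1, j) : ℂ) + T.pattern k i = T.pattern k 0 + (i + 1) + 1 := by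
    exact_mod_cast h3
  simp only [l, Nat.add_sub_cancel]
  linear_combination h4

theorem cCoeff_eq (T : GT lam n) (k i : ℕ)
    (hx : (i, T.pattern k i) ∈ (T.shape k).innerCorners) :
    T.cCoeff k (i, T.pattern k i) = T.cRow k i := by
  have hinner : ∀ {a b}, (a, b) ∈ (T.shape k).innerCorners ↔
      b = T.pattern k a ∧ (a = 0 ∨ T.pattern k a < T.pattern k (a - 1)) :=
    (T.shape k).mem_innerCorners_iff
  have hinj : Set.InjOn (T.num k) (T.shape k).innerCorners := by
    rintro ⟨a, b⟩ ha ⟨a', b'⟩ ha' h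
    have h1 := T.num_of_mem_innerCorners k ha
    rw [h, T.num_of_mem_innerCorners k ha'] at h1
    have h2 : a' = a := T.l_injective k (sub_right_injective h1)
    subst h2
    rw [(hinner.1 ha).1, (hinner.1 ha').1]
  rw [cCoeff, mul_assoc, prod_filter_lt_mul_prod_filter_gt _ _ _ hinj hx, cRow]
  congr 1
  refine prod_of_injOn Prod.fst ?_ ?_ ?_ ?_
  · rintro ⟨a, b⟩ ha ⟨a', b'⟩ ha' (rfl : a = a')
    rw [(hinner.1 (mem_of_mem_erase ha)).1, (hinner.1 (mem_of_mem_erase ha')).1]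
  · rintro ⟨a, b⟩ ha
    obtain ⟨h1, h2⟩ := mem_erase.1 (mem_coe.1 ha)
    obtain ⟨h3, h4⟩ := hinner.1 h2
    refine mem_coe.2 (mem_erase.2 ⟨?_, mem_range.2 ?_⟩)
    · rintro (rfl : a = i)
      exact h1 (by rw [h3])
    · by_contra hc
      change ¬ a < k + 1 at hc
      rw [pattern_eq_zero T (by omega : k ≤ a - 1)] at h4
      omega
  · intro r hr hr'
    have h1 : ¬ (r = 0 ∨ T.pattern k r < T.pattern k (r - 1)) := by
      intro h
      refine hr' ⟨(r, T.pattern k r), mem_coe.2 (mem_erase.2 ⟨?_, hinner.2 ⟨rfl, h⟩⟩), rfl⟩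
      intro h2
      exact (mem_erase.1 hr).1 (Prod.mk.inj h2).1
    -- A row without inner corner is as long as the row above it, so nothing fits in between.
    have h2 : T.pattern (k + 1) r = T.pattern k r := by
      obtain ⟨r, rfl⟩ : ∃ r', r = r' + 1 := ⟨r - 1, by omega⟩
      have h3 := T.pattern_succ_succ_le k r
      have h4 := T.pattern_mono (Nat.le_add_right k 1) (r + 1)
      simp only [Nat.add_sub_cancel] at h1
      omega
    rw [gap, h2, sub_self, zero_div, add_zero]
  · rintro ⟨a, b⟩ ha
    rw [T.num_of_mem_innerCorners k hx, T.num_of_mem_innerCorners k (mem_of_mem_erase ha)]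
    rw [show ∀ u v w : ℂ, u - v - (u - w) = w - v by intros; ring]
    rfl

theorem dCoeff_eq (T : GT lam n) {k : ℕ} (hk : 0 < k) (i : ℕ)
    (hx : (i + 1, T.pattern k i) ∈ (T.shape k).outerCorners) :
    T.dCoeff k (i + 1, T.pattern k i) = T.dRow k i := by
  have houter : ∀ {a b}, (a, b) ∈ (T.shape k).outerCorners ↔
      0 < a ∧ b = T.pattern k (a - 1) ∧ T.pattern k a < b :=
    (T.shape k).mem_outerCorners_iff
  have hbout : ∀ x : ℕ × ℕ, T.bOut k x = T.gap (k - 1) (x.1 - 1) := by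
    intro x
    rw [bOut, gap, Nat.sub_add_cancel hk]
  have hinj : Set.InjOn (T.num k) (T.shape k).outerCorners := by
    rintro ⟨a, b⟩ ha ⟨a', b'⟩ ha' h
    have h1 := T.num_of_mem_outerCorners k ha
    rw [h, T.num_of_mem_outerCorners k ha'] at h1
    have h2 : a' - 1 = a - 1 := T.l_injective k (sub_right_injective h1)
    have h3 := houter.1 ha
    have h4 := houter.1 ha'
    obtain rfl : a = a' := by omega
    rw [h3.2.1, h4.2.1]
  have hprod := prod_filter_lt_mul_prod_filter_gt _ (T.num k) (fun y => -T.bOut k y) hinj hx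
  simp only [neg_div, ← sub_eq_add_neg, sub_neg_eq_add] at hprod
  rw [dCoeff, mul_assoc, hprod, dRow, hbout]
  congr 1
  refine prod_of_injOn (fun y => y.1 - 1) ?_ ?_ ?_ ?_
  · rintro ⟨a, b⟩ ha ⟨a', b'⟩ ha' h
    have h3 := houter.1 (mem_of_mem_erase (mem_coe.1 ha))
    have h4 := houter.1 (mem_of_mem_erase (mem_coe.1 ha'))
    simp only at h
    obtain rfl : a = a' := by omega
    rw [h3.2.1, h4.2.1]
  · rintro ⟨a, b⟩ ha
    obtain ⟨h1, h2⟩ := mem_erase.1 (mem_coe.1 ha)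
    obtain ⟨h3, h4, h5⟩ := houter.1 h2
    refine mem_coe.2 (mem_erase.2 ⟨?_, mem_range.2 ?_⟩)
    · rintro (h6 : a - 1 = i)
      refine h1 ?_
      rw [h4, h6, show a = i + 1 by omega]
    · by_contra hc
      change ¬ a - 1 < k at hc
      rw [pattern_eq_zero T (by omega : k ≤ a - 1)] at h4
      omega
  · intro r hr hr'
    have h1 : ¬ (T.pattern k (r + 1) < T.pattern k r) := by
      intro h
      refine hr' ⟨(r + 1, T.pattern k r), mem_coe.2 (mem_erase.2 ⟨?_,
        houter.2 ⟨Nat.succ_pos _, rfl, h⟩⟩), rfl⟩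
      intro h2
      exact (mem_erase.1 hr).1 (by simpa using (Prod.mk.inj h2).1)
    have h2 : T.pattern k r = T.pattern (k - 1) r := by
      have h3 := T.pattern_succ_succ_le (k - 1) r
      have h4 := T.pattern_mono (Nat.sub_le k 1) r
      rw [Nat.sub_add_cancel hk] at h3
      omega
    rw [gap, Nat.sub_add_cancel hk, h2, sub_self, zero_div, add_zero]
  · rintro ⟨a, b⟩ ha
    rw [T.num_of_mem_outerCorners k hx, T.num_of_mem_outerCorners k (mem_of_mem_erase ha), hbout]
    rw [show ∀ u v w : ℂ, u - v - (u - w) = -(v - w) by intros; ring, div_neg, sub_neg_eq_add]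
    rfl

namespace IsPatternAdd

variable {S T : GT lam n} {k i : ℕ}

theorem pattern_lt_pred (h : IsPatternAdd S T k i) (hi : 0 < i) :
    S.pattern k i < S.pattern (k - 1) (i - 1) := by
  have h1 := T.pattern_succ_succ_le (k - 1) (i - 1)
  have h2 := h.pos
  rw [Nat.sub_add_cancel hi, Nat.sub_add_cancel h2, h.pattern_self,
    h.pattern_of_ne (Or.inl (by omega))] at h1
  exact h1

theorem pattern_lt_succ (h : IsPatternAdd S T k i) : S.pattern k i < S.pattern (k + 1) i := by
  have h1 := T.pattern_mono (Nat.le_add_right k 1) i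
  rw [h.pattern_self, h.pattern_of_ne (m := k + 1) (Or.inl (by omega))] at h1
  exact h1

theorem succ_pattern_lt (h : IsPatternAdd S T k i) : T.pattern (k + 1) (i + 1) < T.pattern k i := by
  have h1 := S.pattern_succ_succ_le k i
  have h2 := h.pattern_self
  rw [h.pattern_of_ne (m := k + 1) (Or.inl (by omega))]
  omega

theorem pred_pattern_lt (h : IsPatternAdd S T k i) : T.pattern (k - 1) i < T.pattern k i := by
  have h1 := S.pattern_mono (Nat.sub_le k 1) i
  have h2 := h.pattern_self
  have h3 := h.pos
  rw [h.pattern_of_ne (m := k - 1) (Or.inl (by omega))]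
  omega

theorem cLabel_eq (h : IsPatternAdd S T k i) : cLabel T S = S.cRow k i := by
  have hx : (i, S.pattern k i) ∈ (S.shape k).innerCorners := by
    refine (S.shape k).mem_innerCorners_iff.2 ⟨rfl, ?_⟩
    rcases Nat.eq_zero_or_pos i with h0 | h0
    · exact Or.inl h0
    · exact Or.inr ((h.pattern_lt_pred h0).trans_le (S.pattern_mono (Nat.sub_le k 1) _))
  rw [cLabel, sum_eq_single (i, S.pattern k i)]
  · rw [h.changesAt.2.2, cCoeff_eq S k i hx]
  · intro y hy hne
    simp only [mem_filter, YoungDiagram.mem_cells] at hy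
    exact absurd ((changesAt_iff_of_isPatternAdd h hy.1).1 hy.2) hne
  · intro hc
    exact absurd (by simpa using ⟨h.changesAt.1, h.changesAt.2.1⟩) hc

theorem dLabel_eq (h : IsPatternAdd S T k i) : dLabel S T = T.dRow k i := by
  have hx : (i + 1, T.pattern k i) ∈ (T.shape k).outerCorners := by
    refine (T.shape k).mem_outerCorners_iff.2 ⟨Nat.succ_pos _, rfl, ?_⟩
    exact lt_of_le_of_lt (T.pattern_mono (Nat.le_add_right k 1) (i + 1)) h.succ_pattern_lt
  rw [dLabel, sum_eq_single (i, S.pattern k i)]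
  · rw [h.changesAt.2.2, ← dCoeff_eq T h.pos i hx, h.pattern_self]
  · intro y hy hne
    simp only [mem_filter, YoungDiagram.mem_cells] at hy
    exact absurd ((changesAt_iff_of_isPatternAdd h hy.1).1 hy.2) hne
  · intro hc
    exact absurd (by simpa using ⟨h.changesAt.1, h.changesAt.2.1⟩) hc

end IsPatternAdd

end GT

/-! ### A partial fraction identity -/

/-- The partial fraction identity of Lagrange interpolation for the polynomial
`∏ (X - x j) - ∏ (X - x j - y j)`: its values at the nodes give the left-hand side and its leading
coefficient the right-hand side. -/
theorem sum_mul_prod_one_add_div_of_injOn {ι : Type*} [DecidableEq ι] (s : Finset ι) (x y : ι → ℂ)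
    (hx : Set.InjOn x s) :
    ∑ i ∈ s, y i * ∏ j ∈ s.erase i, (1 + y j / (x j - x i)) = ∑ i ∈ s, y i := by
  rcases s.eq_empty_or_nonempty with rfl | hs
  · simp
  open Polynomial in
  let P : ℂ[X] := ∏ i ∈ s, (X - C (x i)) - ∏ i ∈ s, (X - C (x i + y i))
  have hdeg : P.degree < #s := by
    have h1 := Lagrange.degree_nodal (s := s) (v := x)
    have h2 := Lagrange.degree_nodal (s := s) (v := fun i => x i + y i)
    rw [← h1]
    refine Polynomial.degree_sub_lt_left
      (by rw [← Lagrange.nodal_eq, ← Lagrange.nodal_eq s (fun i => x i + y i), h1, h2])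
      (Lagrange.nodal_ne_zero (s := s) (v := x)) ?_
    rw [← Lagrange.nodal_eq, ← Lagrange.nodal_eq s (fun i => x i + y i),
      Lagrange.nodal_monic.leadingCoeff, Lagrange.nodal_monic.leadingCoeff]
  have h1 := Lagrange.coeff_eq_sum hx hdeg
  have h2 : P.coeff (#s - 1) = ∑ i ∈ s, y i := by
    simp only [P, Polynomial.coeff_sub]
    rw [Polynomial.prod_X_sub_C_coeff_card_pred _ _ hs.card_pos,
      Polynomial.prod_X_sub_C_coeff_card_pred _ _ hs.card_pos, sum_add_distrib]
    ring
  rw [← h2, h1]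
  refine sum_congr rfl fun i hi => ?_
  have h3 : P.eval (x i) = y i * ∏ j ∈ s.erase i, (x i - (x j + y j)) := by
    simp only [P, Polynomial.eval_sub, Polynomial.eval_prod, Polynomial.eval_X, Polynomial.eval_C]
    rw [prod_eq_zero hi (sub_self _), ← mul_prod_erase _ _ hi]
    ring
  rw [h3, mul_div_assoc, ← prod_div_distrib]
  congr 1
  refine prod_congr rfl fun j hj => ?_
  have hne : x i - x j ≠ 0 := fun h =>
    ne_of_mem_erase hj (hx (mem_of_mem_erase hj) hi (sub_eq_zero.1 h).symm)
  rw [← neg_sub (x i) (x j), div_neg, ← sub_eq_add_neg, eq_div_iff hne, sub_mul,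
    div_mul_cancel₀ _ hne]
  ring

/-- In the partial fraction identity the nodes with vanishing weight need not be distinct, since they
do not contribute to either side. -/
theorem sum_mul_prod_one_add_div {ι : Type*} [DecidableEq ι] (s : Finset ι) (x y : ι → ℂ)
    (hx : ∀ i ∈ s, ∀ j ∈ s, y i ≠ 0 → y j ≠ 0 → x i = x j → i = j) :
    ∑ i ∈ s, y i * ∏ j ∈ s.erase i, (1 + y j / (x j - x i)) = ∑ i ∈ s, y i := by
  have h1 := sum_mul_prod_one_add_div_of_injOn {i ∈ s | y i ≠ 0} x y fun i hi j hj h => by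
    simp only [coe_filter, Set.mem_ofPred_eq] at hi hj
    exact hx i hi.1 j hj.1 hi.2 hj.2 h
  rw [sum_filter_ne_zero] at h1
  rw [← h1, sum_filter]
  refine sum_congr rfl fun i hi => ?_
  split_ifs with hy
  · congr 1
    symm
    refine prod_subset (erase_subset_erase _ (filter_subset _ _)) fun j hj hj' => ?_
    have : y j = 0 := by
      by_contra hne
      exact hj' (mem_erase.2 ⟨ne_of_mem_erase hj, mem_filter.2 ⟨mem_of_mem_erase hj, hne⟩⟩)
    rw [this, zero_div, add_zero]
  · rw [not_not.1 hy, zero_mul]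

/-- The partial fraction identity for two families of nodes. -/
theorem sum_mul_prod_one_add_div_pair (s t : Finset ℕ) (x y x' y' : ℕ → ℂ)
    (hx : Set.InjOn x s) (hx' : Set.InjOn x' t)
    (hxx' : ∀ i ∈ s, ∀ j ∈ t, y i ≠ 0 → y' j ≠ 0 → x i ≠ x' j) :
    ∑ i ∈ s, y i * ((∏ j ∈ s.erase i, (1 + y j / (x j - x i))) *
        ∏ j ∈ t, (1 + y' j / (x' j - x i))) +
      ∑ i ∈ t, y' i * ((∏ j ∈ s, (1 + y j / (x j - x' i))) *
        ∏ j ∈ t.erase i, (1 + y' j / (x' j - x' i))) = ∑ i ∈ s, y i + ∑ i ∈ t, y' i := by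
  have h := sum_mul_prod_one_add_div (s.disjSum t) (Sum.elim x x') (Sum.elim y y') (by
    rintro (i | i) hi (j | j) hj hyi hyj h
    · rw [hx (inl_mem_disjSum.1 hi) (inl_mem_disjSum.1 hj) h]
    · exact absurd h (hxx' i (inl_mem_disjSum.1 hi) j (inr_mem_disjSum.1 hj) hyi hyj)
    · exact absurd h.symm (hxx' j (inl_mem_disjSum.1 hj) i (inr_mem_disjSum.1 hi) hyj hyi)
    · rw [hx' (inr_mem_disjSum.1 hi) (inr_mem_disjSum.1 hj) h])
  rw [sum_disjSum, sum_disjSum] at h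
  simp only [Sum.elim_inl, Sum.elim_inr] at h
  rw [← h]
  congr 1
  · refine sum_congr rfl fun i _ => ?_
    have : (s.disjSum t).erase (Sum.inl i) = (s.erase i).disjSum t := by
      ext (j | j) <;> simp
    rw [this, prod_disjSum]
    rfl
  · refine sum_congr rfl fun i _ => ?_
    have : (s.disjSum t).erase (Sum.inr i) = s.disjSum (t.erase i) := by
      ext (j | j) <;> simp
    rw [this, prod_disjSum]
    rfl

/-! ### Sums over edges -/

open Classical in
theorem sum_filter_exists_eq {α β : Type*} [Fintype α] [AddCommMonoid β] (R : ℕ → α → Prop) (N : ℕ)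
    (hN : ∀ i a, R i a → i < N) (hR : ∀ i j a, R i a → R j a → i = j) (F : α → β) :
    ∑ a with ∃ i, R i a, F a = ∑ i ∈ range N, ∑ a with R i a, F a := by
  rw [← sum_biUnion]
  · refine sum_congr ?_ fun _ _ => rfl
    ext a
    simp only [mem_filter, mem_univ, true_and, mem_biUnion, mem_range]
    exact ⟨fun ⟨i, hi⟩ => ⟨i, hN i a hi, hi⟩, fun ⟨i, _, hi⟩ => ⟨i, hi⟩⟩
  · intro i _ j _ hij
    rw [Function.onFun, disjoint_left]
    intro a ha ha'
    exact hij (hR i j a (mem_filter.1 ha).2 (mem_filter.1 ha').2)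

namespace GT

variable {lam : YoungDiagram} {n : ℕ}

open Classical in
theorem sum_edge_from {β : Type*} [AddCommMonoid β] (k : Fin (n - 1)) (S : GT lam n)
    (F : GT lam n → β) : ∑ T with (diagram lam n).edge k S T, F T =
      ∑ i ∈ range (k + 1), ∑ T with IsPatternAdd S T (k + 1) i, F T := by
  rw [← sum_filter_exists_eq (fun i T => IsPatternAdd S T (k + 1) i) _ (fun _ _ h => h.row_lt)
    (fun _ _ _ h h' => (h.indices_unique h').2)]
  refine sum_congr ?_ fun _ _ => rfl
  ext T
  simp [diagram_edge_iff]

open Classical in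
theorem sum_edge_to {β : Type*} [AddCommMonoid β] (k : Fin (n - 1)) (T : GT lam n)
    (F : GT lam n → β) : ∑ S with (diagram lam n).edge k S T, F S =
      ∑ i ∈ range (k + 1), ∑ S with IsPatternAdd S T (k + 1) i, F S := by
  rw [← sum_filter_exists_eq (fun i S => IsPatternAdd S T (k + 1) i) _ (fun _ _ h => h.row_lt)
    (fun _ _ _ h h' => (h.indices_unique h').2)]
  refine sum_congr ?_ fun _ _ => rfl
  ext S
  simp [diagram_edge_iff]

open Classical in
theorem sum_filter_eq_of_unique {α : Type*} [Fintype α] (R : α → Prop)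
    (hR : ∀ a b, R a → R b → a = b) (F : α → ℂ) (g : ℂ) (h1 : ∀ a, R a → F a = g)
    (h2 : (¬ ∃ a, R a) → g = 0) : ∑ a with R a, F a = g := by
  by_cases h : ∃ a, R a
  · obtain ⟨a, ha⟩ := h
    rw [sum_eq_single_of_mem a (by simpa using ha) fun b hb hne =>
      absurd (hR b a (by simpa using hb) ha) hne, h1 a ha]
  · rw [h2 h]
    refine sum_eq_zero fun a ha => absurd ⟨a, by simpa using ha⟩ h

/-! ### The crossing condition -/

theorem l_eq (T : GT lam n) (k i : ℕ) : T.l k i = (T.pattern k i : ℂ) - (i : ℂ) := rfl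

namespace IsPatternAdd

variable {S T : GT lam n} {k i : ℕ}

theorem l_self (h : IsPatternAdd S T k i) : T.l k i = S.l k i + 1 := by
  rw [l_eq, l_eq, h.pattern_self]
  push_cast
  ring

theorem l_of_ne (h : IsPatternAdd S T k i) {m j : ℕ} (hne : m ≠ k ∨ j ≠ i) :
    T.l m j = S.l m j := by
  rw [l_eq, l_eq, h.pattern_of_ne hne]

theorem gap_of_ne (h : IsPatternAdd S T k i) {m j : ℕ} (hne : (m ≠ k ∧ m + 1 ≠ k) ∨ j ≠ i) :
    T.gap m j = S.gap m j := by
  rw [gap, gap, h.pattern_of_ne (m := m) (by tauto), h.pattern_of_ne (m := m + 1) (by tauto)]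

theorem gap_self (h : IsPatternAdd S T k i) : T.gap k i = S.gap k i - 1 := by
  rw [gap, gap, h.pattern_self, h.pattern_of_ne (m := k + 1) (Or.inl (by omega))]
  push_cast
  ring

theorem gap_pred (h : IsPatternAdd S T k i) : T.gap (k - 1) i = S.gap (k - 1) i + 1 := by
  have := h.pos
  rw [gap, gap, Nat.sub_add_cancel h.pos, h.pattern_self,
    h.pattern_of_ne (m := k - 1) (Or.inl (by omega))]
  push_cast
  ring

/-- The label `d` of an edge in terms of its initial vertex. -/
theorem dRow_eq (h : IsPatternAdd S T k i) :
    T.dRow k i = ∏ j ∈ range k, (1 + -S.gap (k - 1) j / (S.l k j - 1 - S.l k i)) := by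
  rw [← mul_prod_erase _ _ (mem_range.2 h.row_lt), dRow, h.gap_pred]
  congr 1
  · rw [show S.l k i - 1 - S.l k i = -1 by ring, neg_div_neg_eq, div_one, add_comm]
  · refine prod_congr rfl fun j hj => ?_
    have hne := ne_of_mem_erase hj
    rw [h.l_self, h.l_of_ne (Or.inr hne), h.gap_of_ne (Or.inr hne),
      show S.l k j - 1 - S.l k i = -(S.l k i + 1 - S.l k j) by ring, neg_div_neg_eq]

/-- The label `c` of an edge in terms of its final vertex. -/
theorem cRow_eq (h : IsPatternAdd S T k i) :
    S.cRow k i = ∏ j ∈ range (k + 1), (1 + T.gap k j / (T.l k j - (T.l k i - 1))) := by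
  have hi := h.row_lt
  rw [← mul_prod_erase _ _ (mem_range.2 (by omega : i < k + 1)), cRow, h.gap_self]
  congr 1
  · rw [sub_sub_cancel, div_one]
    ring
  · refine prod_congr rfl fun j hj => ?_
    have hne := ne_of_mem_erase hj
    rw [h.l_self, h.l_of_ne (Or.inr hne), h.gap_of_ne (Or.inr hne), add_sub_cancel_right]

end IsPatternAdd

theorem gap_eq_zero_of_eq (T : GT lam n) {k j : ℕ} (h : T.pattern (k + 1) j = T.pattern k j) :
    T.gap k j = 0 := by
  rw [gap, h, sub_self]

/-- If the `i`-th entry of row `k` cannot be increased, the corresponding term vanishes. -/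
theorem cRow_mul_prod_eq_zero {T : GT lam n} {k i : ℕ} (hk : k < n) (hik : i ≤ k) (hpos : 0 < k)
    (h : ¬ ∃ U, IsPatternAdd T U k i) :
    T.cRow k i * ∏ j ∈ range k, (1 + -T.gap (k - 1) j / (T.l k j - 1 - T.l k i)) = 0 := by
  have hmono := T.pattern_mono (Nat.le_add_right k 1) i
  rcases hmono.eq_or_lt with h1 | h1
  · rw [cRow, T.gap_eq_zero_of_eq h1.symm, zero_mul, zero_mul]
  have hi : 0 < i ∧ T.pattern k i = T.pattern (k - 1) (i - 1) := by
    rcases hik.eq_or_lt with rfl | hik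
    · rw [pattern_eq_zero T le_rfl, pattern_eq_zero T le_rfl]
      exact ⟨hpos, rfl⟩
    · by_contra hc
      refine h (exists_isPatternAdd hik hk h1 ?_)
      rcases Nat.eq_zero_or_pos i with h0 | h0
      · exact Or.inl h0
      · right
        have h3 := T.pattern_succ_succ_le (k - 1) (i - 1)
        rw [Nat.sub_add_cancel h0, Nat.sub_add_cancel hpos] at h3
        omega
  obtain ⟨i, rfl⟩ : ∃ i', i = i' + 1 := ⟨i - 1, by omega⟩
  have h2 := hi.2
  simp only [Nat.add_sub_cancel] at h2
  have h3 := T.pattern_succ_succ_le k i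
  have hne : (T.pattern k i : ℂ) - T.pattern k (i + 1) ≠ 0 := by
    rw [sub_ne_zero, Nat.cast_injective.ne_iff]
    omega
  -- The increase is blocked by the entry `i` of row `k - 1`, and the factor of index `i` is zero.
  rw [prod_eq_zero (mem_range.2 (by omega : i < k)), mul_zero]
  rw [gap, Nat.sub_add_cancel hpos, ← h2, l_eq, l_eq, neg_div,
    show ((T.pattern k i : ℂ) - i - 1 - (T.pattern k (i + 1) - ((i + 1 : ℕ) : ℂ))) =
      T.pattern k i - T.pattern k (i + 1) by push_cast; ring, div_self hne]
  ring

/-- If the `i`-th entry of row `k` cannot be decreased, the corresponding term vanishes. -/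
theorem dRow_mul_prod_eq_zero {T : GT lam n} {k i : ℕ} (hk : k < n) (hik : i < k)
    (h : ¬ ∃ S, IsPatternAdd S T k i) :
    T.dRow k i * ∏ j ∈ range (k + 1), (1 + T.gap k j / (T.l k j - (T.l k i - 1))) = 0 := by
  have hpos : 0 < k := by omega
  have hmono := T.pattern_mono (Nat.sub_le k 1) i
  rcases hmono.eq_or_lt with h1 | h1
  · rw [dRow, T.gap_eq_zero_of_eq (by rw [Nat.sub_add_cancel hpos, h1]), zero_mul, zero_mul]
  have h3 := T.pattern_succ_succ_le k i
  have h2 : T.pattern (k + 1) (i + 1) = T.pattern k i := by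
    by_contra hc
    exact h (exists_isPatternAdd_to hk hpos h1 (by omega))
  have h4 := T.pattern_succ_succ_le (k - 1) i
  rw [Nat.sub_add_cancel hpos] at h4
  have hne : (T.pattern k (i + 1) : ℂ) - T.pattern k i ≠ 0 := by
    rw [sub_ne_zero, Nat.cast_injective.ne_iff]
    omega
  -- The decrease is blocked by the entry `i + 1` of row `k + 1`; the factor of that index is zero.
  rw [prod_eq_zero (mem_range.2 (by omega : i + 1 < k + 1)), mul_zero]
  rw [gap, h2, l_eq, l_eq,
    show ((T.pattern k (i + 1) : ℂ) - ((i + 1 : ℕ) : ℂ) - (T.pattern k i - i - 1)) =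
      T.pattern k (i + 1) - T.pattern k i by push_cast; ring, ← neg_sub, neg_div, div_self hne]
  ring

theorem sum_gap (T : GT lam n) (k : ℕ) :
    ∑ j ∈ range (k + 1), T.gap k j = (T.rowSum (k + 1) : ℂ) - T.rowSum k := by
  simp only [gap, sum_sub_distrib, rowSum, Int.cast_sum, Int.cast_natCast]
  rw [sum_range_succ (fun j => (T.pattern k j : ℂ)), pattern_eq_zero T le_rfl, Nat.cast_zero,
    add_zero]

/-- The partial fraction identity with the nodes `l_{k,j}` and `l_{k,j} - 1`, whose weights are the
differences with the neighbouring rows. -/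
theorem sum_dRow_mul_sub_sum_cRow_mul (T : GT lam n) {k : ℕ} (hpos : 0 < k) :
    ∑ i ∈ range k, T.dRow k i * ∏ j ∈ range (k + 1), (1 + T.gap k j / (T.l k j - (T.l k i - 1))) -
      ∑ i ∈ range (k + 1), T.cRow k i *
        ∏ j ∈ range k, (1 + -T.gap (k - 1) j / (T.l k j - 1 - T.l k i)) =
    2 * T.rowSum k - T.rowSum (k - 1) - T.rowSum (k + 1) := by
  have h := sum_mul_prod_one_add_div_pair (range (k + 1)) (range k) (T.l k) (T.gap k)
    (fun j => T.l k j - 1) (fun j => -T.gap (k - 1) j) (T.l_injective k).injOn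
    ((sub_left_injective.comp (T.l_injective k)).injOn) ?_
  · have h1 : ∑ j ∈ range k, T.gap (k - 1) j = (T.rowSum k : ℂ) - T.rowSum (k - 1) := by
      have := T.sum_gap (k - 1)
      rwa [Nat.sub_add_cancel hpos] at this
    rw [sum_gap, sum_neg_distrib, h1] at h
    have h2 : ∀ i ∈ range k, -T.gap (k - 1) i *
        ((∏ j ∈ range (k + 1), (1 + T.gap k j / (T.l k j - (T.l k i - 1)))) *
        ∏ j ∈ (range k).erase i, (1 + -T.gap (k - 1) j / (T.l k j - 1 - (T.l k i - 1)))) =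
        -(T.dRow k i *
          ∏ j ∈ range (k + 1), (1 + T.gap k j / (T.l k j - (T.l k i - 1)))) := by
      intro i _
      have h3 : ∏ j ∈ (range k).erase i,
          (1 + -T.gap (k - 1) j / (T.l k j - 1 - (T.l k i - 1))) =
          ∏ j ∈ (range k).erase i, (1 + T.gap (k - 1) j / (T.l k i - T.l k j)) :=
        prod_congr rfl fun j _ => by
          rw [sub_sub_sub_cancel_right, ← neg_sub (T.l k i), neg_div_neg_eq]
      rw [h3, dRow]
      ring
    rw [sum_congr rfl h2, sum_neg_distrib] at h
    simp only [← mul_assoc] at h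
    simp only [← cRow.eq_1] at h
    linear_combination -h
  · -- A coincidence `l_{k,i} = l_{k,j} - 1` forces `i = j + 1` and equal entries, hence weight zero.
    intro i _ j _ hi _ h
    have h1 : (T.pattern k i : ℤ) - i = (T.pattern k j : ℤ) - j - 1 := by
      have : (T.pattern k i : ℂ) - i = (T.pattern k j : ℂ) - j - 1 := h
      exact_mod_cast this
    have h2 : j < i := by
      by_contra hc
      have := T.pattern_anti k (not_lt.1 hc)
      omega
    have h3 : i = j + 1 := by
      by_contra hc
      have h4 := T.l_strictAnti k (by omega : j < j + 1)
      have h5 := T.l_strictAnti k (by omega : j + 1 < i)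
      push_cast at h4 h5
      omega
    subst h3
    refine hi (T.gap_eq_zero_of_eq ?_)
    have h4 := T.pattern_succ_succ_le k j
    have h5 := T.pattern_mono (Nat.le_add_right k 1) (j + 1)
    push_cast at h1
    omega

theorem crossingCondition : (diagram lam n).CrossingCondition := by
  classical
  intro T k
  have hk : (k : ℕ) + 1 < n := by omega
  rw [sum_edge_from, sum_edge_to, diagram_m]
  have h1 : ∀ i ∈ range ((k : ℕ) + 1), ∑ S with IsPatternAdd S T (k + 1) i,
      (diagram lam n).edgeProd S T = T.dRow (k + 1) i *
        ∏ j ∈ range (k + 1 + 1), (1 + T.gap (k + 1) j / (T.l (k + 1) j - (T.l (k + 1) i - 1))) := by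
    intro i hi
    refine sum_filter_eq_of_unique _ (fun _ _ h h' => h.left_unique h') _ _ ?_
      (dRow_mul_prod_eq_zero hk (mem_range.1 hi))
    intro S hS
    rw [← hS.cRow_eq, ← hS.cLabel_eq, ← hS.dLabel_eq, mul_comm]
    rfl
  have h2 : ∀ i ∈ range ((k : ℕ) + 1), ∑ U with IsPatternAdd T U (k + 1) i,
      (diagram lam n).edgeProd T U = T.cRow (k + 1) i *
        ∏ j ∈ range (k + 1), (1 + -T.gap (k + 1 - 1) j / (T.l (k + 1) j - 1 - T.l (k + 1) i)) := by
    intro i hi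
    refine sum_filter_eq_of_unique _ (fun _ _ h h' => h.right_unique h') _ _ ?_
      (cRow_mul_prod_eq_zero hk (mem_range.1 hi).le (Nat.succ_pos _))
    intro U hU
    rw [← hU.dRow_eq, ← hU.cLabel_eq, ← hU.dLabel_eq]
    rfl
  have h3 := T.sum_dRow_mul_sub_sum_cRow_mul (Nat.succ_pos (k : ℕ))
  -- The identity also has a node for the entry `0` that ends row `k + 1`; it cannot be increased.
  rw [sum_range_succ (fun i => T.cRow (k + 1) i * _),
    cRow_mul_prod_eq_zero hk le_rfl (Nat.succ_pos _) fun ⟨U, hU⟩ => lt_irrefl _ hU.row_lt,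
    add_zero] at h3
  rw [sum_congr rfl h1, sum_congr rfl h2]
  push_cast
  exact h3

end GT

/-! ### The diamond condition -/

namespace GT

variable {lam : YoungDiagram} {n : ℕ}

/-- The entrywise minimum of two patterns is a pattern. -/
theorem exists_pattern_min (S T : GT lam n) :
    ∃ R : GT lam n, ∀ k i, R.pattern k i = min (S.pattern k i) (T.pattern k i) :=
  exists_pattern_eq _ (by simp)
    (fun k i => min_le_min (S.pattern_mono (Nat.le_add_right k 1) i)
      (T.pattern_mono (Nat.le_add_right k 1) i))
    (fun k i => min_le_min (S.pattern_succ_succ_le k i) (T.pattern_succ_succ_le k i))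
    (fun k hk i => by rw [S.pattern_eq_rowLen hk, T.pattern_eq_rowLen hk, min_self])

/-- The entrywise maximum of two patterns is a pattern. -/
theorem exists_pattern_max (S T : GT lam n) :
    ∃ R : GT lam n, ∀ k i, R.pattern k i = max (S.pattern k i) (T.pattern k i) :=
  exists_pattern_eq _ (by simp)
    (fun k i => max_le_max (S.pattern_mono (Nat.le_add_right k 1) i)
      (T.pattern_mono (Nat.le_add_right k 1) i))
    (fun k i => max_le_max (S.pattern_succ_succ_le k i) (T.pattern_succ_succ_le k i))
    (fun k hk i => by rw [S.pattern_eq_rowLen hk, T.pattern_eq_rowLen hk, max_self])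

section Diamond

variable {R S T U : GT lam n} {k m x y : ℕ}

theorem indices_ne_of_isPatternAdd_to (hne : S ≠ T) (hS : IsPatternAdd S U k x)
    (hT : IsPatternAdd T U m y) : ¬ (k = m ∧ x = y) := by
  rintro ⟨rfl, rfl⟩
  exact hne (hS.left_unique hT)

theorem indices_ne_of_isPatternAdd_from (hne : S ≠ T) (hS : IsPatternAdd R S m y)
    (hT : IsPatternAdd R T k x) : ¬ (k = m ∧ x = y) := by
  rintro ⟨rfl, rfl⟩
  exact hne (hS.right_unique hT)

theorem pattern_eq_max (hne : S ≠ T) (hS : IsPatternAdd S U k x) (hT : IsPatternAdd T U m y)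
    (a b : ℕ) : U.pattern a b = max (S.pattern a b) (T.pattern a b) := by
  have h := indices_ne_of_isPatternAdd_to hne hS hT
  have h1 := hS a b
  have h2 := hT a b
  split_ifs at h1 h2 <;> omega

theorem pattern_eq_min (hne : S ≠ T) (hS : IsPatternAdd R S m y) (hT : IsPatternAdd R T k x)
    (a b : ℕ) : R.pattern a b = min (S.pattern a b) (T.pattern a b) := by
  have h := indices_ne_of_isPatternAdd_from hne hS hT
  have h1 := hS a b
  have h2 := hT a b
  split_ifs at h1 h2 <;> omega

theorem exists_lower_of_upper (hne : S ≠ T) (hS : IsPatternAdd S U k x)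
    (hT : IsPatternAdd T U m y) : ∃ R, IsPatternAdd R S m y ∧ IsPatternAdd R T k x := by
  have h := indices_ne_of_isPatternAdd_to hne hS hT
  obtain ⟨R, hR⟩ := exists_pattern_min S T
  refine ⟨R, fun a b => ?_, fun a b => ?_⟩ <;>
  · have h1 := hS a b
    have h2 := hT a b
    rw [hR]
    split_ifs at h1 h2 ⊢ <;> omega

theorem exists_upper_of_lower (hne : S ≠ T) (hS : IsPatternAdd R S m y)
    (hT : IsPatternAdd R T k x) : ∃ U, IsPatternAdd S U k x ∧ IsPatternAdd T U m y := by
  have h := indices_ne_of_isPatternAdd_from hne hS hT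
  obtain ⟨U, hU⟩ := exists_pattern_max S T
  refine ⟨U, fun a b => ?_, fun a b => ?_⟩ <;>
  · have h1 := hS a b
    have h2 := hT a b
    rw [hU]
    split_ifs at h1 h2 ⊢ <;> omega

theorem l_sub_l_ne_zero (T : GT lam n) (k : ℕ) {i j : ℕ} (h : i ≠ j) : T.l k i - T.l k j ≠ 0 :=
  sub_ne_zero.2 fun h' => h (T.l_injective k h')

theorem l_add_gap (T : GT lam n) (k j : ℕ) : T.l k j + T.gap k j = T.l (k + 1) j := by
  rw [l, l, gap]
  ring

/-- The label `c` as a quotient of products of differences of the numbers `l`. -/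
theorem cRow_eq_div (T : GT lam n) {k i : ℕ} (hi : i < k + 1) :
    T.cRow k i = (∏ j ∈ range (k + 1), (T.l (k + 1) j - T.l k i)) /
      ∏ j ∈ (range (k + 1)).erase i, (T.l k j - T.l k i) := by
  rw [cRow, ← mul_prod_erase _ (fun j => T.l (k + 1) j - T.l k i) (mem_range.2 hi), mul_div_assoc,
    ← prod_div_distrib]
  congr 1
  · rw [← l_add_gap]; ring
  · refine prod_congr rfl fun j hj => ?_
    have hne := T.l_sub_l_ne_zero k (ne_of_mem_erase hj)
    rw [← l_add_gap]
    field_simp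
    ring

/-- The label `d` as a quotient of products of differences of the numbers `l`. -/
theorem dRow_eq_div (T : GT lam n) {k i : ℕ} (hi : i < k + 1) :
    T.dRow (k + 1) i = (∏ j ∈ range (k + 1), (T.l (k + 1) i - T.l k j)) /
      ∏ j ∈ (range (k + 1)).erase i, (T.l (k + 1) i - T.l (k + 1) j) := by
  rw [dRow, ← mul_prod_erase _ (fun j => T.l (k + 1) i - T.l k j) (mem_range.2 hi), mul_div_assoc,
    ← prod_div_distrib]
  congr 1
  · rw [Nat.add_sub_cancel, ← l_add_gap]; ring
  · refine prod_congr rfl fun j hj => ?_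
    have hne := T.l_sub_l_ne_zero (k + 1) (ne_of_mem_erase hj).symm
    rw [Nat.add_sub_cancel, eq_div_iff hne, add_mul, div_mul_cancel₀ _ hne, one_mul,
      ← l_add_gap T k j]
    ring

/-- The two sides of the diamond condition agree for the four vertices of a diamond. Only the
factors relating the two moving entries change along an edge; they occur if the entries belong to
the same row, or if the move of `d` is in the row following that of `c`. -/
theorem cRow_mul_dRow_eq (hne : S ≠ T) (hSU : IsPatternAdd S U k x) (hTU : IsPatternAdd T U m y)
    (hRS : IsPatternAdd R S m y) (hRT : IsPatternAdd R T k x) :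
    S.cRow k x * U.dRow m y = S.dRow m y * R.cRow k x := by
  have hidx := indices_ne_of_isPatternAdd_to hne hSU hTU
  have hx := hSU.row_lt
  have hy := hTU.row_lt
  by_cases hkm : m = k
  · subst hkm
    have hyx : y ≠ x := fun h => hidx ⟨rfl, h.symm⟩
    have h1 : y ∈ (range (m + 1)).erase x := mem_erase.2 ⟨hyx, mem_range.2 (by omega)⟩
    have h2 : x ∈ (range m).erase y := mem_erase.2 ⟨hyx.symm, mem_range.2 hx⟩
    have hr1 : ∏ j ∈ ((range (m + 1)).erase x).erase y, (1 + R.gap m j / (R.l m j - R.l m x)) =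
        ∏ j ∈ ((range (m + 1)).erase x).erase y, (1 + S.gap m j / (S.l m j - S.l m x)) :=
      prod_congr rfl fun j hj => by
        have hj' := ne_of_mem_erase hj
        rw [hRS.gap_of_ne (Or.inr hj'), hRS.l_of_ne (Or.inr hj'), hRS.l_of_ne (Or.inr hyx.symm)]
    have hr2 : ∏ j ∈ ((range m).erase y).erase x, (1 + U.gap (m - 1) j / (U.l m y - U.l m j)) =
        ∏ j ∈ ((range m).erase y).erase x, (1 + S.gap (m - 1) j / (S.l m y - S.l m j)) :=
      prod_congr rfl fun j hj => by
        have hj' := ne_of_mem_erase hj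
        rw [hSU.gap_of_ne (Or.inr hj'), hSU.l_of_ne (Or.inr hj'), hSU.l_of_ne (Or.inr hyx)]
    have hn1 : S.l m y - S.l m x ≠ 0 := S.l_sub_l_ne_zero m hyx
    have hn2 : S.l m y - 1 - S.l m x ≠ 0 := by
      have := R.l_sub_l_ne_zero m hyx
      rwa [← hRS.l_of_ne (m := m) (j := x) (Or.inr hyx.symm),
        show R.l m y = S.l m y - 1 by rw [hRS.l_self]; ring] at this
    rw [cRow, dRow, dRow, cRow, ← mul_prod_erase _ _ h1, ← mul_prod_erase _ _ h2,
      ← mul_prod_erase _ _ h2, ← mul_prod_erase _ _ h1, hr1, hr2]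
    rw [hSU.gap_of_ne (Or.inr hyx), hSU.l_of_ne (Or.inr hyx), hSU.l_self, hSU.gap_pred,
      show R.gap m x = S.gap m x from (hRS.gap_of_ne (Or.inr hyx.symm)).symm,
      show R.l m x = S.l m x from (hRS.l_of_ne (Or.inr hyx.symm)).symm,
      show R.l m y = S.l m y - 1 by rw [hRS.l_self]; ring,
      show R.gap m y = S.gap m y + 1 by rw [hRS.gap_self]; ring]
    have key : (1 + S.gap m y / (S.l m y - S.l m x)) *
        (1 + (S.gap (m - 1) x + 1) / (S.l m y - (S.l m x + 1))) =
        (1 + S.gap (m - 1) x / (S.l m y - S.l m x)) *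
        (1 + (S.gap m y + 1) / (S.l m y - 1 - S.l m x)) := by
      rw [show S.l m y - (S.l m x + 1) = S.l m y - 1 - S.l m x by ring]
      field_simp
      ring
    linear_combination S.gap m x *
      (∏ j ∈ ((range (m + 1)).erase x).erase y, (1 + S.gap m j / (S.l m j - S.l m x))) *
      S.gap (m - 1) y *
      (∏ j ∈ ((range m).erase y).erase x, (1 + S.gap (m - 1) j / (S.l m y - S.l m j))) * key
  by_cases hkm' : m = k + 1
  · subst hkm'
    have hx' : x < k + 1 := by omega
    rw [S.cRow_eq_div hx', U.dRow_eq_div hy, S.dRow_eq_div hy, R.cRow_eq_div hx']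
    have hr1 : ∏ j ∈ (range (k + 1)).erase x, (R.l k j - R.l k x) =
        ∏ j ∈ (range (k + 1)).erase x, (S.l k j - S.l k x) :=
      prod_congr rfl fun j _ => by
        rw [hRS.l_of_ne (m := k) (Or.inl (by omega)), hRS.l_of_ne (m := k) (Or.inl (by omega))]
    have hr2 : ∏ j ∈ (range (k + 1)).erase y, (U.l (k + 1) y - U.l (k + 1) j) =
        ∏ j ∈ (range (k + 1)).erase y, (S.l (k + 1) y - S.l (k + 1) j) :=
      prod_congr rfl fun j _ => by
        rw [hSU.l_of_ne (m := k + 1) (Or.inl (by omega)),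
          hSU.l_of_ne (m := k + 1) (Or.inl (by omega))]
    have hr3 : ∏ j ∈ (range (k + 1)).erase y, (R.l (k + 1) j - R.l k x) =
        ∏ j ∈ (range (k + 1)).erase y, (S.l (k + 1) j - S.l k x) :=
      prod_congr rfl fun j hj => by
        rw [hRS.l_of_ne (m := k + 1) (Or.inr (ne_of_mem_erase hj)),
          hRS.l_of_ne (m := k) (Or.inl (by omega))]
    have hr4 : ∏ j ∈ (range (k + 1)).erase x, (U.l (k + 1) y - U.l k j) =
        ∏ j ∈ (range (k + 1)).erase x, (S.l (k + 1) y - S.l k j) :=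
      prod_congr rfl fun j hj => by
        rw [hSU.l_of_ne (m := k) (Or.inr (ne_of_mem_erase hj)),
          hSU.l_of_ne (m := k + 1) (Or.inl (by omega))]
    rw [hr1, hr2, ← mul_prod_erase _ _ (mem_range.2 hy),
      ← mul_prod_erase _ (fun j => U.l (k + 1) y - U.l k j) (mem_range.2 hx'),
      ← mul_prod_erase _ (fun j => S.l (k + 1) y - S.l k j) (mem_range.2 hx'),
      ← mul_prod_erase _ (fun j => R.l (k + 1) j - R.l k x) (mem_range.2 hy), hr3, hr4,
      hSU.l_self, hSU.l_of_ne (m := k + 1) (Or.inl (by omega)),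
      show R.l (k + 1) y = S.l (k + 1) y - 1 by rw [hRS.l_self]; ring,
      ← hRS.l_of_ne (m := k) (Or.inl (by omega))]
    ring
  · have hc : R.cRow k x = S.cRow k x := by
      rw [cRow, cRow, hRS.gap_of_ne (Or.inl (by omega))]
      congr 1
      refine prod_congr rfl fun j _ => ?_
      rw [hRS.gap_of_ne (m := k) (Or.inl (by omega)), hRS.l_of_ne (m := k) (Or.inl (by omega)),
        hRS.l_of_ne (m := k) (Or.inl (by omega))]
    have hd : U.dRow m y = S.dRow m y := by
      rw [dRow, dRow, hSU.gap_of_ne (m := m - 1) (Or.inl (by omega))]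
      congr 1
      refine prod_congr rfl fun j _ => ?_
      rw [hSU.gap_of_ne (m := m - 1) (Or.inl (by omega)), hSU.l_of_ne (m := m) (Or.inl (by omega)),
        hSU.l_of_ne (m := m) (Or.inl (by omega))]
    rw [hc, hd, mul_comm]

end Diamond

theorem diamondCondition : (diagram lam n).DiamondCondition := by
  classical
  intro S T hne _ i j
  have hedge : ∀ (k : Fin (n - 1)) (A B : GT lam n), (diagram lam n).edge k A B →
      ∃ x, IsPatternAdd A B (k + 1) x := fun k A B h => diagram_edge_iff.1 h
  by_cases h : ∃ U x y, IsPatternAdd S U (j + 1) x ∧ IsPatternAdd T U (i + 1) y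
  · obtain ⟨U, x, y, hSU, hTU⟩ := h
    obtain ⟨R, hRS, hRT⟩ := exists_lower_of_upper hne hSU hTU
    rw [sum_eq_single_of_mem U (mem_filter.2 ⟨mem_univ _, hSU.edge, hTU.edge⟩),
      sum_eq_single_of_mem R (mem_filter.2 ⟨mem_univ _, hRS.edge, hRT.edge⟩)]
    · change cLabel U S * dLabel T U = dLabel R S * cLabel T R
      rw [hSU.cLabel_eq, hTU.dLabel_eq, hRS.dLabel_eq, hRT.cLabel_eq]
      exact cRow_mul_dRow_eq hne hSU hTU hRS hRT
    · intro R' hR' hRR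
      obtain ⟨-, h1, h2⟩ := mem_filter.1 hR'
      obtain ⟨y', h1⟩ := hedge _ _ _ h1
      obtain ⟨x', h2⟩ := hedge _ _ _ h2
      exact absurd (pattern_ext fun a b => by
        rw [pattern_eq_min hne h1 h2, pattern_eq_min hne hRS hRT]) hRR
    · intro U' hU' hUU
      obtain ⟨-, h1, h2⟩ := mem_filter.1 hU'
      obtain ⟨x', h1⟩ := hedge _ _ _ h1
      obtain ⟨y', h2⟩ := hedge _ _ _ h2
      exact absurd (pattern_ext fun a b => by
        rw [pattern_eq_max hne h1 h2, pattern_eq_max hne hSU hTU]) hUU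
  · rw [sum_eq_zero, sum_eq_zero]
    · intro R hR
      obtain ⟨-, h1, h2⟩ := mem_filter.1 hR
      obtain ⟨y, h1⟩ := hedge _ _ _ h1
      obtain ⟨x, h2⟩ := hedge _ _ _ h2
      obtain ⟨U, h3, h4⟩ := exists_upper_of_lower hne h1 h2
      exact absurd ⟨U, x, y, h3, h4⟩ h
    · intro U hU
      obtain ⟨-, h1, h2⟩ := mem_filter.1 hU
      obtain ⟨x, h1⟩ := hedge _ _ _ h1
      obtain ⟨y, h2⟩ := hedge _ _ _ h2
      exact absurd ⟨U, x, y, h1, h2⟩ h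

/-! ### The labels do not vanish -/

theorem l_ne_l_of_lt (T : GT lam n) {k m i j : ℕ}
    (h : (T.pattern k i : ℤ) - i < (T.pattern m j : ℤ) - j) : T.l m j - T.l k i ≠ 0 := by
  rw [sub_ne_zero]
  intro h'
  have h1 : (T.pattern m j : ℤ) - j = (T.pattern k i : ℤ) - i := by
    have h2 : ((T.pattern m j : ℂ) - j) = (T.pattern k i : ℂ) - i := h'
    exact_mod_cast h2
  omega

/-- The numerator of `c` does not vanish along an edge, since the numbers `l` of row `k + 1` are
separated by those of row `k` after the move. -/
theorem IsPatternAdd.cLabel_ne_zero {S T : GT lam n} {k i : ℕ} (h : IsPatternAdd S T k i) :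
    cLabel T S ≠ 0 := by
  have hi := h.row_lt
  rw [h.cLabel_eq, S.cRow_eq_div (by omega)]
  refine div_ne_zero (prod_ne_zero_iff.2 fun j _ => ?_)
    (prod_ne_zero_iff.2 fun j hj => S.l_sub_l_ne_zero k (ne_of_mem_erase hj))
  rcases Nat.lt_or_ge i j with hij | hij
  · rw [← neg_sub, neg_ne_zero]
    refine S.l_ne_l_of_lt ?_
    have h1 := S.pattern_succ_succ_le k (j - 1)
    have h2 := S.pattern_anti k (by omega : i ≤ j - 1)
    rw [Nat.sub_add_cancel (by omega)] at h1
    omega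
  · refine S.l_ne_l_of_lt ?_
    have h1 := S.pattern_anti (k + 1) hij
    have h2 := h.pattern_lt_succ
    omega

theorem IsPatternAdd.dLabel_ne_zero {S T : GT lam n} {k i : ℕ} (h : IsPatternAdd S T k i) :
    dLabel S T ≠ 0 := by
  have hi := h.row_lt
  have hlt := h.pred_pattern_lt
  obtain ⟨k, rfl⟩ : ∃ k', k = k' + 1 := ⟨k - 1, by omega⟩
  rw [h.dLabel_eq, T.dRow_eq_div (by omega)]
  refine div_ne_zero (prod_ne_zero_iff.2 fun j _ => ?_)
    (prod_ne_zero_iff.2 fun j hj => T.l_sub_l_ne_zero (k + 1) (ne_of_mem_erase hj).symm)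
  rcases Nat.lt_or_ge j i with hij | hij
  · rw [← neg_sub, neg_ne_zero]
    refine T.l_ne_l_of_lt ?_
    have h1 := T.pattern_succ_succ_le k j
    have h2 := T.pattern_anti (k + 1) (by omega : j + 1 ≤ i)
    omega
  · refine T.l_ne_l_of_lt ?_
    have h1 := T.pattern_anti k hij
    rw [Nat.add_sub_cancel] at hlt
    omega

theorem isRankedPoset : (diagram lam n).IsRankedPoset where
  covBy_iff _ _ := covBy_iff_edge
  color_unique _ _ _ _ h h' := edge_color_unique h h'
  label_ne_zero _ _ _ h := by
    obtain ⟨i, h⟩ := diagram_edge_iff.1 h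
    exact Or.inl h.cLabel_ne_zero
  rank_covBy _ _ h := by
    obtain ⟨k, h⟩ := covBy_iff_edge.1 h
    exact rank_of_edge h

end GT

/-! ### Representations of `gl_N` from Chevalley generators -/

section GlSystem

variable {L : Type*} [LieRing L]

/-- A family `E i j`, `i, j < N`, satisfying the commutation relations of the matrix units of
`gl_N`. -/
def IsGlSystem (N : ℕ) (E : ℕ → ℕ → L) : Prop :=
  ∀ i j k l, i < N → j < N → k < N → l < N →
    ⁅E i j, E k l⁆ = (if j = k then E i l else 0) - if l = i then E k j else 0

/-- The relations between the Chevalley generators `E_{k,k+1}`, `E_{k+1,k}` and the diagonal matrix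
units of `gl_N`, including the Serre relations. -/
structure IsGlChevalleySystem (N : ℕ) (h e f : ℕ → L) : Prop where
  lie_h_h : ∀ i j, i < N → j < N → ⁅h i, h j⁆ = 0
  lie_h_e : ∀ i j, i < N → j + 1 < N →
    ⁅h i, e j⁆ = (if i = j then e j else 0) - if i = j + 1 then e j else 0
  lie_h_f : ∀ i j, i < N → j + 1 < N →
    ⁅h i, f j⁆ = (if i = j + 1 then f j else 0) - if i = j then f j else 0
  lie_e_f : ∀ i j, i + 1 < N → j + 1 < N →
    ⁅e i, f j⁆ = if i = j then h i - h (i + 1) else 0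
  lie_e_e : ∀ i j, j + 1 < N → i + 1 < j → ⁅e i, e j⁆ = 0
  lie_f_f : ∀ i j, j + 1 < N → i + 1 < j → ⁅f i, f j⁆ = 0
  serre_e : ∀ i, i + 2 < N → ⁅e i, ⁅e i, e (i + 1)⁆⁆ = 0
  serre_e' : ∀ i, i + 2 < N → ⁅e (i + 1), ⁅e (i + 1), e i⁆⁆ = 0
  serre_f : ∀ i, i + 2 < N → ⁅f i, ⁅f i, f (i + 1)⁆⁆ = 0
  serre_f' : ∀ i, i + 2 < N → ⁅f (i + 1), ⁅f (i + 1), f i⁆⁆ = 0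

namespace IsGlSystem

variable {N : ℕ} {E : ℕ → ℕ → L}

/-- The automorphism `x ↦ -xᵀ` of `gl_N`; it exchanges raising and lowering operators. -/
theorem neg_swap (hE : IsGlSystem N E) : IsGlSystem N fun i j => -E j i := by
  intro i j k l hi hj hk hl
  rw [neg_lie, lie_neg, neg_neg, hE j i l k hj hi hl hk]
  simp only [eq_comm (a := l) (b := i), eq_comm (a := k) (b := j)]
  split_ifs <;> abel

theorem lie_eq_zero_of_le (hE : IsGlSystem N E) {z : L} {J : ℕ} (hJ : J ≤ N)
    (hd : ∀ i, i < J → ⁅E i i, z⁆ = 0) (hu : ∀ i, i + 1 < J → ⁅E i (i + 1), z⁆ = 0)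
    {i j : ℕ} (hij : i ≤ j) (hj : j < J) : ⁅E i j, z⁆ = 0 := by
  induction j, hij using Nat.le_induction with
  | base => exact hd i hj
  | succ j hij ih =>
    have h1 := hE i j j (j + 1) (by omega) (by omega) (by omega) (by omega)
    rw [if_pos rfl, if_neg (by omega), sub_zero] at h1
    rw [← h1, lie_lie, hu j hj, ih (by omega), lie_zero, lie_zero, sub_zero]

theorem lie_eq_zero_of_ge (hE : IsGlSystem N E) {z : L} {J : ℕ} (hJ : J ≤ N)
    (hd : ∀ i, i < J → ⁅E i i, z⁆ = 0) (hl : ∀ i, i + 1 < N → ⁅E (i + 1) i, z⁆ = 0)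
    {i j : ℕ} (hij : j ≤ i) (hj : j < J) (hi : i < N) : ⁅E i j, z⁆ = 0 := by
  induction i, hij using Nat.le_induction with
  | base => exact hd j hj
  | succ i hij ih =>
    have h1 := hE (i + 1) i i j (by omega) (by omega) (by omega) (by omega)
    rw [if_pos rfl, if_neg (by omega), sub_zero] at h1
    rw [← h1, lie_lie, hl i hi, ih (by omega), lie_zero, lie_zero, sub_zero]

end IsGlSystem

/-- The relations of an additional raising generator `e`, to become `E_{q,q+1}`, with the matrix
units of `gl_{q+1}`. -/
structure IsNextRaising (q : ℕ) (E : ℕ → ℕ → L) (e : L) : Prop where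
  isGlSystem : IsGlSystem (q + 1) E
  lie_diag : ∀ i, i ≤ q → ⁅E i i, e⁆ = if i = q then e else 0
  lie_lower : ∀ i, i + 1 ≤ q → ⁅E (i + 1) i, e⁆ = 0
  lie_upper : ∀ i, i + 1 < q → ⁅E i (i + 1), e⁆ = 0
  serre : ∀ p, p + 1 = q → ⁅E p q, ⁅E p q, e⁆⁆ = 0
  serre' : ∀ p, p + 1 = q → ⁅e, ⁅e, E p q⁆⁆ = 0

namespace IsNextRaising

variable {q : ℕ} {E : ℕ → ℕ → L} {e : L}

theorem lie_eq_zero (h : IsNextRaising q E e) {i j : ℕ} (hi : i ≤ q) (hj : j < q) :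
    ⁅E i j, e⁆ = 0 := by
  have hd : ∀ i, i < q → ⁅E i i, e⁆ = 0 := fun i hi => by
    rw [h.lie_diag i hi.le, if_neg hi.ne]
  rcases le_total i j with hij | hij
  · exact h.isGlSystem.lie_eq_zero_of_le (Nat.le_succ q) hd (fun i hi => h.lie_upper i hi) hij hj
  · exact h.isGlSystem.lie_eq_zero_of_ge (Nat.le_succ q) hd
      (fun i hi => h.lie_lower i (by omega)) hij hj (by omega)

theorem lie_last (h : IsNextRaising q E e) : ⁅E q q, e⁆ = e := by
  rw [h.lie_diag q le_rfl, if_pos rfl]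

theorem lie_lie_of_lt (h : IsNextRaising q E e) {i j k : ℕ} (hi : i ≤ q) (hj : j < q) (hk : k ≤ q) :
    ⁅E i j, ⁅E k q, e⁆⁆ = if j = k then ⁅E i q, e⁆ else 0 := by
  rw [leibniz_lie, h.lie_eq_zero hi hj, lie_zero, add_zero,
    h.isGlSystem i j k q (by omega) (by omega) (by omega) (by omega), sub_lie]
  have h1 : ⁅(if q = i then E k j else 0), e⁆ = 0 := by
    split_ifs
    · exact h.lie_eq_zero hk hj
    · exact zero_lie e
  rw [h1, sub_zero]
  split_ifs
  · rfl
  · exact zero_lie e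

theorem lie_lie_symm (h : IsNextRaising q E e) {i k : ℕ} (hi : i < q) (hk : k < q) :
    ⁅E k q, ⁅E i q, e⁆⁆ = ⁅E i q, ⁅E k q, e⁆⁆ := by
  rw [leibniz_lie, h.isGlSystem k q i q (by omega) (by omega) (by omega) (by omega),
    if_neg (by omega), if_neg (by omega), sub_zero, zero_lie, zero_add]

/-- The relation `[E_{kq}, E_{i,q+1}] = 0`: it is obtained from the Serre relation by applying the
derivations `ad E_{i,q-1}` and `ad E_{k,q-1}`. -/
theorem lie_lie_eq_zero [IsAddTorsionFree L] (h : IsNextRaising q E e) {i k : ℕ} (hi : i < q)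
    (hk : k < q) :
    ⁅E k q, ⁅E i q, e⁆⁆ = 0 := by
  obtain ⟨p, rfl⟩ : ∃ p, q = p + 1 := ⟨q - 1, by omega⟩
  have hE := h.isGlSystem
  have h0 := h.serre p rfl
  have h1 : ∀ i, i < p + 1 → ⁅E i (p + 1), ⁅E p (p + 1), e⁆⁆ = 0 := by
    intro i hi
    rcases eq_or_ne i p with rfl | hip
    · exact h0
    have h2 := congrArg (fun z => ⁅E i p, z⁆) h0
    simp only [lie_zero] at h2
    rw [leibniz_lie, h.lie_lie_of_lt hi.le (Nat.lt_succ_self p) (Nat.le_succ p), if_pos rfl,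
      hE i p p (p + 1) (by omega) (by omega) (by omega) (by omega), if_pos rfl, if_neg (by omega),
      sub_zero, h.lie_lie_symm hi (Nat.lt_succ_self p), ← two_nsmul] at h2
    exact (smul_eq_zero_iff_right (two_ne_zero)).1 h2
  rcases eq_or_ne i p with rfl | hip
  · exact h1 k hk
  rcases eq_or_ne k p with rfl | hkp
  · rw [h.lie_lie_symm hi hk, h1 i hi]
  have h2 := congrArg (fun z => ⁅E k p, z⁆) (h1 i hi)
  simp only [lie_zero] at h2
  rw [leibniz_lie, h.lie_lie_of_lt hk.le (Nat.lt_succ_self p) (Nat.le_succ p), if_pos rfl,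
    hE k p i (p + 1) (by omega) (by omega) (by omega) (by omega), if_neg (by omega),
    if_neg (by omega), sub_zero, zero_lie, zero_add] at h2
  rw [h.lie_lie_symm hi hk, h2]

/-- The relations `[E_{ij}, E_{k,q+1}] = δ_{jk} E_{i,q+1}`. -/
theorem lie_lie [IsAddTorsionFree L] (h : IsNextRaising q E e) {i j k : ℕ} (hi : i ≤ q) (hj : j ≤ q)
    (hk : k ≤ q) : ⁅E i j, ⁅E k q, e⁆⁆ = if j = k then ⁅E i q, e⁆ else 0 := by
  rcases hj.lt_or_eq with hj | rfl
  · exact h.lie_lie_of_lt hi hj hk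
  rcases hk.lt_or_eq with hk | rfl
  · rw [if_neg hk.ne']
    rcases hi.lt_or_eq with hi | rfl
    · exact h.lie_lie_eq_zero hk hi
    · rw [leibniz_lie, h.lie_last, h.isGlSystem i i k i (by omega) (by omega) (by omega) (by omega),
        if_neg (by omega), if_pos rfl, zero_sub, neg_lie, neg_add_cancel]
  · rw [if_pos rfl, h.lie_last]

theorem lie_self_eq_zero (h : IsNextRaising q E e) {i : ℕ} (hi : i ≤ q) :
    ⁅⁅E i q, e⁆, e⁆ = 0 := by
  rcases hi.lt_or_eq with hi | rfl
  · obtain ⟨p, rfl⟩ : ∃ p, q = p + 1 := ⟨q - 1, by omega⟩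
    have h0 : ⁅⁅E p (p + 1), e⁆, e⁆ = 0 := by
      have h1 := h.serre' p rfl
      rw [← lie_skew (E p (p + 1)) e, neg_lie, lie_skew, h1]
    have h1 := h.lie_lie_of_lt hi.le (Nat.lt_succ_self p) (Nat.le_succ p)
    rw [if_pos rfl] at h1
    rw [← h1, _root_.lie_lie, h0, h.lie_eq_zero hi.le (Nat.lt_succ_self p), lie_zero, lie_zero,
      sub_zero]
  · rw [h.lie_last, lie_self]

theorem lie_lie_lie_eq_zero [IsAddTorsionFree L] (h : IsNextRaising q E e) {i j : ℕ} (hi : i ≤ q)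
    (hj : j ≤ q) : ⁅⁅E i q, e⁆, ⁅E j q, e⁆⁆ = 0 := by
  rw [leibniz_lie, h.lie_self_eq_zero hi, lie_zero, add_zero, ← lie_skew ⁅E i q, e⁆ (E j q),
    h.lie_lie hj le_rfl hi]
  split_ifs
  · rw [neg_lie, h.lie_self_eq_zero hj, neg_zero]
  · rw [neg_zero, zero_lie]

end IsNextRaising

/-- The extension of a system of matrix units of `gl_{q+1}` by a last column, a last row and a last
diagonal entry. -/
def extendSystem (q : ℕ) (E : ℕ → ℕ → L) (e f h : L) (i j : ℕ) : L :=
  if i ≤ q then (if j ≤ q then E i j else ⁅E i q, e⁆) else (if j ≤ q then ⁅f, E q j⁆ else h)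

/-- The relations with the new row are those with the new column after the automorphism
`x ↦ -xᵀ`; the remaining ones follow from the Jacobi identity. -/
theorem isGlSystem_extendSystem [IsAddTorsionFree L] {q : ℕ} {E : ℕ → ℕ → L} {e f h : L}
    (he : IsNextRaising q E e) (hf : IsNextRaising q (fun i j => -E j i) (-f))
    (hE : ∀ i j, i ≤ q → j ≤ q → ⁅h, E i j⁆ = 0) (hhe : ⁅h, e⁆ = -e) (hhf : ⁅h, f⁆ = f)
    (hef : ⁅e, f⁆ = E q q - h) : IsGlSystem (q + 2) (extendSystem q E e f h) := by
  have hsys := he.isGlSystem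
  set A : ℕ → L := fun i => ⁅E i q, e⁆ with hA
  set C : ℕ → L := fun i => ⁅f, E q i⁆ with hC
  have hC' : ∀ i, ⁅-E q i, -f⁆ = -C i := fun i => by
    rw [neg_lie, lie_neg, neg_neg, hC, lie_skew]
  have hEA : ∀ i j k, i ≤ q → j ≤ q → k ≤ q → ⁅E i j, A k⁆ = if j = k then A i else 0 :=
    fun i j k hi hj hk => he.lie_lie hi hj hk
  have hEC : ∀ i j k, i ≤ q → j ≤ q → k ≤ q → ⁅E i j, C k⁆ = -if i = k then C j else 0 := by
    intro i j k hi hj hk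
    have h1 := hf.lie_lie hj hi hk
    rw [hC', hC', neg_lie, lie_neg, neg_neg] at h1
    rw [h1]
    split_ifs
    · rfl
    · rw [neg_zero]
  have hAA : ∀ i j, i ≤ q → j ≤ q → ⁅A i, A j⁆ = 0 := fun i j hi hj =>
    he.lie_lie_lie_eq_zero hi hj
  have hCC : ∀ i j, i ≤ q → j ≤ q → ⁅C i, C j⁆ = 0 := by
    intro i j hi hj
    have h1 := hf.lie_lie_lie_eq_zero hi hj
    rwa [hC', hC', neg_lie, lie_neg, neg_neg] at h1
  have hhA : ∀ i, i ≤ q → ⁅h, A i⁆ = -A i := by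
    intro i hi
    rw [hA, leibniz_lie, hE i q hi le_rfl, zero_lie, zero_add, hhe, lie_neg]
  have hhC : ∀ i, i ≤ q → ⁅h, C i⁆ = C i := by
    intro i hi
    rw [hC, leibniz_lie, hE q i le_rfl hi, lie_zero, add_zero, hhf]
  have hAf : ∀ i, i ≤ q → ⁅A i, f⁆ = E i q - if i = q then h else 0 := by
    intro i hi
    rcases hi.lt_or_eq with hi | rfl
    · have h1 : ⁅E i q, f⁆ = 0 := by
        have := hf.lie_eq_zero le_rfl hi
        rwa [neg_lie, lie_neg, neg_neg] at this
      have h2 : ⁅E i q, h⁆ = 0 := by rw [← lie_skew, hE i q hi.le le_rfl, neg_zero]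
      rw [hA, lie_lie, h1, lie_zero, sub_zero, hef, lie_sub, h2, sub_zero, if_neg hi.ne, sub_zero,
        hsys i q q q (by omega) (by omega) (by omega) (by omega), if_pos rfl, if_neg (by omega),
        sub_zero]
    · have h1 : A i = e := he.lie_last
      rw [h1, hef, if_pos rfl]
  have hAC : ∀ i j, i ≤ q → j ≤ q → ⁅A i, C j⁆ = E i j - if i = j then h else 0 := by
    intro i j hi hj
    have h1 : ⁅A i, E q j⁆ = -if j = i then e else 0 := by
      rw [← lie_skew, hEA q j i le_rfl hj hi]
      have : A q = e := he.lie_last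
      rw [this]
    have h3 : ⁅E i q - (if i = q then h else 0), E q j⁆ = E i j - if j = i then E q q else 0 := by
      rw [sub_lie, hsys i q q j (by omega) (by omega) (by omega) (by omega), if_pos rfl]
      have : ⁅(if i = q then h else 0), E q j⁆ = 0 := by
        split_ifs
        · exact hE q j le_rfl hj
        · exact zero_lie _
      rw [this, sub_zero]
    have h4 : ⁅f, ⁅A i, E q j⁆⁆ = if j = i then E q q - h else 0 := by
      rw [h1, lie_neg, lie_skew]
      split_ifs
      · exact hef
      · exact zero_lie _
    change ⁅A i, ⁅f, E q j⁆⁆ = _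
    rw [leibniz_lie, hAf i hi, h3, h4]
    simp only [eq_comm (a := j) (b := i)]
    split_ifs <;> abel
  have hx1 : ∀ i j, i ≤ q → j ≤ q → extendSystem q E e f h i j = E i j := fun i j hi hj => by
    rw [extendSystem, if_pos hi, if_pos hj]
  have hx2 : ∀ i, i ≤ q → extendSystem q E e f h i (q + 1) = A i := fun i hi => by
    rw [extendSystem, if_pos hi, if_neg (by omega)]
  have hx3 : ∀ j, j ≤ q → extendSystem q E e f h (q + 1) j = C j := fun j hj => by
    rw [extendSystem, if_neg (by omega), if_pos hj]
  have hx4 : extendSystem q E e f h (q + 1) (q + 1) = h := by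
    rw [extendSystem, if_neg (by omega), if_neg (by omega)]
  have hcases : ∀ i, i < q + 2 → i ≤ q ∨ i = q + 1 := fun i hi => by omega
  have hne : ∀ i, i ≤ q → i ≠ q + 1 := fun i hi => by omega
  have hne' : ∀ i, i ≤ q → q + 1 ≠ i := fun i hi => by omega
  intro i j k l hi hj hk hl
  rcases hcases i hi with hi | rfl <;> rcases hcases j hj with hj | rfl <;>
    rcases hcases k hk with hk | rfl <;> rcases hcases l hl with hl | rfl
  · rw [hx1 i j hi hj, hx1 k l hk hl, hx1 i l hi hl, hx1 k j hk hj]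
    exact hsys i j k l (by omega) (by omega) (by omega) (by omega)
  · rw [hx1 i j hi hj, hx2 k hk, hx2 i hi, hEA i j k hi hj hk, if_neg (hne' i hi), sub_zero]
  · rw [hx1 i j hi hj, hx3 l hl, hx3 j hj, hEC i j l hi hj hl, if_neg (hne j hj), zero_sub]
    simp only [eq_comm]
  · rw [hx1 i j hi hj, hx4, if_neg (hne j hj), if_neg (hne' i hi), sub_zero, ← lie_skew,
      hE i j hi hj, neg_zero]
  · rw [hx2 i hi, hx1 k l hk hl, hx2 k hk, if_neg (hne' k hk), zero_sub, ← lie_skew,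
      hEA k l i hk hl hi]
  · rw [hx2 i hi, hx2 k hk, if_neg (hne' k hk), if_neg (hne' i hi), sub_zero, hAA i k hi hk]
  · rw [hx2 i hi, hx3 l hl, hx1 i l hi hl, hx4, if_pos rfl, hAC i l hi hl]
    simp only [eq_comm]
  · rw [hx2 i hi, hx4, if_pos rfl, if_neg (hne' i hi), sub_zero, ← lie_skew, hhA i hi, neg_neg]
  · rw [hx3 j hj, hx1 k l hk hl, hx3 l hl, if_neg (hne l hl), sub_zero, ← lie_skew,
      hEC k l j hk hl hj, neg_neg]
    simp only [eq_comm]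
  · rw [hx3 j hj, hx2 k hk, hx4, hx1 k j hk hj, if_pos rfl, ← lie_skew, hAC k j hk hj, neg_sub]
    simp only [eq_comm]
  · rw [hx3 j hj, hx3 l hl, if_neg (hne j hj), if_neg (hne l hl), sub_zero, hCC j l hj hl]
  · rw [hx3 j hj, hx4, if_neg (hne j hj), if_pos rfl, zero_sub, ← lie_skew, hhC j hj]
  · rw [hx4, hx1 k l hk hl, if_neg (hne' k hk), if_neg (hne l hl), sub_zero, hE k l hk hl]
  · rw [hx4, hx2 k hk, if_neg (hne' k hk), if_pos rfl, zero_sub, hhA k hk]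
  · rw [hx4, hx3 l hl, if_pos rfl, if_neg (hne l hl), sub_zero, hhC l hl]
  · rw [hx4, if_pos rfl, lie_self, sub_self]

theorem IsGlChevalleySystem.neg_swap {N : ℕ} {h e f : ℕ → L} (hs : IsGlChevalleySystem N h e f) :
    IsGlChevalleySystem N (fun i => -h i) (fun i => -f i) (fun i => -e i) where
  lie_h_h i j hi hj := by rw [neg_lie, lie_neg, neg_neg, hs.lie_h_h i j hi hj]
  lie_h_e i j hi hj := by
    rw [neg_lie, lie_neg, neg_neg, hs.lie_h_f i j hi hj]
    split_ifs <;> abel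
  lie_h_f i j hi hj := by
    rw [neg_lie, lie_neg, neg_neg, hs.lie_h_e i j hi hj]
    split_ifs <;> abel
  lie_e_f i j hi hj := by
    rw [neg_lie, lie_neg, neg_neg, ← lie_skew, hs.lie_e_f j i hj hi]
    rcases eq_or_ne i j with rfl | hij
    · rw [if_pos rfl, if_pos rfl]; abel
    · rw [if_neg hij, if_neg hij.symm, neg_zero]
  lie_e_e i j hj hij := by rw [neg_lie, lie_neg, neg_neg, hs.lie_f_f i j hj hij]
  lie_f_f i j hj hij := by rw [neg_lie, lie_neg, neg_neg, hs.lie_e_e i j hj hij]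
  serre_e i hi := by simp only [neg_lie, lie_neg, neg_neg, hs.serre_f i hi, neg_zero]
  serre_e' i hi := by simp only [neg_lie, lie_neg, neg_neg, hs.serre_f' i hi, neg_zero]
  serre_f i hi := by simp only [neg_lie, lie_neg, neg_neg, hs.serre_e i hi, neg_zero]
  serre_f' i hi := by simp only [neg_lie, lie_neg, neg_neg, hs.serre_e' i hi, neg_zero]

theorem IsGlChevalleySystem.isNextRaising {N q : ℕ} {h e f : ℕ → L}
    (hs : IsGlChevalleySystem N h e f) (hq : q + 1 < N) {E : ℕ → ℕ → L}
    (hE : IsGlSystem (q + 1) E) (hd : ∀ i, i ≤ q → E i i = h i)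
    (hu : ∀ i, i + 1 ≤ q → E i (i + 1) = e i) (hl : ∀ i, i + 1 ≤ q → E (i + 1) i = f i) :
    IsNextRaising q E (e q) where
  isGlSystem := hE
  lie_diag i hi := by
    rw [hd i hi, hs.lie_h_e i q (by omega) hq, if_neg (by omega : i ≠ q + 1), sub_zero]
  lie_lower i hi := by
    rw [hl i hi, ← lie_skew, hs.lie_e_f q i hq (by omega), if_neg (by omega), neg_zero]
  lie_upper i hi := by
    rw [hu i hi.le, hs.lie_e_e i q hq hi]
  serre p hp := by
    subst hp
    rw [hu p le_rfl, hs.serre_e p (by omega)]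
  serre' p hp := by
    subst hp
    rw [hu p le_rfl, hs.serre_e' p (by omega)]

/-- Chevalley generators satisfying the Serre relations extend to a system of matrix units, one row
and column at a time: `E_{i,q+1} = [E_{iq}, E_{q,q+1}]` and `E_{q+1,i} = [E_{q+1,q}, E_{qi}]`. -/
theorem IsGlChevalleySystem.exists_isGlSystem [IsAddTorsionFree L] {N : ℕ} {h e f : ℕ → L}
    (hs : IsGlChevalleySystem N h e f) : ∃ E : ℕ → ℕ → L, IsGlSystem N E ∧
      (∀ i, i < N → E i i = h i) ∧ (∀ i, i + 1 < N → E i (i + 1) = e i) ∧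
      ∀ i, i + 1 < N → E (i + 1) i = f i := by
  suffices H : ∀ m, m ≤ N → ∃ E : ℕ → ℕ → L, IsGlSystem m E ∧
      (∀ i, i < m → E i i = h i) ∧ (∀ i, i + 1 < m → E i (i + 1) = e i) ∧
      ∀ i, i + 1 < m → E (i + 1) i = f i from H N le_rfl
  intro m
  induction m with
  | zero =>
    intro _
    exact ⟨fun _ _ => 0, fun i _ _ _ hi => absurd hi (Nat.not_lt_zero i),
      fun i hi => absurd hi (Nat.not_lt_zero i), fun i hi => absurd hi (Nat.not_lt_zero _),
      fun i hi => absurd hi (Nat.not_lt_zero _)⟩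
  | succ m ih =>
    intro hm
    obtain ⟨E, hE, hd, hu, hl⟩ := ih (by omega)
    rcases m with _ | q
    · refine ⟨fun _ _ => h 0, ?_, ?_, fun i hi => by omega, fun i hi => by omega⟩
      · intro i j k l hi hj hk hl
        rw [lie_self, if_pos (by omega), if_pos (by omega), sub_self]
      · intro i hi
        obtain rfl : i = 0 := by omega
        rfl
    · have he : IsNextRaising q E (e q) := hs.isNextRaising (by omega) hE
        (fun i hi => hd i (by omega)) (fun i hi => hu i (by omega)) fun i hi => hl i (by omega)
      have hf : IsNextRaising q (fun i j => -E j i) (-f q) :=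
        hs.neg_swap.isNextRaising (by omega) hE.neg_swap
          (fun i hi => by rw [hd i (by omega)]) (fun i hi => by rw [hl i (by omega)])
          fun i hi => by rw [hu i (by omega)]
      have hhE : ∀ i j, i ≤ q → j ≤ q → ⁅h (q + 1), E i j⁆ = 0 := by
        intro i j hi hj
        have h1 : ∀ i, i < q + 1 → ⁅E i i, h (q + 1)⁆ = 0 := fun i hi => by
          rw [hd i hi, hs.lie_h_h i (q + 1) (by omega) (by omega)]
        have h2 : ∀ i, i + 1 < q + 1 → ⁅E i (i + 1), h (q + 1)⁆ = 0 := fun i hi => by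
          rw [hu i hi, ← lie_skew, hs.lie_h_e (q + 1) i (by omega) (by omega), if_neg (by omega),
            if_neg (by omega), sub_zero, neg_zero]
        have h3 : ∀ i, i + 1 < q + 1 → ⁅E (i + 1) i, h (q + 1)⁆ = 0 := fun i hi => by
          rw [hl i hi, ← lie_skew, hs.lie_h_f (q + 1) i (by omega) (by omega), if_neg (by omega),
            if_neg (by omega), sub_zero, neg_zero]
        rw [← lie_skew, neg_eq_zero]
        rcases le_total i j with hij | hij
        · exact hE.lie_eq_zero_of_le le_rfl h1 h2 hij (by omega)
        · exact hE.lie_eq_zero_of_ge le_rfl h1 h3 hij (by omega) (by omega)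
      refine ⟨extendSystem q E (e q) (f q) (h (q + 1)),
        isGlSystem_extendSystem he hf hhE ?_ ?_ ?_, ?_, ?_, ?_⟩
      · rw [hs.lie_h_e (q + 1) q (by omega) (by omega), if_neg (by omega), if_pos rfl, zero_sub]
      · rw [hs.lie_h_f (q + 1) q (by omega) (by omega), if_pos rfl, if_neg (by omega), sub_zero]
      · rw [hs.lie_e_f q q (by omega) (by omega), if_pos rfl, hd q (by omega)]
      · intro i hi
        rcases (by omega : i ≤ q ∨ i = q + 1) with hi | rfl
        · rw [extendSystem, if_pos hi, if_pos hi, hd i (by omega)]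
        · rw [extendSystem, if_neg (by omega), if_neg (by omega)]
      · intro i hi
        rcases (by omega : i + 1 ≤ q ∨ i = q) with hi | rfl
        · rw [extendSystem, if_pos (by omega), if_pos hi, hu i (by omega)]
        · rw [extendSystem, if_pos le_rfl, if_neg (by omega), he.lie_last]
      · intro i hi
        rcases (by omega : i + 1 ≤ q ∨ i = q) with hi | rfl
        · rw [extendSystem, if_pos hi, if_pos (by omega), hl i (by omega)]
        · rw [extendSystem, if_neg (by omega), if_pos le_rfl, ← lie_skew]
          have h1 := hf.lie_last
          rw [neg_lie, lie_neg, neg_neg] at h1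
          rw [h1, neg_neg]

/-- A system of matrix units in a Lie algebra defines a homomorphism from `gl_N`. -/
theorem IsGlSystem.exists_lieHom [LieAlgebra ℂ L] {N : ℕ} {E : ℕ → ℕ → L} (hE : IsGlSystem N E) :
    ∃ ψ : Matrix (Fin N) (Fin N) ℂ →ₗ⁅ℂ⁆ L, ∀ i j, ψ (Matrix.single i j 1) = E i j := by
  let ψ₀ : Matrix (Fin N) (Fin N) ℂ →ₗ[ℂ] L :=
    (Matrix.stdBasis ℂ (Fin N) (Fin N)).constr ℂ fun p => E p.1 p.2
  have hψ : ∀ i j, ψ₀ (Matrix.single i j 1) = E i j := by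
    intro i j
    rw [← Matrix.stdBasis_eq_single ℂ i j, Module.Basis.constr_basis]
  refine ⟨{ ψ₀ with map_lie' := ?_ }, hψ⟩
  intro x y
  change ψ₀ ⁅x, y⁆ = ⁅ψ₀ x, ψ₀ y⁆
  have h1 : (LieModule.toEnd ℂ (Matrix (Fin N) (Fin N) ℂ) (Matrix (Fin N) (Fin N) ℂ)
      : _ →ₗ[ℂ] _).compr₂ ψ₀ =
      (LieModule.toEnd ℂ L L : L →ₗ[ℂ] _).compl₁₂ ψ₀ ψ₀ := by
    refine (Matrix.stdBasis ℂ (Fin N) (Fin N)).ext fun p =>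
      (Matrix.stdBasis ℂ (Fin N) (Fin N)).ext fun r => ?_
    obtain ⟨i, j⟩ := p
    obtain ⟨k, l⟩ := r
    rw [Matrix.stdBasis_eq_single, Matrix.stdBasis_eq_single]
    change ψ₀ ⁅Matrix.single i j (1 : ℂ), Matrix.single k l (1 : ℂ)⁆ =
      ⁅ψ₀ (Matrix.single i j 1), ψ₀ (Matrix.single k l 1)⁆
    rw [hψ, hψ, hE i j k l i.2 j.2 k.2 l.2, Ring.lie_def, map_sub]
    congr 1
    · rcases eq_or_ne j k with rfl | hjk
      · rw [Matrix.single_mul_single_same, mul_one, hψ, if_pos rfl]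
      · rw [Matrix.single_mul_single_of_ne _ _ _ _ hjk, map_zero,
          if_neg (fun h => hjk (Fin.ext h))]
    · rcases eq_or_ne l i with rfl | hli
      · rw [Matrix.single_mul_single_same, mul_one, hψ, if_pos rfl]
      · rw [Matrix.single_mul_single_of_ne _ _ _ _ hli, map_zero,
          if_neg (fun h => hli (Fin.ext h))]
  exact congrArg (fun φ => φ x y) h1

end GlSystem

/-! ### The operators of a labeled diagram -/

namespace LabeledDiagram

variable {I P : Type*} (D : LabeledDiagram I P)

theorem opH_single (i : I) (s : P) (a : ℂ) :
    D.opH i (Finsupp.single s a) = Finsupp.single s (a * D.m i s) := by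
  rw [opH, Finsupp.linearCombination_single, Finsupp.smul_single, smul_eq_mul]

variable [Fintype P]

open Classical in
theorem opX_single (i : I) (s : P) (a : ℂ) :
    D.opX i (Finsupp.single s a) = ∑ t with D.edge i s t, Finsupp.single t (a * D.c t s) := by
  rw [opX, Finsupp.linearCombination_single, smul_sum]
  simp

open Classical in
theorem opY_single (i : I) (t : P) (a : ℂ) :
    D.opY i (Finsupp.single t a) = ∑ s with D.edge i s t, Finsupp.single s (a * D.d s t) := by
  rw [opY, Finsupp.linearCombination_single, smul_sum]
  simp

open Classical in
theorem opX_apply (i : I) (v : P →₀ ℂ) (t : P) :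
    D.opX i v t = ∑ s with D.edge i s t, v s * D.c t s := by
  induction v using Finsupp.induction_linear with
  | zero => simp
  | add f g hf hg =>
    rw [map_add, Finsupp.add_apply, hf, hg, ← sum_add_distrib]
    exact sum_congr rfl fun s _ => by rw [Finsupp.add_apply, add_mul]
  | single s a =>
    rw [opX_single, Finsupp.finsetSum_apply]
    simp only [sum_filter, Finsupp.single_apply, ite_mul, zero_mul]
    rw [sum_eq_single t, sum_eq_single s]
    · simp
    · intro b _ hb
      simp [hb.symm]
    · simp
    · intro b _ hb
      simp [hb]
    · simp

open Classical in
theorem opY_apply (i : I) (v : P →₀ ℂ) (s : P) :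
    D.opY i v s = ∑ t with D.edge i s t, v t * D.d s t := by
  induction v using Finsupp.induction_linear with
  | zero => simp
  | add f g hf hg =>
    rw [map_add, Finsupp.add_apply, hf, hg, ← sum_add_distrib]
    exact sum_congr rfl fun s _ => by rw [Finsupp.add_apply, add_mul]
  | single t a =>
    rw [opY_single, Finsupp.finsetSum_apply]
    simp only [sum_filter, Finsupp.single_apply, ite_mul, zero_mul]
    rw [sum_eq_single s, sum_eq_single t]
    · simp
    · intro b _ hb
      simp [hb.symm]
    · simp
    · intro b _ hb
      simp [hb]
    · simp

/-- The diagonal entries of `[X_i, Y_i]` are given by the crossing condition, and its off-diagonal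
entries, as well as those of `[X_i, Y_j]`, vanish by the diamond condition. -/
theorem opX_mul_opY_sub [PartialOrder P] [DecidableEq I] (hD : D.IsRankedPoset)
    (hcross : D.CrossingCondition) (hdiamond : D.DiamondCondition) (i j : I) :
    D.opX i * D.opY j - D.opY j * D.opX i = if i = j then D.opH i else 0 := by
  classical
  have hrank : ∀ i s t, D.edge i s t → D.rank t = D.rank s + 1 := fun i s t h =>
    hD.rank_covBy s t ((hD.covBy_iff s t).2 ⟨i, h⟩)
  refine Finsupp.lhom_ext' fun s => LinearMap.ext_ring (Finsupp.ext fun t => ?_)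
  have hXY : D.opX i (D.opY j (Finsupp.single s 1)) t =
      ∑ r with D.edge j r s ∧ D.edge i r t, D.d r s * D.c t r := by
    rw [opX_apply, sum_filter, sum_filter]
    refine sum_congr rfl fun r _ => ?_
    rw [opY_apply, sum_filter, sum_eq_single s]
    · by_cases h1 : D.edge i r t <;> by_cases h2 : D.edge j r s <;> simp [h1, h2]
    · intro b _ hb
      simp [hb.symm]
    · simp
  have hYX : D.opY j (D.opX i (Finsupp.single s 1)) t =
      ∑ u with D.edge i s u ∧ D.edge j t u, D.c u s * D.d t u := by
    rw [opY_apply, sum_filter, sum_filter]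
    refine sum_congr rfl fun u _ => ?_
    rw [opX_apply, sum_filter, sum_eq_single s]
    · by_cases h1 : D.edge i s u <;> by_cases h2 : D.edge j t u <;> simp [h1, h2]
    · intro b _ hb
      simp [hb.symm]
    · simp
  change (D.opX i * D.opY j - D.opY j * D.opX i) (Finsupp.single s 1) t = _
  rw [LinearMap.sub_apply, Module.End.mul_apply, Module.End.mul_apply,
    Finsupp.sub_apply, hXY, hYX]
  change _ = (if i = j then D.opH i else 0) (Finsupp.single s 1) t
  by_cases hst : s = t
  · subst hst
    by_cases hij : i = j
    · subst hij
      rw [if_pos rfl, opH_single, Finsupp.single_eq_same, one_mul, ← hcross s i]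
      simp only [and_self, edgeProd, mul_comm]
    · rw [if_neg hij, sum_eq_zero, sum_eq_zero, sub_self]
      · rfl
      · intro u hu
        obtain ⟨-, h1, h2⟩ := mem_filter.1 hu
        exact absurd (hD.color_unique _ _ _ _ h1 h2) hij
      · intro r hr
        obtain ⟨-, h1, h2⟩ := mem_filter.1 hr
        exact absurd (hD.color_unique _ _ _ _ h2 h1) hij
  · have hR : (if i = j then D.opH i else 0) (Finsupp.single s (1 : ℂ)) t = 0 := by
      split_ifs
      · rw [opH_single, Finsupp.single_apply, if_neg hst]
      · rfl
    rw [hR]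
    by_cases hrk : D.rank s = D.rank t
    · rw [hdiamond s t hst hrk j i, sub_self]
    · rw [sum_eq_zero, sum_eq_zero, sub_self]
      · intro u hu
        obtain ⟨-, h1, h2⟩ := mem_filter.1 hu
        have h3 := hrank _ _ _ h1
        have h4 := hrank _ _ _ h2
        omega
      · intro r hr
        obtain ⟨-, h1, h2⟩ := mem_filter.1 hr
        have h3 := hrank _ _ _ h1
        have h4 := hrank _ _ _ h2
        omega

/-- A nonzero subspace invariant under the raising operators contains a nonzero vector killed by all
of them, since these operators increase the rank. -/
theorem exists_ne_zero_forall_opX_eq_zero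
    (hrank : ∀ i s t, D.edge i s t → D.rank t = D.rank s + 1) (W : Submodule ℂ (P →₀ ℂ))
    (hW : ∀ i, ∀ w ∈ W, D.opX i w ∈ W) (hne : W ≠ ⊥) :
    ∃ w ∈ W, w ≠ 0 ∧ ∀ i, D.opX i w = 0 := by
  classical
  obtain ⟨M, hM⟩ : ∃ M : ℤ, ∀ s, D.rank s ≤ M := by
    obtain ⟨M, hM⟩ := (Set.finite_range D.rank).bddAbove
    exact ⟨M, fun s => hM ⟨s, rfl⟩⟩
  have key : ∀ N : ℕ, ∀ w ∈ W, w ≠ 0 → (∀ s, w s ≠ 0 → M - N < D.rank s) →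
      ∃ w ∈ W, w ≠ 0 ∧ ∀ i, D.opX i w = 0 := by
    intro N
    induction N with
    | zero =>
      intro w _ hw0 hN
      obtain ⟨s, hs⟩ := Finsupp.ne_iff.1 hw0
      have h1 := hN s hs
      have h2 := hM s
      push_cast at h1
      omega
    | succ N ih =>
      intro w hw hw0 hN
      by_cases h : ∀ i, D.opX i w = 0
      · exact ⟨w, hw, hw0, h⟩
      push Not at h
      obtain ⟨i, hi⟩ := h
      refine ih _ (hW i w hw) hi fun t ht => ?_
      rw [opX_apply] at ht
      obtain ⟨s, hs, hs0⟩ := exists_ne_zero_of_sum_ne_zero ht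
      have h1 := hN s (left_ne_zero_of_mul hs0)
      have h2 := hrank i s t (mem_filter.1 hs).2
      push_cast at h1
      omega
  obtain ⟨w, hw, hw0⟩ := W.exists_mem_ne_zero_of_ne_bot hne
  obtain ⟨m, hm⟩ : ∃ m : ℤ, ∀ s, m ≤ D.rank s := by
    obtain ⟨m, hm⟩ := (Set.finite_range D.rank).bddBelow
    exact ⟨m, fun s => hm ⟨s, rfl⟩⟩
  refine key (M - m + 1).toNat w hw hw0 fun s _ => ?_
  have h1 := hm s
  have h2 := hM s
  omega

/-- The diagram with the labels `c` and `d` exchanged and the edges kept: its raising operators are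
the transposes of the lowering operators of the original diagram. -/
def transposeLabels {I P : Type*} (D : LabeledDiagram I P) : LabeledDiagram I P :=
  { D with
    c := fun t s => D.d s t
    d := fun s t => D.c t s }

theorem sum_transposeLabels_opX_mul (i : I) (u w : P →₀ ℂ) :
    ∑ t, D.transposeLabels.opX i u t * w t = ∑ s, u s * D.opY i w s := by
  classical
  simp only [opX_apply, opY_apply, sum_filter, sum_mul, mul_sum]
  rw [sum_comm]
  refine sum_congr rfl fun s _ => sum_congr rfl fun t _ => ?_
  change (if D.edge i s t then u s * D.d s t else 0) * w t =
    u s * if D.edge i s t then w t * D.d s t else 0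
  split_ifs <;> ring

/-- If in the diagram and in its transpose only the multiples of one basis vector `v_{s₀}` are
killed by all raising operators, then `V[P]` has no proper nonzero invariant subspace: the
annihilator of such a subspace would be invariant under the transposed lowering operators, and both
would contain `v_{s₀}`. -/
theorem eq_top_of_invariant (hrank : ∀ i s t, D.edge i s t → D.rank t = D.rank s + 1) (s₀ : P)
    (hX : ∀ w : P →₀ ℂ, (∀ i, D.opX i w = 0) → ∀ s, w s ≠ 0 → s = s₀)
    (hY : ∀ w : P →₀ ℂ, (∀ i, D.transposeLabels.opX i w = 0) → ∀ s, w s ≠ 0 → s = s₀)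
    (W : Submodule ℂ (P →₀ ℂ)) (hWX : ∀ i, ∀ w ∈ W, D.opX i w ∈ W)
    (hWY : ∀ i, ∀ w ∈ W, D.opY i w ∈ W) (hne : W ≠ ⊥) : W = ⊤ := by
  have hzero : ∀ w : P →₀ ℂ, w ≠ 0 → (∀ s, w s ≠ 0 → s = s₀) →
      w s₀ ≠ 0 ∧ ∀ s, s ≠ s₀ → w s = 0 := by
    intro w hw0 h
    obtain ⟨s, hs⟩ := Finsupp.ne_iff.1 hw0
    obtain rfl := h s hs
    exact ⟨hs, fun t ht => by by_contra hc; exact ht (h t hc)⟩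
  by_contra htop
  obtain ⟨w, hw, hw0, hwX⟩ := D.exists_ne_zero_forall_opX_eq_zero hrank W hWX hne
  obtain ⟨hw1, hw2⟩ := hzero w hw0 (hX w hwX)
  obtain ⟨φ, hφ0, hφ⟩ := W.exists_le_ker_of_lt_top (lt_top_iff_ne_top.2 htop)
  let W' : Submodule ℂ (P →₀ ℂ) :=
    { carrier := {u | ∀ w ∈ W, ∑ s, u s * w s = 0}
      add_mem' := by
        intro a b ha hb w hw
        simp only [Finsupp.add_apply, add_mul, sum_add_distrib, ha w hw, hb w hw, add_zero]
      zero_mem' := by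
        intro w _
        simp
      smul_mem' := by
        intro c a ha w hw
        simp only [Finsupp.smul_apply, smul_eq_mul, mul_assoc, ← mul_sum, ha w hw, mul_zero] }
  have hφs : ∀ w : P →₀ ℂ, φ w = ∑ s, φ (Finsupp.single s 1) * w s := by
    intro w
    conv_lhs => rw [← Finsupp.sum_single w, Finsupp.sum_fintype _ _ (by simp), map_sum]
    refine sum_congr rfl fun s _ => ?_
    rw [← mul_one (w s), ← smul_eq_mul, ← Finsupp.smul_single, map_smul, smul_eq_mul, smul_eq_mul,
      mul_one, mul_comm]
  have hW' : W' ≠ ⊥ := by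
    rw [Submodule.ne_bot_iff]
    refine ⟨Finsupp.equivFunOnFinite.symm fun s => φ (Finsupp.single s 1), fun w hw => ?_, ?_⟩
    · have h1 : φ w = 0 := hφ hw
      rw [hφs] at h1
      simpa using h1
    · intro h
      refine hφ0 (LinearMap.ext fun w => ?_)
      rw [hφs]
      refine sum_eq_zero fun s _ => ?_
      have h1 := DFunLike.congr_fun h s
      simp only [Finsupp.equivFunOnFinite_symm_apply_apply, Finsupp.coe_zero, Pi.zero_apply] at h1
      rw [h1, zero_mul]
  obtain ⟨u, hu, hu0, huY⟩ := D.transposeLabels.exists_ne_zero_forall_opX_eq_zero hrank W'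
    (fun i u hu w hw => by rw [sum_transposeLabels_opX_mul]; exact hu _ (hWY i w hw)) hW'
  obtain ⟨hu1, -⟩ := hzero u hu0 (hY u huY)
  have h1 : ∑ s, u s * w s = 0 := hu w hw
  rw [sum_eq_single s₀ (fun s _ hs => by rw [hw2 s hs, mul_zero]) (by simp)] at h1
  exact mul_ne_zero hu1 hw1 h1

end LabeledDiagram

theorem isIrreducibleRep_of_forall_eq_top {L V : Type*} [LieRing L] [LieAlgebra ℂ L]
    [AddCommGroup V] [Module ℂ V] [Nontrivial V] (φ : L →ₗ⁅ℂ⁆ Module.End ℂ V)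
    (h : ∀ W : Submodule ℂ V, (∀ x, ∀ w ∈ W, φ x w ∈ W) → W ≠ ⊥ → W = ⊤) :
    IsIrreducibleRep φ := by
  let _ := LieRingModule.compLieHom V φ
  have _ := LieModule.compLieHom (R := ℂ) V φ
  refine LieModule.IsIrreducible.mk fun N hN => ?_
  have h1 := h N.toSubmodule (fun x w hw => N.lie_mem (x := x) hw)
    (by rwa [Ne, LieSubmodule.toSubmodule_eq_bot])
  rwa [LieSubmodule.toSubmodule_eq_top] at h1

namespace GT

variable {lam : YoungDiagram} {n : ℕ}

/-! ### The highest weight vector -/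

/-- The pattern of the highest tableau, whose `i`-th row consists of entries `i` only. -/
theorem exists_highest (hlam : lam.colLen 0 ≤ n) :
    ∃ T : GT lam n, ∀ k i, T.pattern k i = if i < k then lam.rowLen i else 0 := by
  have h0 : ∀ i, n ≤ i → lam.rowLen i = 0 := by
    intro i hi
    by_contra hc
    have := YoungDiagram.mem_iff_lt_colLen.1
      (YoungDiagram.mem_iff_lt_rowLen.2 (Nat.pos_of_ne_zero hc))
    omega
  refine exists_pattern_eq _ (by simp) ?_ ?_ ?_
  · intro k i
    split_ifs <;> omega
  · intro k i
    have := lam.rowLen_anti i (i + 1) (Nat.le_succ i)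
    split_ifs <;> omega
  · intro k hk i
    split_ifs with h
    · rfl
    · rw [h0 i (by omega)]

theorem not_isPatternAdd_of_highest {T U : GT lam n}
    (hT : ∀ k i, T.pattern k i = if i < k then lam.rowLen i else 0) {k i : ℕ} :
    ¬ IsPatternAdd T U k i := by
  intro h
  have h1 := h.pattern_lt_succ
  have h2 := h.row_lt
  rw [hT, hT, if_pos h2, if_pos (by omega)] at h1
  exact lt_irrefl _ h1

open Classical in
/-- A vector killed by all raising operators is a multiple of the highest basis vector. Row by row,
the tableaux in its support have the largest possible entries: if the first `k` rows of `T` are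
determined in this way by row `k`, and an entry of row `k` could still be increased, then
among the tableaux in the support only `T` contributes to the coefficient of the
increased tableau. -/
theorem eq_highest_of_killed (e : GT lam n → GT lam n → ℂ)
    (he : ∀ S T k i, IsPatternAdd S T k i → e T S ≠ 0) (v : GT lam n →₀ ℂ)
    (hv : ∀ (k : Fin (n - 1)) (U : GT lam n),
      ∑ S with (diagram lam n).edge k S U, v S * e U S = 0)
    {T₀ : GT lam n} (hT₀ : ∀ k i, T₀.pattern k i = if i < k then lam.rowLen i else 0)
    (T : GT lam n) (hT : v T ≠ 0) : T = T₀ := by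
  have key : ∀ k, ∀ T, v T ≠ 0 → ∀ m, m < k → ∀ i, i < m →
      T.pattern m i = T.pattern (m + 1) i := by
    intro k
    induction k with
    | zero => exact fun _ _ m hm => absurd hm (Nat.not_lt_zero m)
    | succ k ih =>
      intro T hT m hm i hi
      rcases (Nat.lt_succ_iff.1 hm).lt_or_eq with hm | rfl
      · exact ih T hT m hm i hi
      by_contra hne
      have hmn : m < n := by
        by_contra hc
        rw [T.pattern_eq_rowLen (by omega), T.pattern_eq_rowLen (by omega)] at hne
        exact hne rfl
      have hex : ∃ i, i < m ∧ T.pattern m i ≠ T.pattern (m + 1) i := ⟨i, hi, hne⟩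
      set a := Nat.find hex with ha
      obtain ⟨ham, hane⟩ := Nat.find_spec hex
      rw [← ha] at ham hane
      have hmin : ∀ b, b < a → T.pattern m b = T.pattern (m + 1) b := by
        intro b hb
        by_contra hc
        exact Nat.find_min hex hb ⟨by omega, hc⟩
      have hlt : T.pattern m a < T.pattern (m + 1) a :=
        lt_of_le_of_ne (T.pattern_mono (Nat.le_add_right m 1) a) hane
      obtain ⟨U, hU⟩ := exists_isPatternAdd ham hmn hlt (by
        rcases Nat.eq_zero_or_pos a with h0 | h0
        · exact Or.inl h0
        · right
          have h1 := ih T hT (m - 1) (by omega) (a - 1) (by omega)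
          rw [Nat.sub_add_cancel (by omega)] at h1
          rw [h1, hmin (a - 1) (by omega)]
          exact hlt.trans_le (T.pattern_anti (m + 1) (Nat.sub_le a 1)))
      have h1 := hv ⟨m - 1, by omega⟩ U
      rw [sum_eq_single_of_mem T] at h1
      · exact mul_ne_zero hT (he _ _ _ _ hU) h1
      · refine mem_filter.2 ⟨mem_univ _, diagram_edge_iff.2 ⟨a, ?_⟩⟩
        simpa [Nat.sub_add_cancel (by omega : 1 ≤ m)] using hU
      · intro S hS hST
        by_contra hc
        have hSv : v S ≠ 0 := left_ne_zero_of_mul hc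
        obtain ⟨b, hb⟩ := diagram_edge_iff.1 (mem_filter.1 hS).2
        simp only [Nat.sub_add_cancel (by omega : 1 ≤ m)] at hb
        have hbm := hb.row_lt
        have hab : a ≠ b := by
          rintro rfl
          exact hST (hb.left_unique hU)
        have hrow : ∀ j, j < m - 1 → S.pattern m j = T.pattern m j := by
          intro j hj
          have h2 := ih S hSv (m - 1) (by omega) j hj
          have h3 := ih T hT (m - 1) (by omega) j hj
          rw [Nat.sub_add_cancel (by omega)] at h2 h3
          rw [← h2, ← h3, ← hb.pattern_of_ne (Or.inl (by omega)),
            ← hU.pattern_of_ne (Or.inl (by omega))]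
        rcases (by omega : a < m - 1 ∨ b < m - 1) with h2 | h2
        · have h3 := hrow a h2
          have h4 := hU.pattern_self
          rw [hb.pattern_of_ne (Or.inr hab)] at h4
          omega
        · have h3 := hrow b h2
          have h4 := hb.pattern_self
          rw [hU.pattern_of_ne (Or.inr hab.symm)] at h4
          omega
  refine pattern_ext fun k i => ?_
  rw [hT₀]
  split_ifs with hik
  · rcases Nat.lt_or_ge k n with hk | hk
    · have h1 : ∀ d, k + d ≤ n → T.pattern k i = T.pattern (k + d) i := by
        intro d
        induction d with
        | zero => exact fun _ => rfl
        | succ d ih =>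
          intro hd
          rw [ih (by omega), key n T hT (k + d) (by omega) i (by omega)]
          rfl
      rw [h1 (n - k) (by omega), T.pattern_eq_rowLen (by omega)]
    · exact T.pattern_eq_rowLen hk i
  · exact T.pattern_eq_zero (by omega)

theorem eq_top_of_invariant (hlam : lam.colLen 0 ≤ n) (W : Submodule ℂ (GT lam n →₀ ℂ))
    (hWX : ∀ k, ∀ w ∈ W, (diagram lam n).opX k w ∈ W)
    (hWY : ∀ k, ∀ w ∈ W, (diagram lam n).opY k w ∈ W) (hne : W ≠ ⊥) : W = ⊤ := by
  classical
  obtain ⟨T₀, hT₀⟩ := exists_highest hlam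
  refine (diagram lam n).eq_top_of_invariant (fun _ _ _ h => rank_of_edge h) T₀ ?_ ?_ W hWX hWY hne
  · intro w hw T hT
    refine eq_highest_of_killed cLabel (fun _ _ _ _ h => h.cLabel_ne_zero) w (fun k U => ?_) hT₀ T hT
    have h1 := DFunLike.congr_fun (hw k) U
    rw [LabeledDiagram.opX_apply] at h1
    exact h1
  · intro w hw T hT
    refine eq_highest_of_killed (fun T S => dLabel S T) (fun _ _ _ _ h => h.dLabel_ne_zero) w
      (fun k U => ?_) hT₀ T hT
    have h1 := DFunLike.congr_fun (hw k) U
    rw [LabeledDiagram.opX_apply] at h1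
    exact h1

end GT

/-! ### Serre relations in finite-dimensional representations -/

/-- In a finite-dimensional `sl₂`-module, a vector of weight `c` killed by the raising operator is
killed by the `(c + 1)`-st power of the lowering operator; here the module is `End V` with the
adjoint action. -/
theorem toEnd_pow_eq_zero_of_sl2 {V : Type*} [AddCommGroup V] [Module ℂ V] [FiniteDimensional ℂ V]
    {h e f x : Module.End ℂ V} (hef : e * f - f * e = h) (hhe : h * e - e * h = 2 • e)
    (hhf : h * f - f * h = -(2 • f)) (hex : e * x - x * e = 0) {c : ℕ}
    (hhx : h * x - x * h = (c : ℂ) • x) :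
    (LieModule.toEnd ℂ (Module.End ℂ V) (Module.End ℂ V) f ^ (c + 1)) x = 0 := by
  -- An `IsSl2Triple` has `h ≠ 0`; if `h = 0`, then also `f = 0`.
  by_cases hh : h = 0
  · have hf : (2 : ℕ) • f = 0 := by
      rw [hh, zero_mul, mul_zero, sub_zero] at hhf
      rw [← neg_eq_zero, ← hhf]
    have hf' : f = 0 := by
      rw [← Nat.cast_smul_eq_nsmul ℂ] at hf
      exact (smul_eq_zero.1 hf).resolve_left (by norm_num)
    rw [hf', map_zero, zero_pow (Nat.succ_ne_zero c), LinearMap.zero_apply]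
  by_cases hx : x = 0
  · rw [hx, map_zero]
  have t : IsSl2Triple h e f := ⟨hh, hef, hhe, hhf⟩
  have P : t.HasPrimitiveVectorWith x (c : ℂ) := ⟨hx, hhx, hex⟩
  exact P.pow_toEnd_f_eq_zero_of_eq_nat rfl

/-- The eigenvalue of `ad E_{i+1,i+1}` on `E_{j+1,j+2}`. -/
noncomputable def rootCoeff (i j : ℕ) : ℂ := (if i = j then 1 else 0) - if i = j + 1 then 1 else 0

/-- The extension of a family indexed by `Fin N` by zero to all natural numbers. -/
def extendByZero {A : Type*} [Zero A] {N : ℕ} (X : Fin N → A) (k : ℕ) : A :=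
  if hk : k < N then X ⟨k, hk⟩ else 0

theorem extendByZero_val {A : Type*} [Zero A] {N : ℕ} (X : Fin N → A) (k : Fin N) :
    extendByZero X k = X k :=
  dif_pos k.2

section Serre

variable {V : Type*} [AddCommGroup V] [Module ℂ V] {n : ℕ} {W : ℕ → Module.End ℂ V}
  {X Y : Fin (n - 1) → Module.End ℂ V}

theorem sub_mul_sub_mul_sub {A : Type*} [Ring A] (a b x : A) :
    (a - b) * x - x * (a - b) = (a * x - x * a) - (b * x - x * b) := by
  noncomm_ring

theorem rootCoeff_sub_self (k : ℕ) : rootCoeff k k - rootCoeff (k + 1) k = 2 := by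
  simp [rootCoeff]
  norm_num

/-- The Serre relations for the raising operators follow from the representation theory of `sl₂`,
applied to the adjoint action of the triple of the color `k` on `End V`. -/
theorem toEnd_raising_pow_eq_zero [FiniteDimensional ℂ V]
    (hWX : ∀ i k, W i * X k - X k * W i = rootCoeff i k • X k)
    (hWY : ∀ i k, W i * Y k - Y k * W i = -(rootCoeff i k • Y k))
    (hXY : ∀ k m, X k * Y m - Y m * X k = if k = m then W k - W (k + 1) else 0)
    {k m : Fin (n - 1)} (hkm : k ≠ m) {c : ℕ}
    (hc : rootCoeff k m - rootCoeff (k + 1) m = -(c : ℂ)) :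
    (LieModule.toEnd ℂ (Module.End ℂ V) (Module.End ℂ V) (X k) ^ (c + 1)) (X m) = 0 := by
  have h1 := hXY k k
  have h2 := hXY m k
  rw [if_pos rfl] at h1
  rw [if_neg hkm.symm] at h2
  have hneg : ∀ x : Module.End ℂ V, -(W k - W (k + 1)) * x - x * -(W k - W (k + 1)) =
      -((W k * x - x * W k) - (W (k + 1) * x - x * W (k + 1))) := fun x => by noncomm_ring
  refine toEnd_pow_eq_zero_of_sl2 (h := -(W k - W (k + 1))) (e := Y k) ?_ ?_ ?_ ?_ ?_
  · rw [← h1, neg_sub]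
  · rw [hneg, hWY, hWY, neg_sub_neg, neg_sub, ← sub_smul, rootCoeff_sub_self, ofNat_smul_eq_nsmul]
  · rw [hneg, hWX, hWX, ← sub_smul, rootCoeff_sub_self, ofNat_smul_eq_nsmul]
  · rw [← neg_sub, h2, neg_zero]
  · rw [hneg, hWX, hWX, ← sub_smul, hc, neg_smul, neg_neg]

/-- The Serre relations for the lowering operators. -/
theorem toEnd_lowering_pow_eq_zero [FiniteDimensional ℂ V]
    (hWX : ∀ i k, W i * X k - X k * W i = rootCoeff i k • X k)
    (hWY : ∀ i k, W i * Y k - Y k * W i = -(rootCoeff i k • Y k))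
    (hXY : ∀ k m, X k * Y m - Y m * X k = if k = m then W k - W (k + 1) else 0)
    {k m : Fin (n - 1)} (hkm : k ≠ m) {c : ℕ}
    (hc : rootCoeff k m - rootCoeff (k + 1) m = -(c : ℂ)) :
    (LieModule.toEnd ℂ (Module.End ℂ V) (Module.End ℂ V) (Y k) ^ (c + 1)) (Y m) = 0 := by
  have h1 := hXY k k
  have h2 := hXY k m
  rw [if_pos rfl] at h1
  rw [if_neg hkm] at h2
  refine toEnd_pow_eq_zero_of_sl2 (h := W k - W (k + 1)) (e := X k) h1 ?_ ?_ h2 ?_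
  · rw [sub_mul_sub_mul_sub, hWX, hWX, ← sub_smul, rootCoeff_sub_self, ofNat_smul_eq_nsmul]
  · rw [sub_mul_sub_mul_sub, hWY, hWY, neg_sub_neg, ← neg_sub, ← sub_smul, rootCoeff_sub_self,
      ofNat_smul_eq_nsmul]
  · rw [sub_mul_sub_mul_sub, hWY, hWY, neg_sub_neg, ← neg_sub, ← sub_smul, hc, neg_smul, neg_neg]

theorem isGlChevalleySystem_of_finiteDimensional [FiniteDimensional ℂ V]
    (hWW : ∀ i j, W i * W j - W j * W i = 0)
    (hWX : ∀ i k, W i * X k - X k * W i = rootCoeff i k • X k)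
    (hWY : ∀ i k, W i * Y k - Y k * W i = -(rootCoeff i k • Y k))
    (hXY : ∀ k m, X k * Y m - Y m * X k = if k = m then W k - W (k + 1) else 0) :
    IsGlChevalleySystem n W (extendByZero X) (extendByZero Y) := by
  have hfin : ∀ i, i + 1 < n → ∃ k : Fin (n - 1), (k : ℕ) = i := fun i hi => ⟨⟨i, by omega⟩, rfl⟩
  have hfar : ∀ k m : Fin (n - 1), (k : ℕ) + 1 < m →
      rootCoeff k m - rootCoeff (k + 1) m = -((0 : ℕ) : ℂ) := by
    intro k m h
    rw [rootCoeff, rootCoeff, if_neg (by omega), if_neg (by omega), if_neg (by omega),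
      if_neg (by omega)]
    simp
  have hnear : ∀ k m : Fin (n - 1), (m : ℕ) = k + 1 →
      rootCoeff k m - rootCoeff (k + 1) m = -((1 : ℕ) : ℂ) := by
    intro k m h
    rw [rootCoeff, rootCoeff, if_neg (by omega), if_neg (by omega), if_pos (by omega),
      if_neg (by omega)]
    simp
  have hnear' : ∀ k m : Fin (n - 1), (k : ℕ) = m + 1 →
      rootCoeff k m - rootCoeff (k + 1) m = -((1 : ℕ) : ℂ) := by
    intro k m h
    rw [rootCoeff, rootCoeff, if_neg (by omega), if_pos (by omega), if_neg (by omega),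
      if_neg (by omega)]
    simp
  refine ⟨?_, ?_, ?_, ?_, ?_, ?_, ?_, ?_, ?_, ?_⟩
  · intro i j _ _
    exact hWW i j
  · intro i j _ hj
    obtain ⟨k, rfl⟩ := hfin j hj
    rw [extendByZero_val]
    refine (hWX i k).trans ?_
    rw [rootCoeff, sub_smul, ite_smul, ite_smul, one_smul, zero_smul]
  · intro i j _ hj
    obtain ⟨k, rfl⟩ := hfin j hj
    rw [extendByZero_val]
    refine (hWY i k).trans ?_
    rw [rootCoeff, sub_smul, ite_smul, ite_smul, one_smul, zero_smul, neg_sub]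
  · intro i j hi hj
    obtain ⟨k, rfl⟩ := hfin i hi
    obtain ⟨m, rfl⟩ := hfin j hj
    rw [extendByZero_val, extendByZero_val]
    refine (hXY k m).trans ?_
    simp only [Fin.ext_iff]
  · intro i j hj hij
    obtain ⟨k, rfl⟩ := hfin i (by omega)
    obtain ⟨m, rfl⟩ := hfin j hj
    rw [extendByZero_val, extendByZero_val]
    have h := toEnd_raising_pow_eq_zero hWX hWY hXY (by rintro rfl; omega : k ≠ m) (hfar k m hij)
    rw [zero_add, pow_one] at h
    exact h
  · intro i j hj hij
    obtain ⟨k, rfl⟩ := hfin i (by omega)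
    obtain ⟨m, rfl⟩ := hfin j hj
    rw [extendByZero_val, extendByZero_val]
    have h := toEnd_lowering_pow_eq_zero hWX hWY hXY (by rintro rfl; omega : k ≠ m) (hfar k m hij)
    rw [zero_add, pow_one] at h
    exact h
  · intro i hi
    obtain ⟨k, hk⟩ := hfin i (by omega)
    obtain ⟨m, hm⟩ := hfin (i + 1) (by omega)
    have h := toEnd_raising_pow_eq_zero hWX hWY hXY (by rintro rfl; omega : k ≠ m)
      (hnear k m (by omega))
    rw [pow_succ, pow_one, ← extendByZero_val X k, ← extendByZero_val X m, hk, hm] at h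
    exact h
  · intro i hi
    obtain ⟨k, hk⟩ := hfin (i + 1) (by omega)
    obtain ⟨m, hm⟩ := hfin i (by omega)
    have h := toEnd_raising_pow_eq_zero hWX hWY hXY (by rintro rfl; omega : k ≠ m)
      (hnear' k m (by omega))
    rw [pow_succ, pow_one, ← extendByZero_val X k, ← extendByZero_val X m, hk, hm] at h
    exact h
  · intro i hi
    obtain ⟨k, hk⟩ := hfin i (by omega)
    obtain ⟨m, hm⟩ := hfin (i + 1) (by omega)
    have h := toEnd_lowering_pow_eq_zero hWX hWY hXY (by rintro rfl; omega : k ≠ m)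
      (hnear k m (by omega))
    rw [pow_succ, pow_one, ← extendByZero_val Y k, ← extendByZero_val Y m, hk, hm] at h
    exact h
  · intro i hi
    obtain ⟨k, hk⟩ := hfin (i + 1) (by omega)
    obtain ⟨m, hm⟩ := hfin i (by omega)
    have h := toEnd_lowering_pow_eq_zero hWX hWY hXY (by rintro rfl; omega : k ≠ m)
      (hnear' k m (by omega))
    rw [pow_succ, pow_one, ← extendByZero_val Y k, ← extendByZero_val Y m, hk, hm] at h
    exact h

end Serre

/-! ### The representation of `gl_n` -/

namespace GT

variable {lam : YoungDiagram} {n : ℕ}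

/-- The eigenvalue of `E_{k+1,k+1}` on the basis vector of `T`: the number of entries `k + 1`. -/
def weight (T : GT lam n) (k : ℕ) : ℤ := T.rowSum (k + 1) - T.rowSum k

variable (lam n) in
/-- The diagonal operator `E_{k+1,k+1}`. -/
noncomputable def opWeight (k : ℕ) : Module.End ℂ (GT lam n →₀ ℂ) :=
  Finsupp.linearCombination ℂ fun T => Finsupp.single T (T.weight k : ℂ)

theorem opWeight_single (k : ℕ) (T : GT lam n) (a : ℂ) :
    opWeight lam n k (Finsupp.single T a) = Finsupp.single T (a * T.weight k) := by
  rw [opWeight, Finsupp.linearCombination_single, Finsupp.smul_single, smul_eq_mul]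

theorem opWeight_apply (k : ℕ) (v : GT lam n →₀ ℂ) (T : GT lam n) :
    opWeight lam n k v T = T.weight k * v T := by
  classical
  induction v using Finsupp.induction_linear with
  | zero => simp
  | add f g hf hg => rw [map_add, Finsupp.add_apply, hf, hg, Finsupp.add_apply, mul_add]
  | single S a =>
    rw [opWeight_single, Finsupp.single_apply, Finsupp.single_apply]
    split_ifs with h
    · rw [h, mul_comm]
    · rw [mul_zero]

theorem weight_of_edge {k : Fin (n - 1)} {S T : GT lam n} (h : (diagram lam n).edge k S T) (i : ℕ) :
    (T.weight i : ℂ) = S.weight i + rootCoeff i k := by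
  obtain ⟨j, h⟩ := diagram_edge_iff.1 h
  rw [weight, weight, rootCoeff, h.rowSum_eq, h.rowSum_eq]
  simp only [Nat.add_right_cancel_iff]
  push_cast
  ring

theorem opWeight_mul_opX_sub (i : ℕ) (k : Fin (n - 1)) :
    opWeight lam n i * (diagram lam n).opX k - (diagram lam n).opX k * opWeight lam n i =
      rootCoeff i k • (diagram lam n).opX k := by
  classical
  refine LinearMap.ext fun v => Finsupp.ext fun T => ?_
  rw [LinearMap.sub_apply, Module.End.mul_apply, Module.End.mul_apply, Finsupp.sub_apply,
    LinearMap.smul_apply, Finsupp.smul_apply, opWeight_apply, LabeledDiagram.opX_apply,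
    LabeledDiagram.opX_apply, mul_sum, ← sum_sub_distrib, smul_eq_mul, mul_sum]
  refine sum_congr rfl fun S hS => ?_
  rw [opWeight_apply, weight_of_edge (mem_filter.1 hS).2]
  ring

theorem opWeight_mul_opY_sub (i : ℕ) (k : Fin (n - 1)) :
    opWeight lam n i * (diagram lam n).opY k - (diagram lam n).opY k * opWeight lam n i =
      -(rootCoeff i k • (diagram lam n).opY k) := by
  classical
  refine LinearMap.ext fun v => Finsupp.ext fun S => ?_
  rw [LinearMap.sub_apply, Module.End.mul_apply, Module.End.mul_apply, Finsupp.sub_apply,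
    LinearMap.neg_apply, Finsupp.neg_apply,
    LinearMap.smul_apply, Finsupp.smul_apply, opWeight_apply, LabeledDiagram.opY_apply,
    LabeledDiagram.opY_apply, mul_sum, ← sum_sub_distrib, smul_eq_mul, mul_sum, ← sum_neg_distrib]
  refine sum_congr rfl fun T hT => ?_
  rw [opWeight_apply, weight_of_edge (mem_filter.1 hT).2]
  ring

theorem opWeight_mul_opWeight_sub (i j : ℕ) :
    opWeight lam n i * opWeight lam n j - opWeight lam n j * opWeight lam n i = 0 := by
  refine LinearMap.ext fun v => Finsupp.ext fun T => ?_
  rw [LinearMap.sub_apply, Module.End.mul_apply, Module.End.mul_apply, Finsupp.sub_apply,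
    opWeight_apply, opWeight_apply, opWeight_apply, opWeight_apply, LinearMap.zero_apply,
    Finsupp.zero_apply]
  ring

theorem opH_eq (k : Fin (n - 1)) :
    (diagram lam n).opH k = opWeight lam n k - opWeight lam n (k + 1) := by
  refine Finsupp.lhom_ext fun T a => ?_
  rw [LabeledDiagram.opH_single, LinearMap.sub_apply, opWeight_single, opWeight_single,
    ← Finsupp.single_sub, diagram_m, ← mul_sub, weight, weight]
  push_cast
  congr 2
  ring

theorem opX_mul_opY_sub_eq (k m : Fin (n - 1)) :
    (diagram lam n).opX k * (diagram lam n).opY m - (diagram lam n).opY m * (diagram lam n).opX k =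
      if k = m then opWeight lam n k - opWeight lam n (k + 1) else 0 := by
  rw [(diagram lam n).opX_mul_opY_sub isRankedPoset crossingCondition diamondCondition, opH_eq]

theorem isGlChevalleySystem :
    IsGlChevalleySystem n (opWeight lam n) (extendByZero (diagram lam n).opX)
      (extendByZero (diagram lam n).opY) :=
  isGlChevalleySystem_of_finiteDimensional opWeight_mul_opWeight_sub opWeight_mul_opX_sub
    opWeight_mul_opY_sub opX_mul_opY_sub_eq

/-- The representation of `gl_n` on the space with basis the tableaux. -/
theorem exists_glRep : ∃ ψ : Matrix (Fin n) (Fin n) ℂ →ₗ⁅ℂ⁆ Module.End ℂ (GT lam n →₀ ℂ),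
    (∀ k : Fin n, ψ (Matrix.single k k 1) = opWeight lam n k) ∧
    (∀ k : Fin (n - 1), ψ (Matrix.single (lowIdx k) (highIdx k) 1) = (diagram lam n).opX k) ∧
    ∀ k : Fin (n - 1), ψ (Matrix.single (highIdx k) (lowIdx k) 1) = (diagram lam n).opY k := by
  have : IsAddTorsionFree (Module.End ℂ (GT lam n →₀ ℂ)) := .of_isTorsionFree ℂ _
  obtain ⟨E, hE, hd, hu, hl⟩ := (isGlChevalleySystem (lam := lam) (n := n)).exists_isGlSystem
  obtain ⟨ψ, hψ⟩ := hE.exists_lieHom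
  refine ⟨ψ, fun k => ?_, fun k => ?_, fun k => ?_⟩
  · rw [hψ, hd _ k.2]
  · rw [hψ, ← extendByZero_val (diagram lam n).opX k, ← hu k (by omega)]
    rfl
  · rw [hψ, ← extendByZero_val (diagram lam n).opY k, ← hl k (by omega)]
    rfl

/-! ### The Gelfand-Tsetlin basis -/

/-- The normalizing factors of the Gelfand-Tsetlin basis. They absorb the factors of the labels
`c` and `d` that come from the row `k` being extended by the entry `0` in position `k`. -/
def normalization (T : GT lam n) : ℕ :=
  ∏ k ∈ range n, ∏ i ∈ range k, (T.pattern k i + (k - 1 - i)).factorial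

theorem normalization_ne_zero (T : GT lam n) : T.normalization ≠ 0 :=
  prod_ne_zero_iff.2 fun _ _ => prod_ne_zero_iff.2 fun _ _ => Nat.factorial_ne_zero _

theorem IsPatternAdd.normalization_eq {S T : GT lam n} {k i : ℕ} (h : IsPatternAdd S T k i) :
    (T.normalization : ℂ) = S.normalization * (S.l k i + k) := by
  have hi := h.row_lt
  have h1 : T.normalization = S.normalization * (S.pattern k i + (k - i)) := by
    rw [normalization, normalization, ← mul_prod_erase _ _ (mem_range.2 h.level_lt),
      ← mul_prod_erase (range n) _ (mem_range.2 h.level_lt),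
      ← mul_prod_erase (range k) _ (mem_range.2 hi),
      ← mul_prod_erase (range k) (fun j => (S.pattern k j + (k - 1 - j)).factorial)
        (mem_range.2 hi), h.pattern_self]
    have h2 : ∏ m ∈ (range n).erase k, ∏ j ∈ range m, (T.pattern m j + (m - 1 - j)).factorial =
        ∏ m ∈ (range n).erase k, ∏ j ∈ range m, (S.pattern m j + (m - 1 - j)).factorial :=
      prod_congr rfl fun m hm => prod_congr rfl fun j _ => by
        rw [h.pattern_of_ne (Or.inl (ne_of_mem_erase hm))]
    have h3 : ∏ j ∈ (range k).erase i, (T.pattern k j + (k - 1 - j)).factorial =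
        ∏ j ∈ (range k).erase i, (S.pattern k j + (k - 1 - j)).factorial :=
      prod_congr rfl fun j hj => by
        rw [h.pattern_of_ne (Or.inr (ne_of_mem_erase hj))]
    rw [h2, h3, show S.pattern k i + 1 + (k - 1 - i) = S.pattern k i + (k - 1 - i) + 1 by omega,
      Nat.factorial_succ,
      show S.pattern k i + (k - 1 - i) + 1 = S.pattern k i + (k - i) by omega]
    ring
  rw [h1, l_eq]
  push_cast [Nat.cast_sub hi.le]
  ring

theorem l_add_ne_zero (T : GT lam n) {k i : ℕ} (hi : i < k) : T.l k i + k ≠ 0 := by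
  have h1 : T.l k i + k = ((T.pattern k i + (k - i) : ℕ) : ℂ) := by
    rw [l_eq]
    push_cast [Nat.cast_sub hi.le]
    ring
  rw [h1, Nat.cast_ne_zero]
  omega

theorem l_last (T : GT lam n) (k : ℕ) : T.l k k = -(k : ℂ) := by
  rw [l_eq, pattern_eq_zero T le_rfl, Nat.cast_zero, zero_sub]

theorem cRow_mul_eq_raiseCoeff (T : GT lam n) {k i : ℕ} (hi : i < k) :
    T.cRow k i * (T.l k i + k) = T.raiseCoeff k i := by
  have hset : (range (k + 1)).erase i = insert k ((range k).erase i) := by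
    rw [range_add_one, erase_insert_of_ne hi.ne']
  have hnum : ∏ j ∈ range (k + 1), (T.l (k + 1) j - T.l k i) =
      (-1) ^ (k + 1) * ∏ j ∈ range (k + 1), (T.l k i - T.l (k + 1) j) := by
    rw [← card_range (k + 1), ← prod_const, card_range, ← prod_mul_distrib]
    exact prod_congr rfl fun j _ => by ring
  have hden : ∏ j ∈ (range k).erase i, (T.l k j - T.l k i) =
      (-1) ^ (k - 1) * ∏ j ∈ (range k).erase i, (T.l k i - T.l k j) := by
    have hcard : #((range k).erase i) = k - 1 := by
      rw [card_erase_of_mem (mem_range.2 hi), card_range]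
    rw [← hcard, ← prod_const, ← prod_mul_distrib]
    exact prod_congr rfl fun j _ => by ring
  have hD : ∏ j ∈ (range k).erase i, (T.l k i - T.l k j) ≠ 0 :=
    prod_ne_zero_iff.2 fun j hj => T.l_sub_l_ne_zero k (ne_of_mem_erase hj).symm
  have hs : ((-1 : ℂ)) ^ (k - 1) ≠ 0 := pow_ne_zero _ (by norm_num)
  have hl := T.l_add_ne_zero hi
  rw [T.cRow_eq_div (by omega), raiseCoeff, hset, prod_insert (by simp), hnum, hden, l_last,
    show k + 1 = k - 1 + 2 by omega, pow_add, show k - 1 + 2 = k + 1 by omega,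
    show -(k : ℂ) - T.l k i = -(T.l k i + k) by ring]
  field_simp

theorem dRow_eq_lowerCoeff_mul (T : GT lam n) {k i : ℕ} (hi : i < k) :
    T.dRow k i = T.lowerCoeff k i * (T.l k i + k - 1) := by
  obtain ⟨k, rfl⟩ : ∃ k', k = k' + 1 := ⟨k - 1, by omega⟩
  rw [T.dRow_eq_div hi, lowerCoeff, prod_range_succ, l_last, Nat.add_sub_cancel]
  push_cast
  ring

open Classical in
theorem exists_basis_satisfiesGTFormulas
    (ψ : Matrix (Fin n) (Fin n) ℂ →ₗ⁅ℂ⁆ Module.End ℂ (GT lam n →₀ ℂ))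
    (hd : ∀ k : Fin n, ψ (Matrix.single k k 1) = opWeight lam n k)
    (hu : ∀ k : Fin (n - 1), ψ (Matrix.single (lowIdx k) (highIdx k) 1) = (diagram lam n).opX k)
    (hl : ∀ k : Fin (n - 1), ψ (Matrix.single (highIdx k) (lowIdx k) 1) = (diagram lam n).opY k) :
    ∃ ξ : Module.Basis (GT lam n) ℂ (GT lam n →₀ ℂ), SatisfiesGTFormulas ψ ξ := by
  have hN : ∀ T : GT lam n, (T.normalization : ℂ) ≠ 0 := fun T =>
    Nat.cast_ne_zero.2 T.normalization_ne_zero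
  let ξ : Module.Basis (GT lam n) ℂ (GT lam n →₀ ℂ) :=
    (Finsupp.basisSingleOne (R := ℂ) (ι := GT lam n)).isUnitSMul
      (w := fun T => (T.normalization : ℂ)⁻¹) fun T => (inv_ne_zero (hN T)).isUnit
  have hξ : ∀ T, ξ T = Finsupp.single T (T.normalization : ℂ)⁻¹ := by
    intro T
    simp only [ξ, Module.Basis.isUnitSMul_apply, Finsupp.coe_basisSingleOne, Finsupp.smul_single,
      smul_eq_mul, mul_one]
  refine ⟨ξ, fun k T => ?_, fun k T => ?_, fun k T => ?_⟩
  · rw [hd, hξ, opWeight_single, Finsupp.smul_single, smul_eq_mul, mul_comm, weight, rowSum, rowSum]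
    push_cast
    rfl
  · rw [hu, hξ, LabeledDiagram.opX_single, sum_edge_from]
    refine sum_congr rfl fun i hi => sum_congr rfl fun U hU => ?_
    have h := (mem_filter.1 hU).2
    have h1 := T.cRow_mul_eq_raiseCoeff h.row_lt
    have h2 := T.l_add_ne_zero h.row_lt
    rw [hξ, Finsupp.smul_single, smul_eq_mul]
    congr 1
    change _ * cLabel U T = _
    rw [h.cLabel_eq, ← h1, h.normalization_eq, mul_inv]
    field_simp [hN T]
  · rw [hl, hξ, LabeledDiagram.opY_single, sum_edge_to]
    refine sum_congr rfl fun i hi => sum_congr rfl fun S hS => ?_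
    have h := (mem_filter.1 hS).2
    have h1 := T.dRow_eq_lowerCoeff_mul h.row_lt
    have h2 := S.l_add_ne_zero h.row_lt
    rw [hξ, Finsupp.smul_single, smul_eq_mul]
    congr 1
    change _ * dLabel S T = _
    rw [h.dLabel_eq, h1, h.normalization_eq, h.l_self, mul_inv]
    have h3 := hN S
    field_simp
    ring

/-! ### Irreducibility and the highest weight -/

theorem weight_highest {T : GT lam n}
    (hT : ∀ k i, T.pattern k i = if i < k then lam.rowLen i else 0) (k : ℕ) :
    T.weight k = lam.rowLen k := by
  have h1 : ∀ k, T.rowSum k = ∑ i ∈ range k, (lam.rowLen i : ℤ) := fun k =>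
    sum_congr rfl fun i hi => by rw [hT, if_pos (mem_range.1 hi)]
  rw [weight, h1, h1, sum_range_succ]
  ring

theorem opX_highest {T : GT lam n}
    (hT : ∀ k i, T.pattern k i = if i < k then lam.rowLen i else 0) (k : Fin (n - 1)) :
    (diagram lam n).opX k (Finsupp.single T 1) = 0 := by
  classical
  rw [LabeledDiagram.opX_single]
  refine sum_eq_zero fun U hU => ?_
  obtain ⟨i, hi⟩ := diagram_edge_iff.1 (mem_filter.1 hU).2
  exact absurd hi (not_isPatternAdd_of_highest hT)

end GT

theorem theorem4p1 (n : ℕ) (lam : YoungDiagram) (hlam : lam.colLen 0 ≤ n) :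
    (GT.diagram lam n).IsRankedPoset ∧
    (GT.diagram lam n).StructureCondition (CartanMatrix.A (n - 1)) ∧
    (GT.diagram lam n).CrossingCondition ∧
    (GT.diagram lam n).DiamondCondition ∧
    (∃ φ : sl (Fin n) ℂ →ₗ⁅ℂ⁆ Module.End ℂ (GT lam n →₀ ℂ),
      (∀ k, φ (slX k) = (GT.diagram lam n).opX k ∧
        φ (slY k) = (GT.diagram lam n).opY k ∧
        φ (slH k) = (GT.diagram lam n).opH k) ∧
      IsSlIrrepOfHighestWeight lam φ ∧
      ∃ ψ : Matrix (Fin n) (Fin n) ℂ →ₗ⁅ℂ⁆ Module.End ℂ (GT lam n →₀ ℂ),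
        (∀ x : sl (Fin n) ℂ, ψ x.1 = φ x) ∧
        IsGlIrrepOfHighestWeight lam ψ ∧
        ∃ ξ : Module.Basis (GT lam n) ℂ (GT lam n →₀ ℂ), GT.SatisfiesGTFormulas ψ ξ) ∧
    (∀ (N : ℕ) (x y : Fin N → ℂ), Function.Injective x →
      ∑ i, y i * ∏ j ∈ univ.erase i, (1 + y j / (x j - x i)) = ∑ i, y i) := by
  refine ⟨GT.isRankedPoset, GT.structureCondition, GT.crossingCondition, GT.diamondCondition, ?_,
    fun N x y hx => sum_mul_prod_one_add_div_of_injOn univ x y hx.injOn⟩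
  obtain ⟨T₀, hT₀⟩ := GT.exists_highest hlam
  obtain ⟨ψ, hd, hu, hl⟩ := GT.exists_glRep (lam := lam) (n := n)
  have hne : Finsupp.single T₀ (1 : ℂ) ≠ 0 := by simp
  have : Nonempty (GT lam n) := ⟨T₀⟩
  let φ : sl (Fin n) ℂ →ₗ⁅ℂ⁆ Module.End ℂ (GT lam n →₀ ℂ) := ψ.comp (sl (Fin n) ℂ).incl
  have hφX : ∀ k, φ (slX k) = (GT.diagram lam n).opX k := hu
  have hφY : ∀ k, φ (slY k) = (GT.diagram lam n).opY k := hl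
  have hφH : ∀ k, φ (slH k) = (GT.diagram lam n).opH k := by
    intro k
    have h1 : φ (slH k) = ψ (Matrix.single (lowIdx k) (lowIdx k) 1 -
        Matrix.single (highIdx k) (highIdx k) 1) := rfl
    rw [h1, map_sub, hd, hd, GT.opH_eq]
    rfl
  refine ⟨φ, fun k => ⟨hφX k, hφY k, hφH k⟩, ⟨?_, Finsupp.single T₀ 1, hne, ?_, ?_⟩, ψ,
    fun _ => rfl, ⟨?_, Finsupp.single T₀ 1, hne, ?_, ?_⟩,
    GT.exists_basis_satisfiesGTFormulas ψ hd hu hl⟩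
  · refine isIrreducibleRep_of_forall_eq_top φ fun W hW => GT.eq_top_of_invariant hlam W ?_ ?_
    · exact fun k w hw => hφX k ▸ hW (slX k) w hw
    · exact fun k w hw => hφY k ▸ hW (slY k) w hw
  · intro k
    rw [hφX, GT.opX_highest hT₀]
  · intro k
    rw [hφH, LabeledDiagram.opH_single, GT.diagram_m, one_mul, Finsupp.smul_single, smul_eq_mul,
      mul_one]
    have h1 := GT.weight_highest hT₀ k
    have h2 := GT.weight_highest hT₀ (k + 1)
    rw [GT.weight] at h1 h2
    congr 1
    rw [show 2 * T₀.rowSum (k + 1) - T₀.rowSum k - T₀.rowSum (k + 2) =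
      (T₀.rowSum (k + 1) - T₀.rowSum k) - (T₀.rowSum (k + 1 + 1) - T₀.rowSum (k + 1)) by ring,
      h1, h2]
    push_cast
    rfl
  · refine isIrreducibleRep_of_forall_eq_top ψ fun W hW => GT.eq_top_of_invariant hlam W ?_ ?_
    · exact fun k w hw => hu k ▸ hW _ w hw
    · exact fun k w hw => hl k ▸ hW _ w hw
  · intro k
    rw [hu, GT.opX_highest hT₀]
  · intro k
    rw [hd, GT.opWeight_single, GT.weight_highest hT₀, one_mul, Finsupp.smul_single, smul_eq_mul,
      mul_one]
    rfl
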